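/- Nets are indexed by $\varepsilon\in(0,1]$, and all $O$-estimates are as $\varepsilon\to0$. Let $\widetilde{\mathbb C}$ (resp. $\widetilde{\mathbb R}$) be the ring of complex (resp. real) generalized numbers: nets of scalars that are $O(\varepsilon^{-N})$ for some $N\in\mathbb N$, modulo nets that are $O(\varepsilon^q)$ for all $q\in\mathbb N$. For $\Omega\subseteq\mathbb R^n$ open, $K\Subset\Omega$ and $j\in\mathbb N$ put $p_{K,j}(f)=\sup_{x\in K,|\alpha|\le j}|\partial^\alpha f(x)|$. Let $\mathcal E_M(\Omega)$ be the set of nets $(u_\varepsilon)_\varepsilon$ in $C^\infty(\Omega)$ such that for all $K\Subset\Omega$ and all $j$ there is $N$ with $p_{K,j}(u_\varepsilon)=O(\varepsilon^{-N})$; let $\mathcal E_M^\infty(\Omega)$ be the set of those for which, for every $K$, one $N$ can be chosen independently of $j$; and let $\mathcal N(\Omega)$ be the set of those with $p_{K,j}(u_\varepsilon)=O(\varepsilon^q)$ for all $K$, $j$, $q$. Then $\mathcal G(\Omega)=\mathcal E_M(\Omega)/\mathcal N(\Omega)$ and $\mathcal G^\infty(\Omega)=\mathcal E_M^\infty(\Omega)/\mathcal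 N(\Omega)$, and $\mathcal G_c(\Omega)$ is the $\widetilde{\mathbb C}$-module of generalized functions with compact support in $\Omega$, i.e. of the classes of nets in $\mathcal E_M(\Omega)$ whose supports lie in one compact subset of $\Omega$; below, representatives $(u_\varepsilon)_\varepsilon$ of $u\in\mathcal G_c(\Omega)$ are taken of this kind. Let $\mathcal L(\mathcal G_c(\Omega),\widetilde{\mathbb C})$ be the space of continuous $\widetilde{\mathbb C}$-linear functionals on $\mathcal G_c(\Omega)$. Here $T$ is continuous if for every $K\Subset\Omega$ there are $j\in\mathbb N$ and $c\in\mathbb R$ with $\mathrm{val}_{K,j}(u)\le \mathrm{val}(Tu)+c$ for all $u$ with a representative supported in $K$, where $\mathrm{val}_{K,j}(u)=\sup\{b\in\mathbb R: p_{K,j}(u_\varepsilon)=O(\varepsilon^b)\}$ and $\mathrm{val}([(z_\varepsilon)])=\sup\{b\in\mathbb R: |z_\varepsilon|=O(\varepsilon^b)\}$. Such a functional $T$ is *basic* if there are distributions $T_\varepsilon\in\mathcal D'(\Omega)$ such that $Tu=[(T_\varepsilon u_\varepsilon)_\varepsilon]$ for all $u\in\mathcal G_c(\Omega)$, and for every $K\Subset\Omega$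 there are $j,N\in\mathbb N$, $c>0$, $\eta\in(0,1]$ with $|T_\varepsilon f|\le c\,\varepsilon^{-N}p_{K,j}(f)$ for all $f\in C^\infty$ supported in $K$ and all $\varepsilon\in(0,\eta]$. The restriction $T|_V$ to an open $V\subseteq\Omega$ is obtained by applying $T$ to extensions by zero. The spaces $\mathcal G^\infty(\Omega)\subseteq\mathcal G(\Omega)$ are regarded as subspaces of $\mathcal L(\mathcal G_c(\Omega),\widetilde{\mathbb C})$ through $g\mapsto\bigl(u\mapsto[(\int_\Omega g_\varepsilon u_\varepsilon\,dx)_\varepsilon]\bigr)$. For $\mathcal R\in\{\mathcal G,\mathcal G^\infty\}$ the set $\mathrm{sing\,supp}_{\mathcal R}\,T$ consists of the points $x\in\Omega$ that have no open neighbourhood $V\subseteq\Omega$ with $T|_V\in\mathcal R(V)$. Let $\iota_d(\delta)(u)=[(u_\varepsilon(0))_\varepsilon]$ for $u\in\mathcal G_c(\mathbb R^n)$. Let $P(\xi)=\sum_{|\alpha|\le m}c_\alpha\xi^\alpha$ be a polynomial with coefficients $c_\alpha\in\widetilde{\mathbb C}$, let $P(D)=\sum_{|\alpha|\le m} c_\alpha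 D^\alpha$ with $D_k=-i\partial_k$ and $(\partial_kT)(u)=-T(\partial_ku)$, and let $\widetilde P:\mathbb R^n\to\widetilde{\mathbb R}$ be given by $\widetilde P^2(\xi)=\sum_{|\alpha|\le m}|\partial^\alpha P(\xi)|^2$. For $\mathcal R\in\{\mathcal G,\mathcal G^\infty\}$, $P(D)$ is *$\mathcal R$-hypoelliptic* if $\mathrm{sing\,supp}_{\mathcal R}P(D)T=\mathrm{sing\,supp}_{\mathcal R}T$ for all open $\Omega\subseteq\mathbb R^n$ and all basic $T\in\mathcal L(\mathcal G_c(\Omega),\widetilde{\mathbb C})$. A *fundamental solution* of $P(D)$ is an $E\in\mathcal L(\mathcal G_c(\mathbb R^n),\widetilde{\mathbb C})$ with $P(D)E=\iota_d(\delta)$; an *$\mathcal R$-parametrix* is a basic $F\in\mathcal L(\mathcal G_c(\mathbb R^n),\widetilde{\mathbb C})$ with $P(D)F-\iota_d(\delta)\in\mathcal R(\mathbb R^n)$. **Theorem.** Assume that $\widetilde P(\xi_0)$ is invertible in $\widetilde{\mathbb R}$ for some $\xi_0\in\mathbb R^n$. Then the following are equivalent: (i) $P(D)$ is $\mathcal G$-hypoelliptic;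 (ii) $P(D)$ has a basic fundamental solution $E$ with $\mathrm{sing\,supp}_{\mathcal G}E\subseteq\{0\}$; (iii) $P(D)$ has a $\mathcal G$-parametrix $F$ with $\mathrm{sing\,supp}_{\mathcal G}F\subseteq\{0\}$. The same equivalence holds with $\mathcal G^\infty$ in place of $\mathcal G$ throughout (in hypoellipticity, singular supports and parametrix). -/

import Mathlib

open scoped Distributions ContDiff Topology
open TopologicalSpace Filter Asymptotics

noncomputable section

namespace Colombeau

/-! ### Nets, moderateness, negligibility -/

/-- The index set `(0, 1]` of all nets. -/
abbrev Idx : Type := Set.Ioc (0 : ℝ) 1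

/-- The filter "`ε → 0`" on `(0, 1]`. -/
def atZero : Filter Idx := comap Subtype.val (𝓝 (0 : ℝ))

/-- `u_ε = O(ε^{-N})` as `ε → 0`, for some natural number `N`. -/
def IsModerate {F : Type*} [NormedAddCommGroup F] (u : Idx → F) : Prop :=
  ∃ N : ℕ, u =O[atZero] fun ε => ((ε : ℝ)⁻¹) ^ N

/-- `u_ε = O(ε^q)` as `ε → 0`, for all natural numbers `q`. -/
def IsNegligible {F : Type*} [NormedAddCommGroup F] (u : Idx → F) : Prop :=
  ∀ q : ℕ, u =O[atZero] fun ε => (ε : ℝ) ^ q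

section NetLemmas

variable {F G : Type*} [NormedAddCommGroup F] [NormedAddCommGroup G]

theorem isBigO_inv_pow {M N : ℕ} (h : M ≤ N) :
    (fun ε : Idx => ((ε : ℝ)⁻¹) ^ M) =O[atZero] fun ε => ((ε : ℝ)⁻¹) ^ N := by
  refine IsBigO.of_bound 1 (Eventually.of_forall fun ε => ?_)
  have h0 : (0 : ℝ) < ε := ε.2.1
  have h1 : (1 : ℝ) ≤ (ε : ℝ)⁻¹ := (one_le_inv₀ h0).2 ε.2.2
  rw [one_mul, Real.norm_of_nonneg (by positivity), Real.norm_of_nonneg (by positivity)]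
  exact pow_le_pow_right₀ h1 h

theorem IsModerate.add {u v : Idx → F} (hu : IsModerate u) (hv : IsModerate v) :
    IsModerate (fun ε => u ε + v ε) := by
  obtain ⟨M, hM⟩ := hu
  obtain ⟨N, hN⟩ := hv
  exact ⟨max M N, (hM.trans (isBigO_inv_pow (le_max_left _ _))).add
    (hN.trans (isBigO_inv_pow (le_max_right _ _)))⟩

theorem IsModerate.of_le {u : Idx → F} {v : Idx → G} (hv : IsModerate v)
    (h : ∀ ε, ‖u ε‖ ≤ ‖v ε‖) : IsModerate u := by
  obtain ⟨N, hN⟩ := hv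
  exact ⟨N, (IsBigO.of_norm_le (g := fun ε => ‖v ε‖) h).trans hN.norm_left⟩

theorem IsModerate.mul {R : Type*} [NormedRing R] {u v : Idx → R}
    (hu : IsModerate u) (hv : IsModerate v) : IsModerate (fun ε => u ε * v ε) := by
  obtain ⟨M, hM⟩ := hu
  obtain ⟨N, hN⟩ := hv
  refine ⟨M + N, ?_⟩
  simpa only [pow_add] using hM.mul hN

theorem isModerate_const (c : F) : IsModerate (fun _ : Idx => c) := by
  refine ⟨0, ?_⟩
  simpa using isBigO_const_const c (one_ne_zero (α := ℝ)) atZero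

theorem isNegligible_zero : IsNegligible (fun _ : Idx => (0 : F)) :=
  fun _ => isBigO_zero _ _

theorem IsNegligible.add {u v : Idx → F} (hu : IsNegligible u) (hv : IsNegligible v) :
    IsNegligible (fun ε => u ε + v ε) :=
  fun q => (hu q).add (hv q)

theorem IsNegligible.of_le {u : Idx → F} {v : Idx → G} (hv : IsNegligible v)
    (h : ∀ ε, ‖u ε‖ ≤ ‖v ε‖) : IsNegligible u :=
  fun q => (IsBigO.of_norm_le (g := fun ε => ‖v ε‖) h).trans (hv q).norm_left

theorem IsModerate.mul_isNegligible {R : Type*} [NormedRing R] {u v : Idx → R}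
    (hu : IsModerate u) (hv : IsNegligible v) : IsNegligible (fun ε => u ε * v ε) := by
  obtain ⟨M, hM⟩ := hu
  intro q
  refine (hM.mul (hv (q + M))).trans (IsBigO.of_bound 1 (Eventually.of_forall fun ε => ?_))
  have h0 : (0 : ℝ) < ε := ε.2.1
  rw [one_mul, pow_add, inv_pow, mul_comm, mul_assoc, mul_inv_cancel₀ (by positivity), mul_one]

end NetLemmas

/-! ### Generalized numbers -/

/-- The ring of moderate nets of scalars. -/
def moderateNets (𝕜 : Type) [RCLike 𝕜] : Subring (Idx → 𝕜) where
  carrier := {r | IsModerate r}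
  mul_mem' hu hv := hu.mul hv
  one_mem' := isModerate_const 1
  add_mem' hu hv := hu.add hv
  zero_mem' := isModerate_const 0
  neg_mem' hu := IsModerate.of_le hu fun ε => by simp

/-- The ideal of negligible nets of scalars. -/
def negligibleNets (𝕜 : Type) [RCLike 𝕜] : Ideal (moderateNets 𝕜) where
  carrier := {r | IsNegligible (r : Idx → 𝕜)}
  zero_mem' := isNegligible_zero
  add_mem' hu hv := hu.add hv
  smul_mem' c _ hu := IsModerate.mul_isNegligible c.2 hu

/-- The ring of generalized numbers over `𝕜`. -/
def GenNum (𝕜 : Type) [RCLike 𝕜] : Type := moderateNets 𝕜 ⧸ negligibleNets 𝕜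

instance (𝕜 : Type) [RCLike 𝕜] : CommRing (GenNum 𝕜) :=
  inferInstanceAs (CommRing (moderateNets 𝕜 ⧸ negligibleNets 𝕜))

/-- The class of a moderate net. -/
def GenNum.mk {𝕜 : Type} [RCLike 𝕜] : moderateNets 𝕜 →+* GenNum 𝕜 :=
  Ideal.Quotient.mk (negligibleNets 𝕜)

/-- The class of a constant net. -/
def GenNum.const {𝕜 : Type} [RCLike 𝕜] (c : 𝕜) : GenNum 𝕜 :=
  GenNum.mk ⟨fun _ => c, isModerate_const c⟩

/-- The ring of complex generalized numbers. -/
abbrev GenC : Type := GenNum ℂ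

/-- The ring of real generalized numbers. -/
abbrev GenR : Type := GenNum ℝ

/-- The net `r` is moderate, and its class is `z`. -/
def Represents {𝕜 : Type} [RCLike 𝕜] (r : Idx → 𝕜) (z : GenNum 𝕜) : Prop :=
  ∃ h : r ∈ moderateNets 𝕜, GenNum.mk ⟨r, h⟩ = z

/-- The valuation of a net of reals: the supremum of all `b` with `r_ε = O(ε^b)`. -/
def netVal (r : Idx → ℝ) : EReal :=
  sSup {b : EReal | ∃ a : ℝ, b = a ∧ r =O[atZero] fun ε => (ε : ℝ) ^ a}

/-- The valuation of a generalized number (the supremum does not depend on the representative). -/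
def GenNum.val {𝕜 : Type} [RCLike 𝕜] (z : GenNum 𝕜) : EReal :=
  sSup {b : EReal | ∃ r : Idx → 𝕜, Represents r z ∧ b = netVal (fun ε => ‖r ε‖)}

/-- The absolute value `|[(z_ε)]| = [(|z_ε|)]`. -/
def GenNum.abs : GenC → GenR :=
  Quotient.map' (s₁ := Submodule.quotientRel _) (s₂ := Submodule.quotientRel _)
    (fun z : moderateNets ℂ => (⟨fun ε => ‖z.1 ε‖, z.2.of_le fun ε => by simp⟩ : moderateNets ℝ))
    (by
      intro z w h
      rw [Submodule.quotientRel_def] at h ⊢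
      exact IsNegligible.of_le (v := fun ε => z.1 ε - w.1 ε) h
        fun ε => abs_norm_sub_norm_le (z.1 ε) (w.1 ε))

theorem abs_sqrt_sub_sqrt_le (a b : ℝ) : |√a - √b| ≤ √|a - b| := by
  have key : ∀ x y : ℝ, √x - √y ≤ √|x - y| := by
    intro x y
    have h1 : √x ≤ √(|x - y| + max y 0) :=
      Real.sqrt_le_sqrt (by have := le_abs_self (x - y); have := le_max_left y 0; linarith)
    have h2 : √(|x - y| + max y 0) ≤ √|x - y| + √(max y 0) :=
      Real.sqrt_le_iff.2 ⟨by positivity, by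
        have e1 := Real.sq_sqrt (abs_nonneg (x - y))
        have e2 := Real.sq_sqrt (le_max_right y 0)
        nlinarith [mul_nonneg (Real.sqrt_nonneg |x - y|) (Real.sqrt_nonneg (max y 0))]⟩
    have h3 : √(max y 0) = √y := by
      rcases le_total y 0 with h | h
      · rw [max_eq_right h, Real.sqrt_zero, Real.sqrt_eq_zero_of_nonpos h]
      · rw [max_eq_left h]
    linarith
  rw [abs_le]
  have := key b a
  rw [abs_sub_comm] at this
  constructor <;> linarith [key a b]

theorem IsNegligible.sqrt_abs {r : Idx → ℝ} (h : IsNegligible r) :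
    IsNegligible (fun ε => √|r ε|) := by
  intro q
  obtain ⟨C, hC⟩ := (h (q + q)).bound
  refine IsBigO.of_bound (√C) (hC.mono fun ε hε => ?_)
  have h0 : (0 : ℝ) < ε := ε.2.1
  rw [Real.norm_of_nonneg (Real.sqrt_nonneg _), Real.norm_of_nonneg (by positivity)]
  rw [Real.norm_eq_abs, Real.norm_of_nonneg (by positivity)] at hε
  calc √|r ε| ≤ √(C * (ε : ℝ) ^ (q + q)) := Real.sqrt_le_sqrt hε
    _ = √C * (ε : ℝ) ^ q := by
      rw [Real.sqrt_mul' _ (by positivity), pow_add, Real.sqrt_mul_self (by positivity)]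

/-- The square root `√[(r_ε)] = [(√r_ε)]`, used for positive generalized numbers. -/
def GenNum.sqrt : GenR → GenR :=
  Quotient.map' (s₁ := Submodule.quotientRel _) (s₂ := Submodule.quotientRel _)
    (fun r : moderateNets ℝ => (⟨fun ε => √(r.1 ε),
      ((isModerate_const (1 : ℝ)).add (r.2.of_le (u := fun ε => |r.1 ε|) fun ε => by simp)).of_le
        fun ε => by
          have h := Real.sqrt_nonneg (r.1 ε)
          have h1 := abs_nonneg (r.1 ε)
          rw [Real.norm_of_nonneg h, Real.norm_of_nonneg (by linarith), Real.sqrt_le_left (by linarith)]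
          nlinarith [le_abs_self (r.1 ε)]⟩ : moderateNets ℝ))
    (by
      intro z w h
      rw [Submodule.quotientRel_def] at h ⊢
      refine IsNegligible.of_le (IsNegligible.sqrt_abs h) fun ε => ?_
      rw [Real.norm_of_nonneg (Real.sqrt_nonneg _)]
      exact abs_sqrt_sub_sqrt_le _ _)

/-! ### Colombeau generalized functions -/

variable {n : ℕ}

/-- The Euclidean space `ℝⁿ`. -/
abbrev Eu (n : ℕ) : Type := EuclideanSpace ℝ (Fin n)

/-- The seminorm `p_{K,j}(f)`, the supremum over `x ∈ K` of the derivatives of `f` of order at most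
`j`. The size of the derivatives of order `i` is measured by the norm of the `i`-th Fréchet
derivative, which equals `max_{|α| = i} |∂^α f(x)|` up to factors that depend only on `n`, `i`. -/
def supNorm (K : Set (Eu n)) (j : ℕ) (f : Eu n → ℂ) : ℝ :=
  ⨆ p : K × Fin (j + 1), ‖iteratedFDeriv ℝ (p.2 : ℕ) f p.1‖

/-- `𝓔_M(Ω)`: the moderate nets of smooth functions on `Ω`
(values outside of `Ω` are irrelevant). -/
def EM (Ω : Opens (Eu n)) : Set (Idx → Eu n → ℂ) :=
  {u | (∀ ε, ContDiffOn ℝ ∞ (u ε) Ω) ∧ ∀ K : Set (Eu n), IsCompact K → K ⊆ Ω →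
    ∀ j : ℕ, ∃ N : ℕ, (fun ε => supNorm K j (u ε)) =O[atZero] fun ε => ((ε : ℝ)⁻¹) ^ N}

/-- `𝓔_M^∞(Ω)`: the regular nets of smooth functions on `Ω`; on every compact set a single power
of `ε` bounds the derivatives of all orders. -/
def EMinf (Ω : Opens (Eu n)) : Set (Idx → Eu n → ℂ) :=
  {u | (∀ ε, ContDiffOn ℝ ∞ (u ε) Ω) ∧ ∀ K : Set (Eu n), IsCompact K → K ⊆ Ω →
    ∃ N : ℕ, ∀ j : ℕ, (fun ε => supNorm K j (u ε)) =O[atZero] fun ε => ((ε : ℝ)⁻¹) ^ N}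

/-- `𝓝(Ω)`: the negligible nets of smooth functions on `Ω`. -/
def EN (Ω : Opens (Eu n)) : Set (Idx → Eu n → ℂ) :=
  {u | (∀ ε, ContDiffOn ℝ ∞ (u ε) Ω) ∧ ∀ K : Set (Eu n), IsCompact K → K ⊆ Ω →
    ∀ j q : ℕ, (fun ε => supNorm K j (u ε)) =O[atZero] fun ε => (ε : ℝ) ^ q}

section SupNormLemmas

variable {Ω V : Opens (Eu n)} {K : Set (Eu n)} {j : ℕ}

theorem supNorm_nonneg (f : Eu n → ℂ) : 0 ≤ supNorm K j f :=
  Real.iSup_nonneg fun _ => norm_nonneg _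

theorem supNorm_le {f : Eu n → ℂ} {C : ℝ} (hC : 0 ≤ C)
    (h : ∀ x ∈ K, ∀ i ≤ j, ‖iteratedFDeriv ℝ i f x‖ ≤ C) : supNorm K j f ≤ C :=
  Real.iSup_le (fun p => h p.1 p.1.2 p.2 (Nat.lt_succ_iff.1 p.2.2)) hC

theorem le_supNorm (hK : IsCompact K) {f : Eu n → ℂ} (hf : ContDiff ℝ ∞ f) {x : Eu n}
    (hx : x ∈ K) {i : ℕ} (hi : i ≤ j) : ‖iteratedFDeriv ℝ i f x‖ ≤ supNorm K j f := by
  have hb : ∀ i : ℕ, ∃ C, ∀ y ∈ K, ‖iteratedFDeriv ℝ i f y‖ ≤ C := fun i =>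
    hK.exists_bound_of_continuousOn
      (hf.continuous_iteratedFDeriv (m := i) (mod_cast le_top)).continuousOn
  choose C hC using hb
  refine le_ciSup (f := fun p : K × Fin (j + 1) => ‖iteratedFDeriv ℝ (p.2 : ℕ) f p.1‖)
    ⟨∑ i : Fin (j + 1), |C i|, ?_⟩ (⟨x, hx⟩, ⟨i, Nat.lt_succ_iff.2 hi⟩)
  rintro _ ⟨p, rfl⟩
  exact ((hC _ _ p.1.2).trans (le_abs_self _)).trans
    (Finset.single_le_sum (f := fun i : Fin (j + 1) => |C i|) (fun _ _ => abs_nonneg _)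
      (Finset.mem_univ p.2))

theorem contDiff_test (f : 𝓓(Ω, ℂ)) : ContDiff ℝ ∞ f := f.contDiff

theorem supNorm_add_le (hK : IsCompact K) (f g : 𝓓(Ω, ℂ)) :
    supNorm K j (f + g : 𝓓(Ω, ℂ)) ≤ supNorm K j f + supNorm K j g := by
  refine supNorm_le (add_nonneg (supNorm_nonneg _) (supNorm_nonneg _)) fun x hx i hi => ?_
  rw [FunLike.coe_add, iteratedFDeriv_add_apply
    ((contDiff_test f).of_le (mod_cast le_top)).contDiffAt
    ((contDiff_test g).of_le (mod_cast le_top)).contDiffAt]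
  exact (norm_add_le _ _).trans
    (add_le_add (le_supNorm hK (contDiff_test f) hx hi) (le_supNorm hK (contDiff_test g) hx hi))

theorem supNorm_smul_le (hK : IsCompact K) (c : ℂ) (f : 𝓓(Ω, ℂ)) :
    supNorm K j (c • f : 𝓓(Ω, ℂ)) ≤ ‖c‖ * supNorm K j f := by
  refine supNorm_le (mul_nonneg (norm_nonneg _) (supNorm_nonneg _)) fun x hx i hi => ?_
  rw [FunLike.coe_smul, iteratedFDeriv_const_smul_apply
    ((contDiff_test f).of_le (mod_cast le_top)).contDiffAt, norm_smul]
  exact mul_le_mul_of_nonneg_left (le_supNorm hK (contDiff_test f) hx hi) (norm_nonneg _)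

theorem supNorm_zero : supNorm K j (0 : 𝓓(Ω, ℂ)) = 0 := by
  refine le_antisymm (supNorm_le le_rfl fun x _ i _ => ?_) (supNorm_nonneg _)
  rw [FunLike.coe_zero, Pi.zero_def, iteratedFDeriv_fun_zero]
  simp

theorem supNorm_le_of_tsupport {L : Set (Eu n)} (hL : IsCompact L) {f : Eu n → ℂ}
    (hf : ContDiff ℝ ∞ f) (h : tsupport f ⊆ L) : supNorm K j f ≤ supNorm L j f := by
  refine supNorm_le (supNorm_nonneg _) fun x _ i hi => ?_
  by_cases hx : x ∈ L
  · exact le_supNorm hL hf hx hi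
  · have : iteratedFDeriv ℝ i f x = 0 := by
      by_contra h0
      exact hx (h (support_iteratedFDeriv_subset i h0))
    rw [this, norm_zero]
    exact supNorm_nonneg _

/-- The partial derivative `∂_k f` of a test function. -/
def testPartial (Ω : Opens (Eu n)) (k : Fin n) : 𝓓(Ω, ℂ) →L[ℂ] 𝓓(Ω, ℂ) :=
  TestFunction.lineDerivCLM ℂ (EuclideanSpace.single k (1 : ℝ))

theorem coe_testPartial (k : Fin n) (f : 𝓓(Ω, ℂ)) :
    (testPartial Ω k f : Eu n → ℂ) =
      fun x => fderiv ℝ f x (EuclideanSpace.single k (1 : ℝ)) := by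
  funext x
  rw [testPartial, TestFunction.lineDerivCLM_apply_of_le (by simp)]
  exact ((contDiff_test f).differentiable (by simp)).differentiableAt.lineDeriv_eq_fderiv

theorem tsupport_testPartial (k : Fin n) (f : 𝓓(Ω, ℂ)) :
    tsupport (testPartial Ω k f) ⊆ tsupport f := by
  rw [coe_testPartial]
  exact tsupport_fderiv_apply_subset ℝ _

theorem supNorm_testPartial_le (hK : IsCompact K) (k : Fin n) (f : 𝓓(Ω, ℂ)) :
    supNorm K j (testPartial Ω k f) ≤ supNorm K (j + 1) f := by
  refine supNorm_le (supNorm_nonneg _) fun x hx i hi => ?_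
  rw [coe_testPartial]
  have hf : ContDiff ℝ ∞ (fderiv ℝ f) := (contDiff_test f).fderiv_right (by simp)
  have h := norm_iteratedFDeriv_clm_apply_const (𝕜 := ℝ) (c := EuclideanSpace.single k (1 : ℝ))
    (n := i) (N := ∞) (x := x) hf.contDiffAt (mod_cast le_top)
  refine h.trans ?_
  rw [show ‖EuclideanSpace.single k (1 : ℝ)‖ = 1 by simp, one_mul, norm_iteratedFDeriv_fderiv]
  exact le_supNorm hK (contDiff_test f) hx (by omega)

/-- Extension by zero of test functions from `V` to a larger open set. -/
def testExtend (h : V ≤ Ω) : 𝓓(V, ℂ) →ₗ[ℂ] 𝓓(Ω, ℂ) where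
  toFun f := ⟨f, f.contDiff, f.hasCompactSupport, f.tsupport_subset.trans h⟩
  map_add' _ _ := rfl
  map_smul' _ _ := rfl

end SupNormLemmas

/-- `𝓔_{c,M}(Ω)`: the moderate nets of smooth functions whose supports lie in one compact subset
of `Ω`. -/
def EcM (Ω : Opens (Eu n)) : Submodule (moderateNets ℂ) (Idx → 𝓓(Ω, ℂ)) where
  carrier := {u | (∃ K : Set (Eu n), IsCompact K ∧ K ⊆ Ω ∧ ∀ ε, tsupport (u ε) ⊆ K) ∧
    (fun ε => (u ε : Eu n → ℂ)) ∈ EM Ω}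
  zero_mem' := by
    refine ⟨⟨∅, isCompact_empty, Set.empty_subset _, fun ε => ?_⟩,
      fun ε => (contDiff_test _).contDiffOn, fun K _ _ j => ⟨0, ?_⟩⟩
    · change tsupport (⇑(0 : 𝓓(Ω, ℂ))) ⊆ ∅
      rw [FunLike.coe_zero, tsupport_zero]
    · change (fun ε => supNorm K j (0 : 𝓓(Ω, ℂ))) =O[atZero] _
      simp only [supNorm_zero]
      exact isBigO_zero _ _
  add_mem' := by
    rintro u v ⟨⟨K, hK, hKΩ, hu⟩, -, hu'⟩ ⟨⟨L, hL, hLΩ, hv⟩, -, hv'⟩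
    refine ⟨⟨K ∪ L, hK.union hL, Set.union_subset hKΩ hLΩ, fun ε => ?_⟩,
      fun ε => (contDiff_test _).contDiffOn, fun K' hK' hKΩ' j => ?_⟩
    · exact (tsupport_add _ _).trans (Set.union_subset_union (hu ε) (hv ε))
    · refine IsModerate.of_le (IsModerate.add (hu' K' hK' hKΩ' j) (hv' K' hK' hKΩ' j)) fun ε => ?_
      rw [Real.norm_of_nonneg (supNorm_nonneg _),
        Real.norm_of_nonneg (add_nonneg (supNorm_nonneg _) (supNorm_nonneg _))]
      exact supNorm_add_le hK' (u ε) (v ε)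
  smul_mem' := by
    rintro c u ⟨⟨K, hK, hKΩ, hu⟩, -, hu'⟩
    refine ⟨⟨K, hK, hKΩ, fun ε => ?_⟩,
      fun ε => (contDiff_test _).contDiffOn, fun K' hK' hKΩ' j => ?_⟩
    · exact (tsupport_smul_subset_right (fun _ => c.1 ε) (u ε : Eu n → ℂ)).trans (hu ε)
    · refine IsModerate.of_le (IsModerate.mul (u := fun ε => ‖c.1 ε‖)
        (IsModerate.of_le (v := c.1) c.2 fun ε => by simp) (hu' K' hK' hKΩ' j)) fun ε => ?_
      rw [Real.norm_of_nonneg (supNorm_nonneg _),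
        Real.norm_of_nonneg (mul_nonneg (norm_nonneg _) (supNorm_nonneg _))]
      exact supNorm_smul_le hK' (c.1 ε) (u ε)

/-- `𝓝_c(Ω)`: the negligible nets in `𝓔_{c,M}(Ω)`. -/
def Nc (Ω : Opens (Eu n)) : Submodule (moderateNets ℂ) (EcM Ω) where
  carrier := {u | (fun ε => (u.1 ε : Eu n → ℂ)) ∈ EN Ω}
  zero_mem' := by
    refine ⟨fun ε => (contDiff_test _).contDiffOn, fun K _ _ j q => ?_⟩
    change (fun ε => supNorm K j (0 : 𝓓(Ω, ℂ))) =O[atZero] _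
    simp only [supNorm_zero]
    exact isBigO_zero _ _
  add_mem' := by
    rintro u v ⟨-, hu⟩ ⟨-, hv⟩
    refine ⟨fun ε => (contDiff_test _).contDiffOn, fun K hK hKΩ j => ?_⟩
    refine IsNegligible.of_le (IsNegligible.add (hu K hK hKΩ j) (hv K hK hKΩ j)) fun ε => ?_
    rw [Real.norm_of_nonneg (supNorm_nonneg _),
      Real.norm_of_nonneg (add_nonneg (supNorm_nonneg _) (supNorm_nonneg _))]
    exact supNorm_add_le hK (u.1 ε) (v.1 ε)
  smul_mem' := by
    rintro c u ⟨-, hu⟩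
    refine ⟨fun ε => (contDiff_test _).contDiffOn, fun K hK hKΩ j => ?_⟩
    refine IsNegligible.of_le (IsModerate.mul_isNegligible (u := fun ε => ‖c.1 ε‖)
        (IsModerate.of_le (v := c.1) c.2 fun ε => by simp) (hu K hK hKΩ j)) fun ε => ?_
    rw [Real.norm_of_nonneg (supNorm_nonneg _),
      Real.norm_of_nonneg (mul_nonneg (norm_nonneg _) (supNorm_nonneg _))]
    exact supNorm_smul_le hK (c.1 ε) (u.1 ε)

/-- `𝓖_c(Ω)`: the Colombeau generalized functions with compact support in `Ω`. -/
def Gc (Ω : Opens (Eu n)) : Type := EcM Ω ⧸ Nc Ω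

instance (Ω : Opens (Eu n)) : AddCommGroup (Gc Ω) :=
  inferInstanceAs (AddCommGroup (EcM Ω ⧸ Nc Ω))

theorem isTorsionBySet_Gc (Ω : Opens (Eu n)) :
    Module.IsTorsionBySet (moderateNets ℂ) (EcM Ω ⧸ Nc Ω) (negligibleNets ℂ) := by
  rw [Module.isTorsionBySet_quotient_iff]
  rintro ⟨u, -, -, hu⟩ c hc
  refine ⟨fun ε => (contDiff_test _).contDiffOn, fun K hK hKΩ j => ?_⟩
  refine IsNegligible.of_le (IsModerate.mul_isNegligible (hu K hK hKΩ j)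
    (IsNegligible.of_le (v := c.1) (u := fun ε => ‖c.1 ε‖) hc fun ε => by simp)) fun ε => ?_
  rw [Real.norm_of_nonneg (supNorm_nonneg _),
    Real.norm_of_nonneg (mul_nonneg (supNorm_nonneg _) (norm_nonneg _)), mul_comm]
  exact supNorm_smul_le hK (c.1 ε) (u ε)

instance (Ω : Opens (Eu n)) : Module (moderateNets ℂ ⧸ negligibleNets ℂ) (EcM Ω ⧸ Nc Ω) :=
  (isTorsionBySet_Gc Ω).module

/-- `𝓖_c(Ω)` is a module over the complex generalized numbers, `[(c_ε)] [(u_ε)] = [(c_ε u_ε)]`. -/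
instance (Ω : Opens (Eu n)) : Module GenC (Gc Ω) :=
  inferInstanceAs (Module (moderateNets ℂ ⧸ negligibleNets ℂ) (EcM Ω ⧸ Nc Ω))

/-- The class in `𝓖_c(Ω)` of a net in `𝓔_{c,M}(Ω)`. -/
def Gc.mk {Ω : Opens (Eu n)} (u : EcM Ω) : Gc Ω := Submodule.Quotient.mk u

/-- An operation on nets that is compatible with the module structures and with negligibility
acts on classes. -/
def Gc.map {Ω V : Opens (Eu n)} (A : EcM V →ₗ[moderateNets ℂ] EcM Ω)
    (hA : ∀ u ∈ Nc V, A u ∈ Nc Ω) : Gc V →ₗ[GenC] Gc Ω where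
  toFun := (Nc V).mapQ (Nc Ω) A hA
  map_add' := map_add ((Nc V).mapQ (Nc Ω) A hA)
  map_smul' := by
    intro c u
    obtain ⟨c, rfl⟩ := Ideal.Quotient.mk_surjective c
    exact map_smul ((Nc V).mapQ (Nc Ω) A hA) c (show EcM V ⧸ Nc V from u)

/-- The partial derivative `∂_k` on `𝓔_{c,M}(Ω)`. -/
def EcM.partial (Ω : Opens (Eu n)) (k : Fin n) : EcM Ω →ₗ[moderateNets ℂ] EcM Ω where
  toFun u := ⟨fun ε => testPartial Ω k (u.1 ε), by
    obtain ⟨u, ⟨K, hK, hKΩ, hu⟩, -, hu'⟩ := u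
    refine ⟨⟨K, hK, hKΩ, fun ε => (tsupport_testPartial k _).trans (hu ε)⟩,
      fun ε => (contDiff_test _).contDiffOn, fun K' hK' hKΩ' j => ?_⟩
    refine IsModerate.of_le (hu' K' hK' hKΩ' (j + 1)) fun ε => ?_
    rw [Real.norm_of_nonneg (supNorm_nonneg _), Real.norm_of_nonneg (supNorm_nonneg _)]
    exact supNorm_testPartial_le hK' k (u ε)⟩
  map_add' u v := Subtype.ext <| funext fun ε => map_add (testPartial Ω k) (u.1 ε) (v.1 ε)
  map_smul' c u := Subtype.ext <| funext fun ε => map_smul (testPartial Ω k) (c.1 ε) (u.1 ε)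

/-- The partial derivative `∂_k` on `𝓖_c(Ω)`. -/
def Gc.partial (Ω : Opens (Eu n)) (k : Fin n) : Gc Ω →ₗ[GenC] Gc Ω :=
  Gc.map (EcM.partial Ω k) (by
    rintro u ⟨-, hu⟩
    refine ⟨fun ε => (contDiff_test _).contDiffOn, fun K hK hKΩ j => ?_⟩
    refine IsNegligible.of_le (hu K hK hKΩ (j + 1)) fun ε => ?_
    rw [Real.norm_of_nonneg (supNorm_nonneg _), Real.norm_of_nonneg (supNorm_nonneg _)]
    exact supNorm_testPartial_le hK k (u.1 ε))

/-- Extension by zero `𝓔_{c,M}(V) → 𝓔_{c,M}(Ω)`. -/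
def EcM.extend {Ω V : Opens (Eu n)} (h : V ≤ Ω) : EcM V →ₗ[moderateNets ℂ] EcM Ω where
  toFun u := ⟨fun ε => testExtend h (u.1 ε), by
    obtain ⟨u, ⟨K, hK, hKV, hu⟩, -, hu'⟩ := u
    refine ⟨⟨K, hK, hKV.trans h, hu⟩,
      fun ε => (contDiff_test _).contDiffOn, fun K' hK' hKΩ' j => ?_⟩
    refine IsModerate.of_le (hu' K hK hKV j) fun ε => ?_
    rw [Real.norm_of_nonneg (supNorm_nonneg _), Real.norm_of_nonneg (supNorm_nonneg _)]
    exact supNorm_le_of_tsupport hK (contDiff_test (u ε)) (hu ε)⟩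
  map_add' u v := Subtype.ext <| funext fun ε => map_add (testExtend h) (u.1 ε) (v.1 ε)
  map_smul' c u := Subtype.ext <| funext fun ε => map_smul (testExtend h) (c.1 ε) (u.1 ε)

/-- Extension by zero `𝓖_c(V) → 𝓖_c(Ω)`. -/
def Gc.extend {Ω V : Opens (Eu n)} (h : V ≤ Ω) : Gc V →ₗ[GenC] Gc Ω :=
  Gc.map (EcM.extend h) (by
    rintro ⟨u, ⟨K, hK, hKV, hu⟩, hu'⟩ ⟨-, hn⟩
    refine ⟨fun ε => (contDiff_test _).contDiffOn, fun K' hK' hKΩ' j => ?_⟩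
    refine IsNegligible.of_le (hn K hK hKV j) fun ε => ?_
    rw [Real.norm_of_nonneg (supNorm_nonneg _), Real.norm_of_nonneg (supNorm_nonneg _)]
    exact supNorm_le_of_tsupport hK (contDiff_test (u ε)) (hu ε))

/-! ### Functionals on `𝓖_c(Ω)` -/

/-- The linear functionals on `𝓖_c(Ω)` with values in the complex generalized numbers. -/
abbrev Functional (Ω : Opens (Eu n)) : Type := Gc Ω →ₗ[GenC] GenC

/-- Continuity for the inductive limit topology of `𝓖_c(Ω)`: for every compact `K ⊆ Ω` there are
`j` and a constant with `|T u|_e ≤ const · 𝒫_{K,j}(u)` for all `u` supported in `K`, where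
`|·|_e = exp(-val(·))` and `𝒫_{K,j} = exp(-val_{K,j}(·))`. -/
def IsContinuousFunctional {Ω : Opens (Eu n)} (T : Functional Ω) : Prop :=
  ∀ K : Set (Eu n), IsCompact K → K ⊆ Ω → ∃ (j : ℕ) (c : ℝ),
    ∀ u : EcM Ω, (∀ ε, tsupport (u.1 ε) ⊆ K) →
      netVal (fun ε => supNorm K j (u.1 ε)) ≤ (T (Gc.mk u)).val + (c : EReal)

/-- The nets of distributions on `Ω` in `𝓜(C_c^∞(Ω), ℂ)`. -/
def IsModerateDistNet {Ω : Opens (Eu n)} (S : Idx → 𝓓(Ω, ℂ) →L[ℂ] ℂ) : Prop :=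
  ∀ K : Set (Eu n), IsCompact K → K ⊆ Ω → ∃ (j N : ℕ) (c : ℝ) (η : Idx), 0 < c ∧
    ∀ f : 𝓓(Ω, ℂ), tsupport f ⊆ K → ∀ ε ≤ η,
      ‖S ε f‖ ≤ c * ((ε : ℝ)⁻¹) ^ N * supNorm K j f

/-- `T` is a basic element of the dual of `𝓖_c(Ω)`. -/
def IsBasic {Ω : Opens (Eu n)} (T : Functional Ω) : Prop :=
  IsContinuousFunctional T ∧ ∃ S : Idx → 𝓓(Ω, ℂ) →L[ℂ] ℂ, IsModerateDistNet S ∧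
    ∀ u : EcM Ω, Represents (fun ε => S ε (u.1 ε)) (T (Gc.mk u))

/-- The restriction `T|_V` of a functional to a smaller open set. -/
def Functional.restrict {Ω V : Opens (Eu n)} (h : V ≤ Ω) (T : Functional Ω) : Functional V :=
  T ∘ₗ Gc.extend h

/-- `T` is the functional `u ↦ [(∫ g_ε u_ε dx)]` given by the class of a net `(g_ε)` in the class
`R Ω`. For `R = EM` this says `T ∈ 𝓖(Ω)`, and for `R = EMinf` it says `T ∈ 𝓖^∞(Ω)`. -/
def IsGivenBy (R : Opens (Eu n) → Set (Idx → Eu n → ℂ)) {Ω : Opens (Eu n)}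
    (T : Functional Ω) : Prop :=
  ∃ g ∈ R Ω, ∀ u : EcM Ω,
    Represents (fun ε => ∫ x in (Ω : Set (Eu n)), g ε x * u.1 ε x) (T (Gc.mk u))

/-- The singular support with respect to `R`; for `R = EM` it is the `𝓖`-singular support, and for
`R = EMinf` the `𝓖^∞`-singular support. -/
def singSupp (R : Opens (Eu n) → Set (Idx → Eu n → ℂ)) {Ω : Opens (Eu n)}
    (T : Functional Ω) : Set (Eu n) :=
  {x | x ∈ Ω ∧ ¬ ∃ (V : Opens (Eu n)) (h : V ≤ Ω), x ∈ V ∧ IsGivenBy R (T.restrict h)}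

/-- `ι_d(δ)`: the functional `u ↦ [(u_ε(0))]` on `𝓖_c(ℝⁿ)`. -/
def delta (n : ℕ) : Functional (⊤ : Opens (Eu n)) where
  toFun := Quotient.map' (s₁ := Submodule.quotientRel _) (s₂ := Submodule.quotientRel _)
    (fun u : EcM (⊤ : Opens (Eu n)) => (⟨fun ε => u.1 ε 0,
      IsModerate.of_le (u.2.2.2 {0} isCompact_singleton (Set.subset_univ _) 0) fun ε => by
        rw [Real.norm_of_nonneg (supNorm_nonneg _)]
        simpa using le_supNorm (j := 0) isCompact_singleton (contDiff_test (u.1 ε))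
          (Set.mem_singleton (0 : Eu n)) le_rfl⟩ : moderateNets ℂ))
    (by
      intro u v h
      rw [Submodule.quotientRel_def] at h ⊢
      refine IsNegligible.of_le (h.2 {0} isCompact_singleton (Set.subset_univ _) 0) fun ε => ?_
      rw [Real.norm_of_nonneg (supNorm_nonneg _)]
      simpa using le_supNorm (j := 0) isCompact_singleton (contDiff_test ((u - v).1 ε))
          (Set.mem_singleton (0 : Eu n)) le_rfl)
  map_add' := by
    rintro ⟨u⟩ ⟨v⟩
    rfl
  map_smul' := by
    rintro ⟨c⟩ ⟨u⟩
    rfl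

/-! ### Differential operators with constant coefficients -/

/-- `D_k = -i ∂_k` on functionals, where `(∂_k T)(u) = -T(∂_k u)`. -/
def dualD (Ω : Opens (Eu n)) (k : Fin n) : Module.End GenC (Functional Ω) :=
  (GenNum.const (-Complex.I) : GenC) • -(LinearMap.lcomp GenC GenC (Gc.partial Ω k))

/-- `D^α` on functionals. -/
def dualDPow (Ω : Opens (Eu n)) (α : Fin n →₀ ℕ) : Module.End GenC (Functional Ω) :=
  ((List.finRange n).map fun k => dualD Ω k ^ α k).prod

/-- `P(D) T = ∑_α c_α D^α T` for the polynomial `P = ∑_α c_α ξ^α`. -/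
def applyOp (P : MvPolynomial (Fin n) GenC) {Ω : Opens (Eu n)} (T : Functional Ω) :
    Functional Ω :=
  ∑ α ∈ P.support, P.coeff α • dualDPow Ω α T

/-- The formal derivative `∂^α P`. -/
def polyDeriv (P : MvPolynomial (Fin n) GenC) (α : Fin n →₀ ℕ) : MvPolynomial (Fin n) GenC :=
  ((List.finRange n).map fun k =>
    ((MvPolynomial.pderiv k).toLinearMap : Module.End GenC (MvPolynomial (Fin n) GenC)) ^ α k).prod P

/-- `P̃(ξ) = (∑_{|α| ≤ m} |∂^α P(ξ)|²)^{1/2}`, a real generalized number; `m` is the degree. -/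
def tildeFn (P : MvPolynomial (Fin n) GenC) (ξ : Eu n) : GenR :=
  GenNum.sqrt (∑ k ∈ Finset.range (P.totalDegree + 1), ∑ α ∈ Finset.univ.finsuppAntidiag k,
    GenNum.abs ((polyDeriv P α).eval fun j => (GenNum.const (ξ j : ℂ) : GenC)) ^ 2)

/-- `P(D)` is hypoelliptic with respect to `R` (`R = EM`: `𝓖`-hypoelliptic, `R = EMinf`:
`𝓖^∞`-hypoelliptic). -/
def IsHypoelliptic (R : Opens (Eu n) → Set (Idx → Eu n → ℂ))
    (P : MvPolynomial (Fin n) GenC) : Prop :=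
  ∀ (Ω : Opens (Eu n)) (T : Functional Ω), IsBasic T →
    singSupp R (applyOp P T) = singSupp R T

/-- `E` is a fundamental solution of `P(D)`. -/
def IsFundamentalSolution (P : MvPolynomial (Fin n) GenC)
    (E : Functional (⊤ : Opens (Eu n))) : Prop :=
  applyOp P E = delta n

/-- `P(D) F - ι_d(δ)` belongs to `𝓖(ℝⁿ)` (`R = EM`) or to `𝓖^∞(ℝⁿ)` (`R = EMinf`). -/
def IsParametrix (R : Opens (Eu n) → Set (Idx → Eu n → ℂ)) (P : MvPolynomial (Fin n) GenC)
    (F : Functional (⊤ : Opens (Eu n))) : Prop :=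
  IsGivenBy R (applyOp P F - delta n)

end Colombeau

end

noncomputable section

open scoped Pointwise

namespace Colombeau

variable {n : ℕ}

open MeasureTheory

/-! ### Nets and their classes -/

section Nets

variable {F G : Type*} [NormedAddCommGroup F] [NormedAddCommGroup G]

/-! From (i) to (ii) the point is the existence of a basic fundamental solution. Write `ᵗP` for the
transpose of `P(D)`, at fixed `ε`, and `σ = ∑ |c_α|`. Malgrange's inequality
(`exists_malgrange_bound`) bounds `σ |f(0)|` by a constant independent of the coefficients times the
supremum of `(1 + ∑|ζ_k|)^M |(ᵗP f)^(ζ)|` over the strip `|Im ζ_k| ≤ 1`. Its source is one complex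
variable: for a polynomial `p` of bounded degree and an entire `g`, `|p(w) g(0)|` is at most a power
of `1 + |w|`, up to constants, times the supremum of `|p g|` on the unit disc (`norm_eval_mul_le`).
This is used on the line from a real frequency `ξ` to an integer grid point where `|P|` controls
`σ`; integration over `ξ` and Fourier inversion then recover `f(0)`. By Hahn–Banach there are
distributions `E_ε` with `E_ε(ᵗP f) = f(0)` and bounds proportional to `1/σ`.

Invertibility of `P̃(ξ₀)` enters only through `σ_ε ≥ ε^N` for small `ε` (`exists_pow_le_sum_cf`):
the numbers dominated by `σ` form an ideal that contains the coefficients of `P`, hence all values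
of its derivatives, so an invertible `P̃(ξ₀)` keeps `σ` from being too small. Thus `(E_ε)` is
moderate, and hypoellipticity carries the singular support of `δ` over to `E`. From (ii) to (iii)
the remainder is zero.

From (iii) to (i), `P(D)` never enlarges the singular support, by integration by parts. For the
converse, the parametrix is cut off near the origin to a net `S` of compactly supported
distributions; since it lies in the class away from the origin, `S(ᵗP w) = w(0) + ∫ κ w` up to a
negligible net, with `κ` in the class (`exists_local_parametrix`). If `P(D)T` is given by `g` near a
point, let `v(y) = S(u(y + ·))` for a test net `u` near that point. Then `u = ᵗP v - k` up to a
negligible net, where `k(y) = ∫ κ(z) u(y + z) dz`, so `Tu` becomes `∫ g v - T(k)`. Transposing both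
convolutions exhibits `T` as integration against convolutions of localized `g` and `κ` with moderate
nets of compactly supported distributions. Such convolutions lose a fixed number of derivatives and
a fixed power of `ε`, and so preserve both moderate and regular nets. This is why one argument, for
`RB b`, covers both classes. -/

theorem eventually_le_atZero (η : Idx) : ∀ᶠ ε in atZero, ε ≤ η := by
  have h : ∀ᶠ x in 𝓝 (0 : ℝ), x < (η : ℝ) := eventually_lt_nhds η.2.1
  exact (h.comap Subtype.val).mono fun ε hε => le_of_lt hε

theorem exists_of_eventually_atZero {p : Idx → Prop} (h : ∀ᶠ ε in atZero, p ε) :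
    ∃ η : Idx, ∀ ε ≤ η, p ε := by
  obtain ⟨s, hs, hsp⟩ := mem_comap.1 h
  obtain ⟨r, hr, hrs⟩ := Metric.mem_nhds_iff.1 hs
  refine ⟨⟨min (r / 2) 1, lt_min (by positivity) one_pos, min_le_right _ _⟩, fun ε hε => ?_⟩
  refine hsp (hrs ?_)
  have h1 : (ε : ℝ) ≤ r / 2 := le_trans hε (min_le_left _ _)
  rw [Metric.mem_ball, Real.dist_eq, sub_zero, abs_of_pos ε.2.1]
  linarith

theorem IsNegligible.isModerate {u : Idx → F} (hu : IsNegligible u) : IsModerate u :=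
  ⟨0, by simpa using hu 0⟩

theorem IsNegligible.congr' {u v : Idx → F} (hu : IsNegligible u) (h : ∀ᶠ ε in atZero, u ε = v ε) :
    IsNegligible v :=
  fun q => (hu q).congr' h (EventuallyEq.refl _ _)

theorem IsNegligible.neg {u : Idx → F} (hu : IsNegligible u) : IsNegligible fun ε => -u ε :=
  hu.of_le fun ε => by simp

theorem IsNegligible.sub {u v : Idx → F} (hu : IsNegligible u) (hv : IsNegligible v) :
    IsNegligible fun ε => u ε - v ε := by
  simpa only [sub_eq_add_neg] using hu.add hv.neg

theorem IsNegligible.sum {ι : Type*} (s : Finset ι) {u : ι → Idx → F}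
    (h : ∀ i ∈ s, IsNegligible (u i)) : IsNegligible fun ε => ∑ i ∈ s, u i ε :=
  fun q => IsBigO.fun_sum fun i hi => h i hi q

theorem IsModerate.sum {ι : Type*} (s : Finset ι) {u : ι → Idx → F}
    (h : ∀ i ∈ s, IsModerate (u i)) : IsModerate fun ε => ∑ i ∈ s, u i ε := by
  classical
  induction s using Finset.induction_on with
  | empty => simpa using isModerate_const (0 : F)
  | insert a s ha ih =>
    simp only [Finset.sum_insert ha]
    exact (h a (by simp)).add (ih fun i hi => h i (by simp [hi]))

theorem isModerate_inv_pow (N : ℕ) : IsModerate fun ε : Idx => ((ε : ℝ)⁻¹) ^ N :=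
  ⟨N, isBigO_refl _ _⟩

theorem inv_coe_pow_pos (ε : Idx) (N : ℕ) : 0 < ((ε : ℝ)⁻¹) ^ N := by
  have := ε.2.1
  positivity

/-- A moderate net is bounded by a single power of `1/ε` for small `ε`. -/
theorem IsModerate.eventually_le {u : Idx → F} (hu : IsModerate u) :
    ∃ N : ℕ, ∀ᶠ ε in atZero, ‖u ε‖ ≤ ((ε : ℝ)⁻¹) ^ N := by
  obtain ⟨N, hN⟩ := hu
  obtain ⟨C, hC⟩ := hN.bound
  have hC1 : (0 : ℝ) < |C| + 1 := by positivity
  -- The extra power of `1/ε` absorbs the constant of the `O`-estimate once `ε ≤ 1/(|C| + 1)`.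
  refine ⟨N + 1, ?_⟩
  filter_upwards [hC, eventually_le_atZero ⟨(|C| + 1)⁻¹, by positivity,
    inv_le_one_of_one_le₀ (by linarith [abs_nonneg C])⟩] with ε hε hε'
  rw [Real.norm_of_nonneg (inv_coe_pow_pos ε N).le] at hε
  have h1 : |C| + 1 ≤ (ε : ℝ)⁻¹ := by
    rw [le_inv_comm₀ hC1 ε.2.1]
    exact hε'
  rw [pow_succ']
  refine hε.trans (mul_le_mul_of_nonneg_right ?_ (inv_coe_pow_pos ε N).le)
  linarith [le_abs_self C]

end Nets

section Classes

variable {𝕜 : Type} [RCLike 𝕜]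

theorem GenNum.mk_eq_mk_iff {r s : moderateNets 𝕜} :
    GenNum.mk r = GenNum.mk s ↔ IsNegligible fun ε => r.1 ε - s.1 ε :=
  Ideal.Quotient.eq

theorem GenNum.mk_surjective : Function.Surjective (GenNum.mk (𝕜 := 𝕜)) :=
  Ideal.Quotient.mk_surjective

/-- A representative of a generalized number. -/
def GenNum.rep (z : GenNum 𝕜) : moderateNets 𝕜 := (GenNum.mk_surjective z).choose

theorem GenNum.mk_rep (z : GenNum 𝕜) : GenNum.mk z.rep = z := (GenNum.mk_surjective z).choose_spec

theorem GenNum.represents_rep (z : GenNum 𝕜) : Represents (z.rep : Idx → 𝕜) z :=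
  ⟨z.rep.2, z.mk_rep⟩

theorem represents_mk (r : moderateNets 𝕜) : Represents (r : Idx → 𝕜) (GenNum.mk r) := ⟨r.2, rfl⟩

theorem Represents.isModerate {r : Idx → 𝕜} {z : GenNum 𝕜} (h : Represents r z) : IsModerate r :=
  h.choose

theorem Represents.isNegligible_sub {r s : Idx → 𝕜} {z : GenNum 𝕜} (hr : Represents r z)
    (hs : Represents s z) : IsNegligible fun ε => r ε - s ε := by
  obtain ⟨h1, rfl⟩ := hr
  obtain ⟨h2, h⟩ := hs
  exact GenNum.mk_eq_mk_iff.1 h.symm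

theorem Represents.of_isNegligible_sub {r s : Idx → 𝕜} {z : GenNum 𝕜} (hr : Represents r z)
    (h : IsNegligible fun ε => r ε - s ε) : Represents s z := by
  obtain ⟨h1, rfl⟩ := hr
  have h2 : IsModerate s := by
    simpa using IsModerate.add (u := r) (v := fun ε => -(r ε - s ε)) h1 h.neg.isModerate
  exact ⟨h2, (GenNum.mk_eq_mk_iff (r := ⟨r, h1⟩) (s := ⟨s, h2⟩).2 h).symm⟩

theorem Represents.congr' {r s : Idx → 𝕜} {z : GenNum 𝕜} (hr : Represents r z)
    (h : ∀ᶠ ε in atZero, r ε = s ε) : Represents s z :=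
  hr.of_isNegligible_sub ((isNegligible_zero (F := 𝕜)).congr' (h.mono fun ε hε => by simp [hε]))

theorem Represents.unique {r : Idx → 𝕜} {z w : GenNum 𝕜} (hr : Represents r z)
    (hs : Represents r w) : z = w := by
  obtain ⟨h1, rfl⟩ := hr
  obtain ⟨h2, rfl⟩ := hs
  rfl

theorem Represents.add {r s : Idx → 𝕜} {z w : GenNum 𝕜} (hr : Represents r z)
    (hs : Represents s w) : Represents (fun ε => r ε + s ε) (z + w) := by
  obtain ⟨h1, rfl⟩ := hr
  obtain ⟨h2, rfl⟩ := hs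
  exact ⟨h1.add h2, map_add GenNum.mk ⟨r, h1⟩ ⟨s, h2⟩⟩

theorem Represents.sub {r s : Idx → 𝕜} {z w : GenNum 𝕜} (hr : Represents r z)
    (hs : Represents s w) : Represents (fun ε => r ε - s ε) (z - w) := by
  obtain ⟨h1, rfl⟩ := hr
  obtain ⟨h2, rfl⟩ := hs
  exact ⟨(moderateNets 𝕜).sub_mem h1 h2, map_sub GenNum.mk ⟨r, h1⟩ ⟨s, h2⟩⟩

theorem Represents.mul {r s : Idx → 𝕜} {z w : GenNum 𝕜} (hr : Represents r z)
    (hs : Represents s w) : Represents (fun ε => r ε * s ε) (z * w) := by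
  obtain ⟨h1, rfl⟩ := hr
  obtain ⟨h2, rfl⟩ := hs
  exact ⟨h1.mul h2, map_mul GenNum.mk ⟨r, h1⟩ ⟨s, h2⟩⟩

theorem represents_zero : Represents (fun _ => (0 : 𝕜)) 0 :=
  ⟨isModerate_const 0, map_zero GenNum.mk⟩

theorem represents_one : Represents (fun _ => (1 : 𝕜)) 1 :=
  ⟨isModerate_const 1, map_one GenNum.mk⟩

theorem Represents.sum {ι : Type*} (s : Finset ι) {r : ι → Idx → 𝕜} {z : ι → GenNum 𝕜}
    (h : ∀ i ∈ s, Represents (r i) (z i)) :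
    Represents (fun ε => ∑ i ∈ s, r i ε) (∑ i ∈ s, z i) := by
  classical
  induction s using Finset.induction_on with
  | empty => simpa using represents_zero
  | insert a s ha ih =>
    simp only [Finset.sum_insert ha]
    exact (h a (by simp)).add (ih fun i hi => h i (by simp [hi]))

/-- The norms of two representatives of the same number have the same valuation. -/
theorem le_val_of_isBigO {r : Idx → 𝕜} {z : GenNum 𝕜} (hr : Represents r z) {a : ℝ}
    (h : r =O[atZero] fun ε => (ε : ℝ) ^ a) : (a : EReal) ≤ z.val :=
  le_sSup_of_le ⟨r, hr, rfl⟩ (le_sSup ⟨a, rfl, h.norm_left⟩)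

theorem Represents.abs {r : Idx → ℂ} {z : GenC} (h : Represents r z) :
    Represents (fun ε => ‖r ε‖) z.abs := by
  obtain ⟨h, rfl⟩ := h
  exact ⟨IsModerate.of_le h fun ε => by simp, rfl⟩

theorem Represents.sqrt {r : Idx → ℝ} {z : GenR} (h : Represents r z) :
    Represents (fun ε => √(r ε)) z.sqrt := by
  obtain ⟨h, rfl⟩ := h
  exact ⟨_, rfl⟩

end Classes

/-! ### Functionals given by moderate nets of distributions -/

section OfNet

variable {Ω : Opens (Eu n)}

instance instSMulEcM (Ω : Opens (Eu n)) : SMul (moderateNets ℂ) (EcM Ω) :=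
  (Submodule.module (EcM Ω)).toSMul

theorem Gc.mk_surjective : Function.Surjective (Gc.mk (Ω := Ω)) := Submodule.Quotient.mk_surjective _

theorem Gc.mk_smul (c : moderateNets ℂ) (u : EcM Ω) : Gc.mk (c • u : EcM Ω) = GenNum.mk c • Gc.mk u := rfl

theorem Gc.mk_sum {ι : Type*} (s : Finset ι) (u : ι → EcM Ω) :
    Gc.mk (∑ i ∈ s, u i) = ∑ i ∈ s, Gc.mk (u i) :=
  map_sum (Nc Ω).mkQ u s

theorem IsModerateDistNet.isBigO {S : Idx → 𝓓(Ω, ℂ) →L[ℂ] ℂ} (hS : IsModerateDistNet S)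
    {K : Set (Eu n)} (hK : IsCompact K) (hKΩ : K ⊆ Ω) : ∃ j N : ℕ, ∀ u : Idx → 𝓓(Ω, ℂ),
      (∀ ε, tsupport (u ε) ⊆ K) →
      (fun ε => S ε (u ε)) =O[atZero] fun ε => ((ε : ℝ)⁻¹) ^ N * supNorm K j (u ε) := by
  obtain ⟨j, N, c, η, hc, h⟩ := hS K hK hKΩ
  refine ⟨j, N, fun u hu => IsBigO.of_bound c ((eventually_le_atZero η).mono fun ε hε => ?_)⟩
  rw [Real.norm_of_nonneg (mul_nonneg (inv_coe_pow_pos ε N).le (supNorm_nonneg _)), ← mul_assoc]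
  exact h (u ε) (hu ε) ε hε

theorem IsModerateDistNet.isModerate {S : Idx → 𝓓(Ω, ℂ) →L[ℂ] ℂ} (hS : IsModerateDistNet S)
    (u : EcM Ω) : IsModerate fun ε => S ε (u.1 ε) := by
  obtain ⟨⟨K, hK, hKΩ, hu⟩, -, hm⟩ := u.2
  obtain ⟨j, N, h⟩ := hS.isBigO hK hKΩ
  obtain ⟨M, hM⟩ := hm K hK hKΩ j
  exact ⟨N + M, by simpa only [pow_add] using (h u.1 hu).trans ((isBigO_refl _ _).mul hM)⟩

theorem IsModerateDistNet.isNegligible {S : Idx → 𝓓(Ω, ℂ) →L[ℂ] ℂ} (hS : IsModerateDistNet S)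
    {u : EcM Ω} (hn : u ∈ Nc Ω) : IsNegligible fun ε => S ε (u.1 ε) := by
  obtain ⟨⟨K, hK, hKΩ, hu⟩, -, -⟩ := u.2
  obtain ⟨j, N, h⟩ := hS.isBigO hK hKΩ
  exact fun q => (h u.1 hu).trans
    (IsModerate.mul_isNegligible (isModerate_inv_pow N) (hn.2 K hK hKΩ j) q)

/-- The functional `[(u_ε)] ↦ [(S_ε u_ε)]` given by a moderate net of distributions. -/
def Functional.ofNet (S : Idx → 𝓓(Ω, ℂ) →L[ℂ] ℂ) (hS : IsModerateDistNet S) : Functional Ω where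
  toFun := Quotient.map' (s₁ := Submodule.quotientRel _) (s₂ := Submodule.quotientRel _)
    (fun u : EcM Ω => (⟨fun ε => S ε (u.1 ε), hS.isModerate u⟩ : moderateNets ℂ))
    (by
      intro u v h
      rw [Submodule.quotientRel_def] at h ⊢
      refine (hS.isNegligible h).of_le fun ε => ?_
      change ‖S ε (u.1 ε) - S ε (v.1 ε)‖ ≤ ‖S ε (u.1 ε - v.1 ε)‖
      rw [map_sub])
  map_add' := by
    rintro ⟨u⟩ ⟨v⟩
    exact congrArg GenNum.mk (Subtype.ext (funext fun ε => map_add (S ε) (u.1 ε) (v.1 ε)))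
  map_smul' := by
    rintro ⟨c⟩ ⟨u⟩
    exact congrArg GenNum.mk (Subtype.ext (funext fun ε => map_smul (S ε) (c.1 ε) (u.1 ε)))

theorem Functional.represents_ofNet {S : Idx → 𝓓(Ω, ℂ) →L[ℂ] ℂ} (hS : IsModerateDistNet S)
    (u : EcM Ω) : Represents (fun ε => S ε (u.1 ε)) (Functional.ofNet S hS (Gc.mk u)) :=
  ⟨hS.isModerate u, rfl⟩

/-- A functional that is represented by a moderate net of distributions is continuous. -/
theorem isContinuousFunctional_of_represents {S : Idx → 𝓓(Ω, ℂ) →L[ℂ] ℂ}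
    (hS : IsModerateDistNet S) {T : Functional Ω}
    (hT : ∀ u : EcM Ω, Represents (fun ε => S ε (u.1 ε)) (T (Gc.mk u))) :
    IsContinuousFunctional T := by
  intro K hK hKΩ
  obtain ⟨j, N, h⟩ := hS.isBigO hK hKΩ
  refine ⟨j, N, fun u hu => sSup_le ?_⟩
  rintro _ ⟨a, rfl, ha⟩
  -- The net of distributions costs the factor `ε^{-N}`, so the valuation drops by at most `N`.
  have h1 : ((a - N : ℝ) : EReal) ≤ (T (Gc.mk u)).val := by
    refine le_val_of_isBigO (hT u) ((h u.1 hu).trans (((isBigO_refl _ _).mul ha).trans ?_))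
    refine IsBigO.of_bound 1 (Eventually.of_forall fun ε => ?_)
    rw [one_mul, Real.rpow_sub ε.2.1, Real.rpow_natCast, inv_pow, div_eq_inv_mul]
  calc (a : EReal) = ((a - N : ℝ) : EReal) + ((N : ℝ) : EReal) := by
        rw [← EReal.coe_add, sub_add_cancel]
    _ ≤ _ := add_le_add_left h1 _

theorem isBasic_ofNet {S : Idx → 𝓓(Ω, ℂ) →L[ℂ] ℂ} (hS : IsModerateDistNet S) :
    IsBasic (Functional.ofNet S hS) :=
  ⟨isContinuousFunctional_of_represents hS (Functional.represents_ofNet hS), S, hS,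
    Functional.represents_ofNet hS⟩

theorem represents_delta (u : EcM (⊤ : Opens (Eu n))) :
    Represents (fun ε => u.1 ε 0) (delta n (Gc.mk u)) :=
  ⟨_, rfl⟩

end OfNet

/-! ### Iterated partial derivatives -/

/-- The partial derivative `∂_k f`. -/
def pd (k : Fin n) (f : Eu n → ℂ) : Eu n → ℂ :=
  fun x => fderiv ℝ f x (EuclideanSpace.single k (1 : ℝ))

/-- The iterated partial derivative `∂_{k₁} ⋯ ∂_{k_r} f` along a word `[k₁, …, k_r]`. -/
def pdw (I : List (Fin n)) (f : Eu n → ℂ) : Eu n → ℂ := I.foldr pd f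

@[simp] theorem pdw_nil (f : Eu n → ℂ) : pdw [] f = f := rfl

@[simp] theorem pdw_cons (k : Fin n) (I : List (Fin n)) (f : Eu n → ℂ) :
    pdw (k :: I) f = pd k (pdw I f) := rfl

theorem pdw_append (I J : List (Fin n)) (f : Eu n → ℂ) : pdw (I ++ J) f = pdw I (pdw J f) := by
  simp [pdw]

section Calculus

variable {f g : Eu n → ℂ} {U K : Set (Eu n)} {x : Eu n}

theorem fderiv_eq_sum_pd (f : Eu n → ℂ) (x v : Eu n) :
    fderiv ℝ f x v = ∑ k, (v k : ℂ) * pd k f x := by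
  have hv : v = ∑ k, v k • EuclideanSpace.single k (1 : ℝ) := by
    ext i
    simp [Finset.sum_apply, Pi.single_apply]
  conv_lhs => rw [hv]
  rw [map_sum]
  refine Finset.sum_congr rfl fun k _ => ?_
  rw [map_smul, pd, Complex.real_smul]

theorem contDiffOn_pd (hU : IsOpen U) (hf : ContDiffOn ℝ ∞ f U) (k : Fin n) :
    ContDiffOn ℝ ∞ (pd k f) U :=
  (hf.fderiv_of_isOpen hU (by simp)).clm_apply contDiffOn_const

theorem contDiff_pd (hf : ContDiff ℝ ∞ f) (k : Fin n) : ContDiff ℝ ∞ (pd k f) :=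
  (hf.fderiv_right (by simp)).clm_apply contDiff_const

theorem contDiffOn_pdw (hU : IsOpen U) (hf : ContDiffOn ℝ ∞ f U) (I : List (Fin n)) :
    ContDiffOn ℝ ∞ (pdw I f) U := by
  induction I with
  | nil => exact hf
  | cons k I ih => exact contDiffOn_pd hU ih k

theorem contDiff_pdw (hf : ContDiff ℝ ∞ f) (I : List (Fin n)) : ContDiff ℝ ∞ (pdw I f) := by
  induction I with
  | nil => exact hf
  | cons k I ih => exact contDiff_pd ih k

theorem contDiffAt_of_isOpen (hU : IsOpen U) (hf : ContDiffOn ℝ ∞ f U) (hx : x ∈ U) :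
    ContDiffAt ℝ ∞ f x :=
  hf.contDiffAt (hU.mem_nhds hx)

theorem tsupport_pd_subset (k : Fin n) (f : Eu n → ℂ) : tsupport (pd k f) ⊆ tsupport f :=
  tsupport_fderiv_apply_subset ℝ _

theorem tsupport_pdw_subset (I : List (Fin n)) (f : Eu n → ℂ) : tsupport (pdw I f) ⊆ tsupport f := by
  induction I with
  | nil => exact subset_rfl
  | cons k I ih => exact (tsupport_pd_subset k _).trans ih

theorem pd_add (k : Fin n) (hf : ContDiff ℝ ∞ f) (hg : ContDiff ℝ ∞ g) :
    pd k (f + g) = pd k f + pd k g := by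
  funext x
  simp only [pd, Pi.add_apply]
  rw [fderiv_add (hf.differentiable (by simp) x) (hg.differentiable (by simp) x)]
  rfl

theorem pd_const_smul (k : Fin n) (c : ℂ) (hf : ContDiff ℝ ∞ f) : pd k (c • f) = c • pd k f := by
  funext x
  simp only [pd, Pi.smul_apply]
  rw [fderiv_const_smul (hf.differentiable (by simp) x)]
  rfl

theorem pd_shift (k : Fin n) (y : Eu n) (f : Eu n → ℂ) :
    pd k (fun z => f (y + z)) = fun z => pd k f (y + z) := by
  funext z
  simp only [pd]
  rw [fderiv_comp_add_left]

theorem pdw_shift (I : List (Fin n)) (y : Eu n) (f : Eu n → ℂ) :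
    pdw I (fun z => f (y + z)) = fun z => pdw I f (y + z) := by
  induction I with
  | nil => rfl
  | cons k I ih => rw [pdw_cons, ih, pd_shift]; rfl

theorem pd_comm (hf : ContDiff ℝ ∞ f) (k l : Fin n) : pd k (pd l f) = pd l (pd k f) := by
  have key : ∀ (k l : Fin n) (x : Eu n), pd k (pd l f) x =
      fderiv ℝ (fderiv ℝ f) x (EuclideanSpace.single k 1) (EuclideanSpace.single l 1) := by
    intro k l x
    have hd : DifferentiableAt ℝ (fderiv ℝ f) x :=
      ((hf.fderiv_right (m := ∞) (by simp)).differentiable (by simp)) x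
    change fderiv ℝ (fun y => fderiv ℝ f y (EuclideanSpace.single l 1)) x _ = _
    rw [fderiv_clm_apply hd (differentiableAt_const _)]
    simp
  funext x
  rw [key, key]
  have := (hf.contDiffAt (x := x)).isSymmSndFDerivAt (n := ∞)
    (by simpa using show ((2 : ℕ∞) : ℕ∞ω) ≤ ((⊤ : ℕ∞) : ℕ∞ω) from WithTop.coe_le_coe.2 le_top)
  exact this.eq _ _

theorem pdw_pd_comm (hf : ContDiff ℝ ∞ f) (I : List (Fin n)) (k : Fin n) :
    pdw I (pd k f) = pd k (pdw I f) := by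
  induction I with
  | nil => rfl
  | cons l I ih => rw [pdw_cons, pdw_cons, ih, pd_comm (contDiff_pdw hf I)]

theorem norm_iteratedFDeriv_pd_le (hf : ContDiffAt ℝ ∞ f x) (k : Fin n) (i : ℕ) :
    ‖iteratedFDeriv ℝ i (pd k f) x‖ ≤ ‖iteratedFDeriv ℝ (i + 1) f x‖ := by
  have hf' : ContDiffAt ℝ ∞ (fderiv ℝ f) x := hf.fderiv_right (by simp)
  have h := norm_iteratedFDeriv_clm_apply_const (𝕜 := ℝ) (c := EuclideanSpace.single k (1 : ℝ))
    (n := i) (N := ∞) (x := x) hf' (mod_cast le_top)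
  rwa [show ‖EuclideanSpace.single k (1 : ℝ)‖ = 1 by simp, one_mul, norm_iteratedFDeriv_fderiv] at h

/-- The derivative splits as `f' = ∑_k A_k ∘ ∂_k f`, where `A_k z` is the map `v ↦ v_k z`. Each
`A_k` is linear of norm at most one, so one Fréchet derivative is traded for partial derivatives. -/
theorem norm_iteratedFDeriv_succ_le (hf : ContDiffAt ℝ ∞ f x) (i : ℕ) :
    ‖iteratedFDeriv ℝ (i + 1) f x‖ ≤ ∑ k, ‖iteratedFDeriv ℝ i (pd k f) x‖ := by
  have hpd : ∀ k, ContDiffAt ℝ ∞ (pd k f) x := fun k =>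
    (hf.fderiv_right (m := ∞) (by simp)).clm_apply contDiffAt_const
  let A : Fin n → (ℂ →L[ℝ] Eu n →L[ℝ] ℂ) := fun k =>
    ContinuousLinearMap.smulRightL ℝ (Eu n) ℂ (EuclideanSpace.proj k)
  have hA : ∀ k, ‖A k‖ ≤ 1 := by
    intro k
    refine ContinuousLinearMap.opNorm_le_bound _ zero_le_one fun z => ?_
    refine ContinuousLinearMap.opNorm_le_bound _ (by positivity) fun v => ?_
    change ‖(v k : ℝ) • z‖ ≤ _
    rw [norm_smul, one_mul, mul_comm]
    exact mul_le_mul_of_nonneg_left (PiLp.norm_apply_le v k) (norm_nonneg _)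
  have hfd : fderiv ℝ f = fun y => ∑ k, (A k ∘ pd k f) y := by
    funext y
    ext v
    rw [fderiv_eq_sum_pd, _root_.sum_apply]
    refine Finset.sum_congr rfl fun k _ => ?_
    exact (Complex.real_smul (x := v k) (z := pd k f y)).symm
  rw [← norm_iteratedFDeriv_fderiv, hfd, iteratedFDeriv_fun_sum_apply]
  · refine (norm_sum_le _ _).trans (Finset.sum_le_sum fun k _ => ?_)
    refine ((A k).norm_iteratedFDeriv_comp_left (hpd k) (mod_cast le_top)).trans ?_
    exact mul_le_of_le_one_left (norm_nonneg _) (hA k)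
  · intro k _
    exact ((A k).contDiff.contDiffAt.comp x (hpd k)).of_le (mod_cast le_top)

/-- Words of partial derivatives are easier to commute with convolutions and Fourier transforms than
Fréchet derivatives are. This converts bounds back, each order costing a sum over `n` directions. -/
theorem norm_iteratedFDeriv_le_of_pdw (hU : IsOpen U) (hf : ContDiffOn ℝ ∞ f U) (hx : x ∈ U) {B : ℝ}
    (hB : 0 ≤ B) (i : ℕ) (h : ∀ I : List (Fin n), I.length ≤ i → ‖pdw I f x‖ ≤ B) :
    ‖iteratedFDeriv ℝ i f x‖ ≤ (n + 1) ^ i * B := by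
  induction i generalizing f with
  | zero => simpa using h [] le_rfl
  | succ i ih =>
    refine (norm_iteratedFDeriv_succ_le (contDiffAt_of_isOpen hU hf hx) i).trans ?_
    have : ∀ k, ‖iteratedFDeriv ℝ i (pd k f) x‖ ≤ (n + 1) ^ i * B := fun k =>
      ih (contDiffOn_pd hU hf k) fun I hI => by
        have := h (I ++ [k]) (by simpa using hI)
        rwa [pdw_append] at this
    refine (Finset.sum_le_sum fun k _ => this k).trans ?_
    rw [Finset.sum_const, Finset.card_univ, Fintype.card_fin, nsmul_eq_mul, pow_succ]
    nlinarith [mul_nonneg (pow_nonneg (show (0 : ℝ) ≤ n + 1 by positivity) i) hB]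

theorem supNorm_le_of_pdw (hU : IsOpen U) (hf : ContDiffOn ℝ ∞ f U) (hK : K ⊆ U) {B : ℝ}
    (hB : 0 ≤ B) (j : ℕ)
    (h : ∀ x ∈ K, ∀ I : List (Fin n), I.length ≤ j → ‖pdw I f x‖ ≤ B) :
    supNorm K j f ≤ (n + 1) ^ j * B := by
  refine supNorm_le (by positivity) fun x hx i hi => ?_
  refine (norm_iteratedFDeriv_le_of_pdw hU hf (hK hx) hB i fun I hI => h x hx I (by omega)).trans ?_
  exact mul_le_mul_of_nonneg_right (pow_le_pow_right₀ (by simp) hi) hB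

theorem norm_pdw_le (hU : IsOpen U) (hf : ContDiffOn ℝ ∞ f U) (hx : x ∈ U) (I : List (Fin n)) (i : ℕ) :
    ‖iteratedFDeriv ℝ i (pdw I f) x‖ ≤ ‖iteratedFDeriv ℝ (i + I.length) f x‖ := by
  induction I generalizing i with
  | nil => rfl
  | cons k I ih =>
    refine (norm_iteratedFDeriv_pd_le (contDiffAt_of_isOpen hU (contDiffOn_pdw hU hf I) hx) k i).trans ?_
    refine (ih (i + 1)).trans (le_of_eq ?_)
    rw [List.length_cons, add_right_comm, add_assoc]

theorem le_supNorm_of_contDiffOn (hU : IsOpen U) (hf : ContDiffOn ℝ ∞ f U) (hK : IsCompact K)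
    (hKU : K ⊆ U) (hx : x ∈ K) {i j : ℕ} (hi : i ≤ j) :
    ‖iteratedFDeriv ℝ i f x‖ ≤ supNorm K j f := by
  have hb : ∀ i : ℕ, ∃ C, ∀ y ∈ K, ‖iteratedFDeriv ℝ i f y‖ ≤ C := fun i => by
    refine hK.exists_bound_of_continuousOn fun y hy => ContinuousAt.continuousWithinAt ?_
    exact ((contDiffAt_of_isOpen hU hf (hKU hy)).iteratedFDeriv_right (m := 0) (i := i)
      (mod_cast le_top)).continuousAt
  choose C hC using hb
  refine le_ciSup (f := fun p : K × Fin (j + 1) => ‖iteratedFDeriv ℝ (p.2 : ℕ) f p.1‖)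
    ⟨∑ i : Fin (j + 1), |C i|, ?_⟩ (⟨x, hx⟩, ⟨i, Nat.lt_succ_iff.2 hi⟩)
  rintro _ ⟨p, rfl⟩
  exact ((hC _ _ p.1.2).trans (le_abs_self _)).trans
    (Finset.single_le_sum (f := fun i : Fin (j + 1) => |C i|) (fun _ _ => abs_nonneg _)
      (Finset.mem_univ p.2))

theorem norm_pdw_le_supNorm (hU : IsOpen U) (hf : ContDiffOn ℝ ∞ f U) (hK : IsCompact K)
    (hKU : K ⊆ U) (hx : x ∈ K) {I : List (Fin n)} {j : ℕ} (hI : I.length ≤ j) :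
    ‖pdw I f x‖ ≤ supNorm K j f := by
  have := norm_pdw_le hU hf (hKU hx) I 0
  rw [norm_iteratedFDeriv_zero] at this
  exact this.trans (le_supNorm_of_contDiffOn hU hf hK hKU hx (by omega))

theorem norm_le_supNorm (hU : IsOpen U) (hf : ContDiffOn ℝ ∞ f U) (hK : IsCompact K)
    (hKU : K ⊆ U) (hx : x ∈ K) (j : ℕ) : ‖f x‖ ≤ supNorm K j f :=
  norm_pdw_le_supNorm hU hf hK hKU hx (I := []) (Nat.zero_le _)

theorem supNorm_pdw_le (hU : IsOpen U) (hf : ContDiffOn ℝ ∞ f U) (hK : IsCompact K)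
    (hKU : K ⊆ U) (I : List (Fin n)) (j : ℕ) :
    supNorm K j (pdw I f) ≤ supNorm K (j + I.length) f :=
  supNorm_le (supNorm_nonneg _) fun _ hx i hi => (norm_pdw_le hU hf (hKU hx) I i).trans
    (le_supNorm_of_contDiffOn hU hf hK hKU hx (by omega))

theorem supNorm_mono (hU : IsOpen U) (hf : ContDiffOn ℝ ∞ f U) {L : Set (Eu n)} (hL : IsCompact L)
    (hLU : L ⊆ U) (hKL : K ⊆ L) {i j : ℕ} (hij : i ≤ j) : supNorm K i f ≤ supNorm L j f :=
  supNorm_le (supNorm_nonneg _) fun _ hx _ hi =>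
    le_supNorm_of_contDiffOn hU hf hL hLU (hKL hx) (hi.trans hij)

theorem supNorm_shift_le (hf : ContDiff ℝ ∞ f) {L : Set (Eu n)} (hL : IsCompact L) (y : Eu n)
    (h : ∀ z ∈ K, y + z ∈ L) (j : ℕ) : supNorm K j (fun z => f (y + z)) ≤ supNorm L j f := by
  refine supNorm_le (supNorm_nonneg _) fun z hz i hi => ?_
  rw [iteratedFDeriv_comp_add_left]
  exact le_supNorm hL hf (h z hz) hi

/-- Leibniz bound for the seminorms of a product. -/
theorem supNorm_mul_le (hU : IsOpen U) (hf : ContDiffOn ℝ ∞ f U) (hg : ContDiffOn ℝ ∞ g U)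
    (hK : IsCompact K) (hKU : K ⊆ U) (j : ℕ) :
    supNorm K j (fun x => f x * g x) ≤ 2 ^ j * supNorm K j f * supNorm K j g := by
  have h0 : 0 ≤ supNorm K j f * supNorm K j g := mul_nonneg (supNorm_nonneg _) (supNorm_nonneg _)
  refine supNorm_le (by rw [mul_assoc]; positivity) fun x hx i hi => ?_
  have hx' := hKU hx
  have h := (ContinuousLinearMap.mul ℝ ℂ).norm_iteratedFDerivWithin_le_of_bilinear_of_le_one hf hg
    hU.uniqueDiffOn hx' (n := i) (mod_cast le_top) (ContinuousLinearMap.opNorm_mul_le ℝ ℂ)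
  simp only [iteratedFDerivWithin_of_isOpen _ hU hx', ContinuousLinearMap.mul_apply'] at h
  refine h.trans ?_
  calc _ ≤ ∑ l ∈ Finset.range (i + 1), (i.choose l : ℝ) * (supNorm K j f * supNorm K j g) := by
        refine Finset.sum_le_sum fun l hl => ?_
        rw [mul_assoc]
        have hl' : l ≤ i := Nat.lt_succ_iff.1 (Finset.mem_range.1 hl)
        exact mul_le_mul_of_nonneg_left (mul_le_mul
          (le_supNorm_of_contDiffOn hU hf hK hKU hx (by omega))
          (le_supNorm_of_contDiffOn hU hg hK hKU hx (by omega)) (norm_nonneg _)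
          (supNorm_nonneg _)) (Nat.cast_nonneg _)
    _ = 2 ^ i * (supNorm K j f * supNorm K j g) := by
        rw [← Finset.sum_mul]
        congr 1
        exact_mod_cast Nat.sum_range_choose i
    _ ≤ 2 ^ j * supNorm K j f * supNorm K j g := by
        rw [mul_assoc]
        exact mul_le_mul_of_nonneg_right (pow_le_pow_right₀ one_le_two hi) h0

end Calculus

/-! ### Compactly supported distributions -/

/-- The space `C^∞(ℝⁿ)`. -/
def Sm (n : ℕ) : Submodule ℂ (Eu n → ℂ) where
  carrier := {f | ContDiff ℝ ∞ f}
  zero_mem' := (contDiff_const : ContDiff ℝ ∞ fun _ : Eu n => (0 : ℂ))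
  add_mem' {f _} hf hg := (show ContDiff ℝ ∞ f from hf).add hg
  smul_mem' c f hf := (show ContDiff ℝ ∞ f from hf).const_smul c

theorem Sm.contDiff (u : Sm n) : ContDiff ℝ ∞ u.1 := u.2

theorem Sm.contDiffOn (u : Sm n) (U : Set (Eu n)) : ContDiffOn ℝ ∞ u.1 U := (Sm.contDiff u).contDiffOn

theorem pdw_add {f g : Eu n → ℂ} (I : List (Fin n)) (hf : ContDiff ℝ ∞ f) (hg : ContDiff ℝ ∞ g) :
    pdw I (f + g) = pdw I f + pdw I g := by
  induction I with
  | nil => rfl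
  | cons k I ih => rw [pdw_cons, ih, pd_add k (contDiff_pdw hf I) (contDiff_pdw hg I)]; rfl

theorem pdw_const_smul {f : Eu n → ℂ} (I : List (Fin n)) (c : ℂ) (hf : ContDiff ℝ ∞ f) :
    pdw I (c • f) = c • pdw I f := by
  induction I with
  | nil => rfl
  | cons k I ih => rw [pdw_cons, ih, pd_const_smul k c (contDiff_pdw hf I)]; rfl

/-- Translation: `z ↦ u (y + z)`. -/
def Sm.shift (y : Eu n) : Sm n →ₗ[ℂ] Sm n where
  toFun u := ⟨fun z => u.1 (y + z), (Sm.contDiff u).comp (contDiff_const.add contDiff_id)⟩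
  map_add' _ _ := rfl
  map_smul' _ _ := rfl

/-- Reflection: `z ↦ u (-z)`. -/
def Sm.refl : Sm n →ₗ[ℂ] Sm n where
  toFun u := ⟨fun z => u.1 (-z), (Sm.contDiff u).comp contDiff_neg⟩
  map_add' _ _ := rfl
  map_smul' _ _ := rfl

/-- The partial derivative on `C^∞(ℝⁿ)`. -/
def Sm.pd (k : Fin n) : Sm n →ₗ[ℂ] Sm n where
  toFun u := ⟨Colombeau.pd k u.1, contDiff_pd u.2 k⟩
  map_add' u v := Subtype.ext (pd_add k u.2 v.2)
  map_smul' c u := Subtype.ext (pd_const_smul k c u.2)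

/-- The iterated partial derivative on `C^∞(ℝⁿ)`. -/
def Sm.pdw (I : List (Fin n)) : Sm n →ₗ[ℂ] Sm n where
  toFun u := ⟨Colombeau.pdw I u.1, contDiff_pdw u.2 I⟩
  map_add' u v := Subtype.ext (pdw_add I u.2 v.2)
  map_smul' c u := Subtype.ext (pdw_const_smul I c u.2)

/-- `S` is dominated by `C · p_{K,j}`. -/
def DominatedBy (S : Sm n →ₗ[ℂ] ℂ) (K : Set (Eu n)) (j : ℕ) (C : ℝ) : Prop :=
  ∀ f : Sm n, ‖S f‖ ≤ C * supNorm K j f.1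

/-- The convolution-type pairing `y ↦ S (u (y + ·))`. -/
def star (S : Sm n →ₗ[ℂ] ℂ) (u : Sm n) : Eu n → ℂ := fun y => S (Sm.shift y u)

/-- Mean value inequality twice: first for `g'` along the segment, then for `g` minus its linear
part. The bound is uniform for base points in a ball, as the second derivative is bounded on the
ball of radius `R + 1`. -/
theorem exists_taylor_bound {g : Eu n → ℂ} (hg : ContDiff ℝ ∞ g) (R : ℝ) :
    ∃ M : ℝ, 0 ≤ M ∧ ∀ x v : Eu n, ‖x‖ ≤ R → ‖v‖ ≤ 1 →
      ‖g (x + v) - g x - fderiv ℝ g x v‖ ≤ M * ‖v‖ ^ 2 := by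
  have hg1 : ContDiff ℝ ∞ (fderiv ℝ g) := hg.fderiv_right (by simp)
  obtain ⟨M, hM⟩ := (isCompact_closedBall (0 : Eu n) (R + 1)).exists_bound_of_continuousOn
    (hg1.continuous_fderiv (by simp)).continuousOn
  refine ⟨|M|, abs_nonneg M, fun x v hx hv => ?_⟩
  have hseg : segment ℝ x (x + v) ⊆ Metric.closedBall 0 (R + 1) := by
    refine (convex_closedBall _ _).segment_subset ?_ ?_
    · rw [mem_closedBall_zero_iff]; linarith
    · rw [mem_closedBall_zero_iff]; linarith [norm_add_le x v]
  have h1 : ∀ z ∈ segment ℝ x (x + v), ‖fderiv ℝ g z - fderiv ℝ g x‖ ≤ |M| * ‖v‖ := by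
    intro z hz
    have h := (convex_segment x (x + v)).norm_image_sub_le_of_norm_fderiv_le (𝕜 := ℝ)
      (f := fderiv ℝ g) (C := |M|) (fun w _ => hg1.differentiable (by simp) w)
      (fun w hw => (hM w (hseg hw)).trans (le_abs_self M)) (left_mem_segment ℝ _ _) hz
    refine h.trans (mul_le_mul_of_nonneg_left ?_ (abs_nonneg M))
    obtain ⟨t, ht, rfl⟩ := segment_eq_image' ℝ x (x + v) ▸ hz
    simp only [add_sub_cancel_left, norm_smul, Real.norm_eq_abs, abs_of_nonneg ht.1]
    exact mul_le_of_le_one_left (norm_nonneg _) ht.2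
  have h2 := (convex_segment x (x + v)).norm_image_sub_le_of_norm_fderiv_le' (𝕜 := ℝ)
    (f := g) (C := |M| * ‖v‖) (φ := fderiv ℝ g x) (fun w _ => hg.differentiable (by simp) w)
    h1 (left_mem_segment ℝ _ _) (right_mem_segment ℝ _ _)
  rw [add_sub_cancel_left] at h2
  exact h2.trans (le_of_eq (by ring))

/-! ### Smoothness of `y ↦ S (u (y + ·))` -/

section Star

variable {S : Sm n →ₗ[ℂ] ℂ} {K : Set (Eu n)} {j : ℕ} {C : ℝ}

/-- Derivatives in `z` of the Taylor remainder of `u` are Taylor remainders of derivatives of `u`.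
Hence the remainder is quadratic in `v` for every seminorm, not just uniformly. -/
theorem pdw_shift_remainder (u : Sm n) (y v : Eu n) (I : List (Fin n)) :
    Colombeau.pdw I (Sm.shift (y + v) u - Sm.shift y u - ∑ k, (v k : ℂ) • Sm.shift y (Sm.pd k u) : Sm n).1 =
      fun z => pdw I u.1 (y + z + v) - pdw I u.1 (y + z) - fderiv ℝ (pdw I u.1) (y + z) v := by
  have h1 : ∀ w : Sm n, Colombeau.pdw I w.1 = (Sm.pdw I w).1 := fun _ => rfl
  rw [h1, map_sub, map_sub, map_sum]
  have h2 : ∀ (w : Sm n) (y z : Eu n), (Sm.pdw I (Sm.shift y w)).1 z = pdw I w.1 (y + z) :=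
    fun w y z => congrFun (pdw_shift I y w.1) z
  funext z
  rw [fderiv_eq_sum_pd]
  simp only [map_smul]
  simp only [Submodule.coe_sub, Submodule.coe_sum, Submodule.coe_smul, Pi.sub_apply,
    Finset.sum_apply, Pi.smul_apply, h2, smul_eq_mul]
  rw [show y + v + z = y + z + v by abel]
  congr 1
  refine Finset.sum_congr rfl fun k _ => ?_
  rw [← pdw_pd_comm u.2 I k]
  rfl

theorem hasFDerivAt_star (hK : IsCompact K) (hS : DominatedBy S K j C) (u : Sm n) (y : Eu n) :
    HasFDerivAt (star S u)
      (∑ k, (EuclideanSpace.proj k : Eu n →L[ℝ] ℝ).smulRight (star S (Sm.pd k u) y)) y := by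
  obtain ⟨R, hR⟩ := hK.isBounded.exists_norm_le
  choose M hM0 hM using fun I : List (Fin n) => exists_taylor_bound (contDiff_pdw u.2 I) (‖y‖ + R)
  -- There are finitely many words of length at most `j`, so their Taylor constants have a common
  -- bound.
  obtain ⟨B, hB⟩ := ((List.finite_length_le (Fin n) j : Set.Finite _).image M).bddAbove
  have hB' : ∀ I : List (Fin n), I.length ≤ j → M I ≤ |B| := fun I hI =>
    (hB ⟨I, hI, rfl⟩).trans (le_abs_self B)
  rw [hasFDerivAt_iff_isLittleO_nhds_zero]
  have hO : (fun v : Eu n => star S u (y + v) - star S u y -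
      (∑ k, (EuclideanSpace.proj k : Eu n →L[ℝ] ℝ).smulRight (star S (Sm.pd k u) y)) v)
      =O[𝓝 0] fun v => ‖v‖ ^ 2 := by
    refine IsBigO.of_bound (|C| * ((n + 1) ^ j * |B|)) ?_
    filter_upwards [Metric.closedBall_mem_nhds (0 : Eu n) one_pos] with v hv
    rw [mem_closedBall_zero_iff] at hv
    have e : star S u (y + v) - star S u y -
        (∑ k, (EuclideanSpace.proj k : Eu n →L[ℝ] ℝ).smulRight (star S (Sm.pd k u) y)) v =
        S (Sm.shift (y + v) u - Sm.shift y u - ∑ k, (v k : ℂ) • Sm.shift y (Sm.pd k u)) := by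
      rw [map_sub, map_sub, map_sum, _root_.sum_apply]
      simp only [map_smul, smul_eq_mul]
      rfl
    rw [e, norm_pow, norm_norm, mul_assoc]
    refine (hS _).trans (mul_le_mul (le_abs_self C) ?_ (supNorm_nonneg _) (abs_nonneg C))
    rw [mul_assoc]
    refine supNorm_le_of_pdw isOpen_univ (Sm.contDiffOn _ _)
      (Set.subset_univ _) (by positivity) j fun z hz I hI => ?_
    rw [pdw_shift_remainder]
    refine (hM I _ v ((norm_add_le _ _).trans (by linarith [hR z hz])) hv).trans ?_
    exact mul_le_mul_of_nonneg_right (hB' I hI) (by positivity)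
  refine hO.trans_isLittleO ?_
  have : (fun v : Eu n => ‖v‖ ^ 2) =o[𝓝 0] fun v => ‖v‖ ^ 1 :=
    (isLittleO_pow_pow one_lt_two).comp_tendsto (tendsto_norm_zero (E := Eu n))
  exact isLittleO_norm_right.1 (by simpa using this)

/-- The partial derivatives of `star S u` are again of the form `star S (∂_k u)`, so the order of
differentiability grows by induction with `u` arbitrary. -/
theorem contDiff_star (hK : IsCompact K) (hS : DominatedBy S K j C) (u : Sm n) :
    ContDiff ℝ ∞ (star S u) := by
  rw [contDiff_infty]
  intro m
  induction m generalizing u with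
  | zero =>
    exact contDiff_zero.2 (continuous_iff_continuousAt.2 fun y =>
      (hasFDerivAt_star hK hS u y).continuousAt)
  | succ m ih =>
    have hd : fderiv ℝ (star S u) = fun y =>
        ∑ k, (EuclideanSpace.proj k : Eu n →L[ℝ] ℝ).smulRight (star S (Sm.pd k u) y) :=
      funext fun y => (hasFDerivAt_star hK hS u y).fderiv
    rw [show ((m + 1 : ℕ) : ℕ∞ω) = (m : ℕ∞ω) + 1 by push_cast; rfl, contDiff_succ_iff_fderiv]
    refine ⟨fun y => (hasFDerivAt_star hK hS u y).differentiableAt, by simp, ?_⟩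
    rw [hd]
    exact ContDiff.sum fun k _ => contDiff_const.smulRight (ih (Sm.pd k u))

theorem pd_star (hK : IsCompact K) (hS : DominatedBy S K j C) (u : Sm n) (k : Fin n) :
    pd k (star S u) = star S (Sm.pd k u) := by
  funext y
  rw [pd, (hasFDerivAt_star hK hS u y).fderiv, _root_.sum_apply, Finset.sum_eq_single k]
  · simp
  · intro l _ hl
    simp [hl]
  · simp

theorem pdw_star (hK : IsCompact K) (hS : DominatedBy S K j C) (u : Sm n) (I : List (Fin n)) :
    pdw I (star S u) = star S (Sm.pdw I u) := by
  induction I with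
  | nil => rfl
  | cons k I ih => rw [pdw_cons, ih, pd_star hK hS]; rfl

end Star

/-! ### Extension of functionals and Fubini for compactly supported distributions -/

/-- Hahn–Banach: a functional that is dominated by a seminorm of `A v` factors through `A`. -/
theorem exists_dual_comp_eq {V W : Type*} [AddCommGroup V] [Module ℂ V] [AddCommGroup W] [Module ℂ W]
    (A : V →ₗ[ℂ] W) (S : V →ₗ[ℂ] ℂ) (p : Seminorm ℂ W) (h : ∀ v, ‖S v‖ ≤ p (A v)) :
    ∃ L : W →ₗ[ℂ] ℂ, (∀ v, L (A v) = S v) ∧ ∀ w, ‖L w‖ ≤ p w := by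
  have hker : LinearMap.ker A ≤ LinearMap.ker S := fun v hv => by
    have := h v
    rw [LinearMap.mem_ker.1 hv, map_zero] at this
    exact norm_le_zero_iff.1 this
  -- The bound forces `S` to vanish on the kernel of `A`, so `A v ↦ S v` is well defined on the
  -- range; Hahn–Banach extends it from there.
  let S' : LinearMap.range A →ₗ[ℂ] ℂ :=
    (LinearMap.ker A).liftQ S hker ∘ₗ A.quotKerEquivRange.symm.toLinearMap
  have hS' : ∀ v, S' ⟨A v, LinearMap.mem_range_self A v⟩ = S v := fun v => by
    have : A.quotKerEquivRange.symm ⟨A v, LinearMap.mem_range_self A v⟩ =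
        (LinearMap.ker A).mkQ v := by
      rw [LinearEquiv.symm_apply_eq]
      rfl
    simp [S', this]
  obtain ⟨L, hL, hL'⟩ := Module.Dual.exists_extension_of_le_seminorm (LinearMap.range A) S' (p := p)
    (by
      rintro ⟨_, v, rfl⟩
      rw [hS']
      exact h v)
  exact ⟨L, fun v => (hL ⟨A v, LinearMap.mem_range_self A v⟩).trans (hS' v), hL'⟩

theorem integrable_mul_of_hasCompactSupport {g f : Eu n → ℂ} (hg : Continuous g)
    (hc : HasCompactSupport g) (hf : Continuous f) : Integrable fun x => g x * f x :=
  (hg.mul hf).integrable_of_hasCompactSupport hc.mul_right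

/-- The functional `f ↦ ∫ g f`. -/
def intFun (g : Eu n → ℂ) (hg : Continuous g) (hc : HasCompactSupport g) : Sm n →ₗ[ℂ] ℂ where
  toFun f := ∫ x, g x * f.1 x
  map_add' f f' := by
    rw [← integral_add (integrable_mul_of_hasCompactSupport hg hc (Sm.contDiff f).continuous)
      (integrable_mul_of_hasCompactSupport hg hc (Sm.contDiff f').continuous)]
    exact integral_congr_ae (.of_forall fun x => mul_add _ _ _)
  map_smul' c f := by
    rw [RingHom.id_apply, smul_eq_mul, ← integral_const_mul]
    exact integral_congr_ae (.of_forall fun x => mul_left_comm _ _ _)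

theorem norm_integral_mul_le {g f : Eu n → ℂ} {B : ℝ} (hg : Continuous g)
    (hc : HasCompactSupport g) (hf : ∀ x ∈ tsupport g, ‖f x‖ ≤ B) :
    ‖∫ x, g x * f x‖ ≤ (∫ x, ‖g x‖) * B := by
  rw [← integral_mul_const]
  refine norm_integral_le_of_norm_le
    ((hg.integrable_of_hasCompactSupport hc).norm.mul_const B) (.of_forall fun x => ?_)
  rw [norm_mul]
  by_cases hx : x ∈ tsupport g
  · exact mul_le_mul_of_nonneg_left (hf x hx) (norm_nonneg _)
  · simp [image_eq_zero_of_notMem_tsupport hx]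

theorem dominatedBy_intFun {g : Eu n → ℂ} (hg : Continuous g) (hc : HasCompactSupport g) :
    DominatedBy (intFun g hg hc) (tsupport g) 0 (∫ x, ‖g x‖) := fun f =>
  norm_integral_mul_le hg hc fun _ hx =>
    norm_le_supNorm isOpen_univ (Sm.contDiffOn f _) hc (Set.subset_univ _) hx 0

/-- The convolution `y ↦ S (u (y + ·))` as an element of `C^∞(ℝⁿ)`. -/
def starSm {S : Sm n →ₗ[ℂ] ℂ} {K : Set (Eu n)} {j : ℕ} {C : ℝ} (hK : IsCompact K)
    (hS : DominatedBy S K j C) (u : Sm n) : Sm n :=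
  ⟨star S u, contDiff_star hK hS u⟩

/-- The jet of order `j` of a smooth function on `K`. -/
def jet (K : Set (Eu n)) (j : ℕ) :
    Sm n →ₗ[ℂ] ({I : List (Fin n) // I.length ≤ j} → C(K, ℂ)) where
  toFun f I := ⟨fun x => pdw I.1 f.1 x, by
    exact (contDiff_pdw f.2 I.1).continuous.comp continuous_subtype_val⟩
  map_add' f g := by
    funext I
    ext x
    exact congrFun (pdw_add I.1 f.2 g.2) x
  map_smul' c f := by
    funext I
    ext x
    exact congrFun (pdw_const_smul I.1 c f.2) x

/-- Fubini for a distribution. As `S` depends only on jets of order `j` on `K`, Hahn–Banach extends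
it to a continuous functional on a finite power of `C(K)`. There `y ↦ g(y) u(y + ·)` has a Bochner
integral, which commutes with continuous functionals. -/
theorem integral_mul_star {S : Sm n →ₗ[ℂ] ℂ} {K : Set (Eu n)} {j : ℕ} {C : ℝ} (hK : IsCompact K)
    (hS : DominatedBy S K j C) {g : Eu n → ℂ} (hg : Continuous g) (hc : HasCompactSupport g)
    (u : Sm n) :
    ∫ y, g y * star S u y = S (starSm hc (dominatedBy_intFun hg hc) u) := by
  have : CompactSpace K := isCompact_iff_compactSpace.1 hK
  have : Finite {I : List (Fin n) // I.length ≤ j} := List.finite_length_le (Fin n) j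
  let _ : Fintype {I : List (Fin n) // I.length ≤ j} := Fintype.ofFinite _
  let W := {I : List (Fin n) // I.length ≤ j} → C(K, ℂ)
  have hC : 0 ≤ |C| * (n + 1) ^ j := by positivity
  obtain ⟨L, hL, hL'⟩ := exists_dual_comp_eq (jet K j) S
    (Real.toNNReal (|C| * (n + 1) ^ j) • normSeminorm ℂ W) (fun f => by
      change _ ≤ ((|C| * (n + 1) ^ j).toNNReal : ℝ) * ‖jet K j f‖
      rw [Real.coe_toNNReal _ hC, mul_assoc]
      refine (hS f).trans (mul_le_mul (le_abs_self C) ?_ (supNorm_nonneg _) (abs_nonneg C))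
      refine supNorm_le_of_pdw isOpen_univ (Sm.contDiffOn f _) (Set.subset_univ _)
        (norm_nonneg _) j fun x hx I hI => ?_
      exact ((jet K j f ⟨I, hI⟩).norm_coe_le_norm ⟨x, hx⟩).trans (norm_le_pi_norm _ _))
  let L' : W →L[ℂ] ℂ := L.mkContinuous (|C| * (n + 1) ^ j).toNNReal hL'
  have hcont : Continuous fun y => jet K j (Sm.shift y u) := by
    refine continuous_pi fun I => ContinuousMap.continuous_of_continuous_uncurry _ ?_
    have e : (Function.uncurry fun (y : Eu n) (x : K) => jet K j (Sm.shift y u) I x) =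
        fun p : Eu n × K => pdw I.1 u.1 (p.1 + p.2) := by
      funext p
      exact congrFun (pdw_shift I.1 p.1 u.1) p.2
    refine e ▸ (contDiff_pdw u.2 I.1).continuous.comp ?_
    exact continuous_fst.add (continuous_subtype_val.comp continuous_snd)
  have hint : Integrable fun y => g y • jet K j (Sm.shift y u) :=
    (hg.smul hcont).integrable_of_hasCompactSupport hc.smul_right
  -- The vector-valued integral is identified by testing it with the point evaluations of each
  -- component of the jet, which are continuous and linear.
  have key : ∫ y, g y • jet K j (Sm.shift y u) =
      jet K j (starSm hc (dominatedBy_intFun hg hc) u) := by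
    funext I
    ext x
    have h1 := (((ContinuousMap.evalCLM ℂ x).comp
      (ContinuousLinearMap.proj (R := ℂ) (φ := fun _ => C(K, ℂ)) I)).integral_comp_comm hint).symm
    refine h1.trans ?_
    change _ = pdw I.1 (star (intFun g hg hc) u) x
    rw [pdw_star hc (dominatedBy_intFun hg hc)]
    refine integral_congr_ae (.of_forall fun y => ?_)
    change g y * pdw I.1 (fun z => u.1 (y + z)) x = g y * pdw I.1 u.1 (x + y)
    rw [pdw_shift, add_comm]
  rw [← hL, ← key]
  change _ = L' _
  rw [← L'.integral_comp_comm hint]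
  refine integral_congr_ae (.of_forall fun y => ?_)
  change g y * S (Sm.shift y u) = L (g y • jet K j (Sm.shift y u))
  rw [map_smul, hL, smul_eq_mul]

/-! ### Lower bounds for polynomials -/

section PolynomialBounds

/-- Division by a linear factor: a bound for `(z - a) h(z)` on a disc gives a bound for
`(w - a) h(z)` on a smaller disc. -/
theorem norm_sub_mul_le_of_entire {h : ℂ → ℂ} (hh : Differentiable ℂ h) {a w : ℂ} {R δ B : ℝ}
    (hδ : 0 < δ) (hR : R ≤ 1) (hB : ∀ z, ‖z‖ ≤ R → ‖(z - a) * h z‖ ≤ B) (z : ℂ)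
    (hz : ‖z‖ ≤ R - δ) : ‖(w - a) * h z‖ ≤ (1 + 2 * (1 + ‖w‖) / δ) * B := by
  -- At distance at least `δ/2` from the root, `|w - a| ≤ (1 + |w|) + |ζ - a|`, and `1 + |w|` is at
  -- most `2(1 + |w|)/δ` times `|ζ - a|`.
  have key : ∀ ζ : ℂ, ‖ζ‖ ≤ R → δ / 2 ≤ ‖ζ - a‖ →
      ‖(w - a) * h ζ‖ ≤ (1 + 2 * (1 + ‖w‖) / δ) * B := by
    intro ζ hζ hζa
    have h1 : ‖w - a‖ ≤ (1 + 2 * (1 + ‖w‖) / δ) * ‖ζ - a‖ := by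
      have e1 : ‖w - a‖ ≤ (‖w‖ + ‖ζ‖) + ‖ζ - a‖ := by
        have : w - a = (w - ζ) + (ζ - a) := by ring
        rw [this]
        exact (norm_add_le _ _).trans (add_le_add_left (norm_sub_le _ _) _)
      have e2 : 1 + ‖w‖ ≤ 2 * (1 + ‖w‖) / δ * ‖ζ - a‖ := by
        rw [div_mul_eq_mul_div, le_div_iff₀ hδ]
        nlinarith [norm_nonneg w]
      linarith
    rw [norm_mul]
    calc ‖w - a‖ * ‖h ζ‖ ≤ (1 + 2 * (1 + ‖w‖) / δ) * ‖ζ - a‖ * ‖h ζ‖ :=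
          mul_le_mul_of_nonneg_right h1 (norm_nonneg _)
      _ = (1 + 2 * (1 + ‖w‖) / δ) * ‖(ζ - a) * h ζ‖ := by rw [norm_mul, mul_assoc]
      _ ≤ _ := mul_le_mul_of_nonneg_left (hB ζ hζ) (by positivity)
  rcases le_or_gt (δ / 2) ‖z - a‖ with hza | hza
  · exact key z (by linarith) hza
  · have hz' : z ∈ Metric.ball a (δ / 2) := by rwa [mem_ball_iff_norm]
    -- Close to the root, the maximum principle on the disc of radius `δ/2` about `a` applies. Its
    -- boundary lies within `δ` of `z`, hence still in the disc of radius `R`.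
    refine Complex.norm_le_of_forall_mem_frontier_norm_le (U := Metric.ball a (δ / 2))
      Metric.isBounded_ball ((hh.const_mul (w - a)).diffContOnCl) (fun ζ hζ => ?_)
      (subset_closure hz')
    rw [frontier_ball a (by positivity), mem_sphere_iff_norm] at hζ
    refine key ζ ?_ hζ.ge
    have e : ζ = (ζ - a) - (z - a) + z := by ring
    have := norm_add_le ((ζ - a) - (z - a)) z
    have := norm_sub_le (ζ - a) (z - a)
    rw [e]
    linarith

/-- The factors `z - a` are replaced by the constants `w - a` one root at a time. Each replacement
shrinks the disc by `δ`, and `δ * s.card ≤ R` keeps the origin inside to the end. -/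
theorem norm_multiset_prod_mul_le (s : Multiset ℂ) {w : ℂ} {δ : ℝ} (hδ : 0 < δ) :
    ∀ (g : ℂ → ℂ), Differentiable ℂ g → ∀ R B : ℝ, R ≤ 1 → δ * s.card ≤ R →
      (∀ z, ‖z‖ ≤ R → ‖(s.map (z - ·)).prod * g z‖ ≤ B) →
      ‖(s.map (w - ·)).prod * g 0‖ ≤ (1 + 2 * (1 + ‖w‖) / δ) ^ s.card * B := by
  induction s using Multiset.induction_on with
  | empty =>
    intro g _ R B _ hR hB
    simpa using hB 0 (by simpa using hR)
  | cons a s ih =>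
    intro g hg R B hR1 hR hB
    rw [Multiset.card_cons, Nat.cast_succ] at hR
    have hd : Differentiable ℂ fun z => (s.map (z - ·)).prod * g z := by
      refine Differentiable.mul ?_ hg
      clear ih hB hR
      induction s using Multiset.induction_on with
      | empty => simp
      | cons b s ihs =>
        simp only [Multiset.map_cons, Multiset.prod_cons]
        exact (differentiable_id.sub_const b).mul ihs
    have h1 := fun z hz => norm_sub_mul_le_of_entire hd (w := w) (a := a) hδ hR1
      (fun z hz => by simpa [mul_assoc] using hB z hz) z hz
    have h2 := ih (fun z => (w - a) * g z) (hg.const_mul _) (R - δ)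
      ((1 + 2 * (1 + ‖w‖) / δ) * B) (by linarith) (by linarith) (fun z hz => by
        rw [mul_left_comm]
        exact h1 z hz)
    rw [Multiset.map_cons, Multiset.prod_cons, Multiset.card_cons, pow_succ, mul_assoc (_ ^ _)]
    rwa [mul_assoc, mul_left_comm]

/-- Malgrange's inequality in one variable. -/
theorem norm_eval_mul_le (p : Polynomial ℂ) {m : ℕ} (hp : p.natDegree ≤ m) {g : ℂ → ℂ}
    (hg : Differentiable ℂ g) {B : ℝ} (hB : ∀ z, ‖z‖ ≤ 1 → ‖p.eval z * g z‖ ≤ B) (w : ℂ) :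
    ‖p.eval w * g 0‖ ≤ (1 + 2 * (m + 1) * (1 + ‖w‖)) ^ m * B := by
  have hB0 : 0 ≤ B := (norm_nonneg _).trans (hB 0 (by simp))
  have hsp := IsAlgClosed.splits p
  have he : ∀ z, p.eval z = p.leadingCoeff * (p.roots.map (z - ·)).prod := fun z => by
    rw [hsp.eval_eq_prod_roots]
  have hcard : p.roots.card ≤ m := (Polynomial.card_roots' p).trans hp
  -- With at most `m` roots, steps of length `1/(m + 1)` fit into the unit disc.
  have hδ : (0 : ℝ) < 1 / (m + 1) := by positivity
  have h := norm_multiset_prod_mul_le p.roots (w := w) hδ (fun z => p.leadingCoeff * g z)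
    (hg.const_mul _) 1 B le_rfl (by
      rw [one_div_mul_eq_div, div_le_one (by positivity)]
      have : (p.roots.card : ℝ) ≤ m := by exact_mod_cast hcard
      linarith) (fun z hz => by
      have := hB z hz
      rw [he z] at this
      rwa [mul_left_comm, ← mul_assoc])
  rw [he w, mul_assoc, mul_left_comm]
  refine h.trans (mul_le_mul_of_nonneg_right ?_ hB0)
  rw [show 2 * (1 + ‖w‖) / (1 / ((m : ℝ) + 1)) = 2 * (m + 1) * (1 + ‖w‖) by field_simp]
  refine pow_le_pow_right₀ ?_ hcard
  have : (0 : ℝ) ≤ 2 * (m + 1) * (1 + ‖w‖) := by positivity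
  linarith

/-- The polynomial `∑_{α ∈ s} c_α ζ^α`. -/
def symb (s : Finset (Fin n →₀ ℕ)) (c : (Fin n →₀ ℕ) → ℂ) : MvPolynomial (Fin n) ℂ :=
  ∑ α ∈ s, MvPolynomial.monomial α (c α)

theorem eval_symb (s : Finset (Fin n →₀ ℕ)) (c : (Fin n →₀ ℕ) → ℂ) (ζ : Fin n → ℂ) :
    (symb s c).eval ζ = ∑ α ∈ s, c α * ∏ k, ζ k ^ α k := by
  simp [symb, map_sum, MvPolynomial.eval_monomial, Finsupp.prod_fintype]

theorem totalDegree_symb_le (s : Finset (Fin n →₀ ℕ)) (c : (Fin n →₀ ℕ) → ℂ) :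
    (symb s c).totalDegree ≤ s.sup fun α => α.sum fun _ e => e :=
  MvPolynomial.totalDegree_finsetSum_le fun _ hα =>
    (MvPolynomial.totalDegree_monomial_le _ _).trans (Finset.le_sup (f := fun α => α.sum fun _ e => e) hα)

theorem coeff_symb {s : Finset (Fin n →₀ ℕ)} (c : (Fin n →₀ ℕ) → ℂ) {α : Fin n →₀ ℕ} (hα : α ∈ s) :
    (symb s c).coeff α = c α := by
  classical
  simp [symb, MvPolynomial.coeff_sum, MvPolynomial.coeff_monomial, hα]

/-- The coefficients of a polynomial are controlled by its values on a finite grid. -/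
theorem exists_grid_bound (s : Finset (Fin n →₀ ℕ)) (d : ℕ)
    (hd : (s.sup fun α => α.sum fun _ e => e) ≤ d) : ∃ C : ℝ, 0 < C ∧
    ∀ c : (Fin n →₀ ℕ) → ℂ, ∃ k : Fin n → Fin (d + 1),
      ∑ α ∈ s, ‖c α‖ ≤ C * ‖(symb s c).eval fun i => ((k i : ℕ) : ℂ)‖ := by
  classical
  let Φ : (s → ℂ) →ₗ[ℂ] ((Fin n → Fin (d + 1)) → ℂ) :=
    { toFun := fun c k => ∑ α : s, c α * ∏ i, ((k i : ℕ) : ℂ) ^ (α : Fin n →₀ ℕ) i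
      map_add' := fun c c' => by
        funext k
        simp [add_mul, Finset.sum_add_distrib]
      map_smul' := fun a c => by
        funext k
        simp [Finset.mul_sum, mul_assoc] }
  have hΦ : ∀ (c : (Fin n →₀ ℕ) → ℂ) (k : Fin n → Fin (d + 1)),
      Φ (fun α => c α) k = (symb s c).eval fun i => ((k i : ℕ) : ℂ) := by
    intro c k
    rw [eval_symb, ← Finset.sum_coe_sort s]
    rfl
  have hker : LinearMap.ker Φ = ⊥ := by
    rw [LinearMap.ker_eq_bot']
    intro c hc
    let c' : (Fin n →₀ ℕ) → ℂ := fun α => if h : α ∈ s then c ⟨α, h⟩ else 0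
    have hcc : (fun α : s => c' α) = c := by
      funext α
      simp [c']
    have h0 : symb s c' = 0 := by
      -- A polynomial of degree at most `d` in each variable that vanishes on a grid with `d + 1`
      -- nodes per axis is zero. Hence `Φ` is injective, and, its domain being finite-dimensional,
      -- bounded below.
      refine MvPolynomial.eq_zero_of_eval_zero_at_prod_finset _
        (fun _ => (Finset.range (d + 1)).image fun k : ℕ => (k : ℂ)) (fun i => ?_) (fun x hx => ?_)
      · rw [Finset.card_image_of_injective _ Nat.cast_injective, Finset.card_range]
        exact Nat.lt_succ_of_le ((MvPolynomial.degreeOf_le_totalDegree _ _).trans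
          ((totalDegree_symb_le s c').trans hd))
      · have hx' : ∀ i, ∃ k : Fin (d + 1), ((k : ℕ) : ℂ) = x i := fun i => by
          obtain ⟨k, hk, hkx⟩ := Finset.mem_image.1 (hx i)
          exact ⟨⟨k, Finset.mem_range.1 hk⟩, hkx⟩
        choose k hk using hx'
        have := congrFun hc k
        rw [← hcc, hΦ] at this
        rw [← funext hk]
        exact this
    funext α
    have := coeff_symb c' α.2
    rw [h0, MvPolynomial.coeff_zero] at this
    rw [← hcc]
    exact this.symm
  obtain ⟨κ, hκ, hΦκ⟩ := LinearMap.exists_antilipschitzWith Φ hker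
  refine ⟨(s.card + 1) * κ, by positivity, fun c => ?_⟩
  -- The supremum norm over the finite grid is attained at one node, which may depend on the
  -- coefficients.
  obtain ⟨k, -, hk⟩ := Finset.exists_max_image Finset.univ
    (fun k : Fin n → Fin (d + 1) => ‖(symb s c).eval fun i => ((k i : ℕ) : ℂ)‖) Finset.univ_nonempty
  refine ⟨k, ?_⟩
  have h1 : ‖fun α : s => c α‖ ≤ κ * ‖(symb s c).eval fun i => ((k i : ℕ) : ℂ)‖ := by
    refine (ZeroHomClass.bound_of_antilipschitz Φ hΦκ _).trans
      (mul_le_mul_of_nonneg_left ?_ κ.2)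
    rw [pi_norm_le_iff_of_nonneg (norm_nonneg _)]
    intro k'
    rw [hΦ]
    exact hk k' (Finset.mem_univ _)
  have h2 : ∑ α ∈ s, ‖c α‖ ≤ s.card * ‖fun α : s => c α‖ := by
    rw [← nsmul_eq_mul]
    exact Finset.sum_le_card_nsmul _ _ _ fun α hα => norm_le_pi_norm (fun α : s => c α) ⟨α, hα⟩
  refine h2.trans ((mul_le_mul_of_nonneg_left h1 (Nat.cast_nonneg _)).trans ?_)
  rw [← mul_assoc]
  refine mul_le_mul_of_nonneg_right ?_ (norm_nonneg _)
  exact mul_le_mul_of_nonneg_right (by linarith) κ.2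

end PolynomialBounds

/-! ### Integration by parts -/

theorem contDiff_of_forall_mem_tsupport {f : Eu n → ℂ} (h : ∀ x ∈ tsupport f, ContDiffAt ℝ ∞ f x) :
    ContDiff ℝ ∞ f :=
  contDiff_iff_contDiffAt.2 fun x => by
    by_cases hx : x ∈ tsupport f
    · exact h x hx
    · exact (contDiffAt_const (c := (0 : ℂ))).congr_of_eventuallyEq
        (notMem_tsupport_iff_eventuallyEq.1 hx)

/-- Off the support of `u` the product vanishes locally, so `g` may be arbitrary outside `U`. -/
theorem contDiff_mul_of_tsupport_subset {U : Set (Eu n)} (hU : IsOpen U) {g u : Eu n → ℂ}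
    (hg : ContDiffOn ℝ ∞ g U) (hu : ContDiff ℝ ∞ u) (hs : tsupport u ⊆ U) :
    ContDiff ℝ ∞ fun x => g x * u x :=
  contDiff_of_forall_mem_tsupport fun _ hx =>
    (contDiffAt_of_isOpen hU hg (hs (tsupport_mul_subset_right hx))).mul hu.contDiffAt

theorem integrable_mul_of_tsupport_subset {U : Set (Eu n)} (hU : IsOpen U) {g u : Eu n → ℂ}
    (hg : ContDiffOn ℝ ∞ g U) (hu : ContDiff ℝ ∞ u) (hc : HasCompactSupport u)
    (hs : tsupport u ⊆ U) : Integrable fun x => g x * u x :=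
  (contDiff_mul_of_tsupport_subset hU hg hu hs).continuous.integrable_of_hasCompactSupport
    hc.mul_left

theorem integral_mul_pd {U : Set (Eu n)} (hU : IsOpen U) {g u : Eu n → ℂ}
    (hg : ContDiffOn ℝ ∞ g U) (hu : ContDiff ℝ ∞ u) (hc : HasCompactSupport u)
    (hs : tsupport u ⊆ U) (k : Fin n) :
    ∫ x, g x * pd k u x = -∫ x, pd k g x * u x := by
  have hc' : HasCompactSupport (pd k u) := hc.mono' (subset_closure.trans (tsupport_pd_subset k u))
  refine integral_mul_fderiv_eq_neg_fderiv_mul_of_integrable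
    (integrable_mul_of_tsupport_subset hU (contDiffOn_pd hU hg k) hu hc hs)
    (integrable_mul_of_tsupport_subset hU hg (contDiff_pd hu k) hc'
      ((tsupport_pd_subset k u).trans hs))
    (integrable_mul_of_tsupport_subset hU hg hu hc hs)
    (fun x hx => (contDiffAt_of_isOpen hU hg (hs hx)).differentiableAt (by simp))
    (fun x _ => hu.differentiable (by simp) x)

theorem hasCompactSupport_pdw {u : Eu n → ℂ} (hc : HasCompactSupport u) (I : List (Fin n)) :
    HasCompactSupport (pdw I u) :=
  hc.mono' (subset_closure.trans (tsupport_pdw_subset I u))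

theorem integral_mul_pdw {U : Set (Eu n)} (hU : IsOpen U) {g u : Eu n → ℂ}
    (hg : ContDiffOn ℝ ∞ g U) (hu : ContDiff ℝ ∞ u) (hc : HasCompactSupport u)
    (hs : tsupport u ⊆ U) (I : List (Fin n)) :
    ∫ x, g x * pdw I u x = (-1) ^ I.length * ∫ x, pdw I.reverse g x * u x := by
  induction I generalizing g with
  | nil => simp
  | cons k I ih =>
    rw [pdw_cons, integral_mul_pd hU hg (contDiff_pdw hu I) (hasCompactSupport_pdw hc I)
      ((tsupport_pdw_subset I u).trans hs) k, ih (contDiffOn_pd hU hg k), List.reverse_cons,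
      pdw_append, List.length_cons, pow_succ]
    simp

/-! ### The Fourier–Laplace transform -/

/-- The phase `i ∑_k x_k ζ_k`. -/
def phase (ζ : Fin n → ℂ) (x : Eu n) : ℂ := Complex.I * ∑ k, (x k : ℂ) * ζ k

/-- The Fourier–Laplace transform `∫ f(x) exp(i ∑_k x_k ζ_k) dx`. -/
def FL (f : Eu n → ℂ) (ζ : Fin n → ℂ) : ℂ := ∫ x, f x * Complex.exp (phase ζ x)

theorem contDiff_coord (k : Fin n) : ContDiff ℝ ∞ fun x : Eu n => (x k : ℂ) :=
  Complex.ofRealCLM.contDiff.comp (EuclideanSpace.proj (𝕜 := ℝ) k).contDiff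

theorem contDiff_phase (ζ : Fin n → ℂ) : ContDiff ℝ ∞ (phase ζ) :=
  contDiff_const.mul (ContDiff.sum fun k _ => (contDiff_coord k).mul contDiff_const)

theorem contDiff_exp_phase (ζ : Fin n → ℂ) : ContDiff ℝ ∞ fun x => Complex.exp (phase ζ x) :=
  (contDiff_phase ζ).cexp

theorem hasFDerivAt_phase (ζ : Fin n → ℂ) (x : Eu n) :
    HasFDerivAt (phase ζ) (Complex.I • ∑ k, (ζ k • Complex.ofRealCLM.comp
      (EuclideanSpace.proj (𝕜 := ℝ) k : Eu n →L[ℝ] ℝ))) x := by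
  have h : ∀ k, HasFDerivAt (fun x : Eu n => (x k : ℂ) * ζ k) (ζ k • Complex.ofRealCLM.comp
      (EuclideanSpace.proj (𝕜 := ℝ) k : Eu n →L[ℝ] ℝ)) x := fun k =>
    ((Complex.ofRealCLM.comp (EuclideanSpace.proj (𝕜 := ℝ) k : Eu n →L[ℝ] ℝ)).hasFDerivAt).mul_const
      (ζ k)
  exact (HasFDerivAt.fun_sum fun k _ => h k).const_mul Complex.I

theorem pd_exp_phase (ζ : Fin n → ℂ) (k : Fin n) :
    pd k (fun x => Complex.exp (phase ζ x)) = fun x => Complex.I * ζ k * Complex.exp (phase ζ x) := by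
  funext x
  rw [pd, (hasFDerivAt_phase ζ x).cexp.fderiv]
  have : ∑ l, ζ l * (((EuclideanSpace.single k (1 : ℝ) : Eu n) l : ℝ) : ℂ) = ζ k := by
    rw [Finset.sum_eq_single k] <;> simp +contextual
  simp only [_root_.smul_apply, _root_.sum_apply, smul_eq_mul]
  change Complex.exp (phase ζ x) * (Complex.I *
    ∑ l, ζ l * (((EuclideanSpace.single k (1 : ℝ) : Eu n) l : ℝ) : ℂ)) = _
  rw [this]
  ring

theorem FL_pd {f : Eu n → ℂ} (hf : ContDiff ℝ ∞ f) (hc : HasCompactSupport f) (k : Fin n)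
    (ζ : Fin n → ℂ) : FL (pd k f) ζ = -(Complex.I * ζ k) * FL f ζ := by
  have h := integral_mul_pd isOpen_univ (contDiff_exp_phase ζ).contDiffOn hf hc
    (Set.subset_univ _) k
  rw [pd_exp_phase] at h
  rw [FL, FL, neg_mul, ← integral_const_mul]
  simp only [mul_comm (pd k f _), mul_comm (f _)]
  rw [h]
  simp only [mul_assoc]

theorem FL_pdw {f : Eu n → ℂ} (hf : ContDiff ℝ ∞ f) (hc : HasCompactSupport f)
    (I : List (Fin n)) (ζ : Fin n → ℂ) :
    FL (pdw I f) ζ = (I.map fun k => -(Complex.I * ζ k)).prod * FL f ζ := by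
  induction I with
  | nil => simp
  | cons k I ih =>
    rw [pdw_cons, FL_pd (contDiff_pdw hf I) (hasCompactSupport_pdw hc I), ih, List.map_cons,
      List.prod_cons, mul_assoc]

/-- Compact support of `f` gives an integrable bound for the differentiated integrand, uniform for
`z` in the unit disc about `z₀`. The result makes the one-variable inequality available on complex
lines. -/
theorem differentiable_FL_line {f : Eu n → ℂ} (hf : Continuous f) (hc : HasCompactSupport f)
    (ξ θ : Fin n → ℂ) : Differentiable ℂ fun z : ℂ => FL f fun k => ξ k + z * θ k := by
  intro z₀
  have e : ∀ (z : ℂ) (x : Eu n), phase (fun k => ξ k + z * θ k) x = phase ξ x + z * phase θ x := by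
    intro z x
    simp only [phase, mul_add, Finset.sum_add_distrib, Finset.mul_sum]
    congr 1
    exact Finset.sum_congr rfl fun k _ => by ring
  have hcont : ∀ ζ : Fin n → ℂ, Continuous (phase ζ) := fun ζ => (contDiff_phase ζ).continuous
  let bd : Eu n → ℝ := fun x =>
    ‖f x‖ * (Real.exp (‖phase ξ x‖ + (‖z₀‖ + 1) * ‖phase θ x‖) * ‖phase θ x‖)
  have hbd : Integrable bd := by
    refine Continuous.integrable_of_hasCompactSupport ?_ (hc.norm.mul_right)
    have := hcont ξ
    have := hcont θ
    fun_prop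
  have hcz : ∀ z : ℂ, Continuous fun x => f x * Complex.exp (phase ξ x + z * phase θ x) := fun z => by
    have := hcont ξ
    have := hcont θ
    fun_prop
  have key := hasDerivAt_integral_of_dominated_loc_of_deriv_le (𝕜 := ℂ) (μ := volume)
    (F := fun z x => f x * Complex.exp (phase ξ x + z * phase θ x))
    (F' := fun z x => f x * (Complex.exp (phase ξ x + z * phase θ x) * phase θ x))
    (x₀ := z₀) (s := Metric.ball z₀ 1) (bound := bd) (Metric.ball_mem_nhds _ one_pos)
    (.of_forall fun z => (hcz z).aestronglyMeasurable)
    ((hcz z₀).integrable_of_hasCompactSupport hc.mul_right)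
    (by
      have := hcont ξ
      have := hcont θ
      exact Continuous.aestronglyMeasurable (by fun_prop))
    (.of_forall fun x z hz => ?_) hbd (.of_forall fun x z _ => ?_)
  · have h := key.2.differentiableAt
    refine h.congr_of_eventuallyEq (.of_forall fun z => ?_)
    simp only [FL, e]
  · rw [norm_mul, norm_mul]
    refine mul_le_mul_of_nonneg_left (mul_le_mul_of_nonneg_right ?_ (norm_nonneg _)) (norm_nonneg _)
    rw [Complex.norm_exp]
    refine Real.exp_le_exp.2 ((Complex.re_le_norm _).trans ((norm_add_le _ _).trans ?_))
    rw [norm_mul]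
    have hz1 : ‖z‖ ≤ ‖z₀‖ + 1 := by
      have := norm_add_le (z - z₀) z₀
      rw [sub_add_cancel] at this
      rw [mem_ball_iff_norm] at hz
      linarith
    exact add_le_add_right (mul_le_mul_of_nonneg_right hz1 (norm_nonneg _)) _
  · have h1 : HasDerivAt (fun z : ℂ => phase ξ x + z * phase θ x) (phase θ x) z := by
      simpa using ((hasDerivAt_id z).mul_const (phase θ x)).const_add (phase ξ x)
    exact h1.cexp.const_mul (f x)

open FourierTransform in
-- `FL f` at `2πξ` is the inverse Fourier transform of `f` at `ξ`, so this is Fourier inversion for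
-- a Schwartz function, evaluated at the origin.
theorem apply_zero_eq_integral_FL {f : Eu n → ℂ} (hf : ContDiff ℝ ∞ f) (hc : HasCompactSupport f) :
    f 0 = ∫ ξ : Eu n, FL f fun k => ((2 * Real.pi * ξ k : ℝ) : ℂ) := by
  let g : SchwartzMap (Eu n) ℂ := hc.toSchwartzMap hf
  have h : 𝓕 (𝓕⁻ g) = g := FourierTransform.fourier_fourierInv_eq g
  have h0 : (𝓕 (𝓕⁻ g)) 0 = f 0 := by rw [h]; rfl
  rw [← h0, SchwartzMap.fourier_coe, Real.fourier_eq']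
  refine integral_congr_ae (.of_forall fun ξ => ?_)
  simp only [inner_zero_right, mul_zero, Complex.ofReal_zero, zero_mul, Complex.exp_zero, one_smul]
  rw [SchwartzMap.fourierInv_coe, Real.fourierInv_eq', FL]
  refine integral_congr_ae (.of_forall fun x => ?_)
  change Complex.exp _ * f x = _
  rw [mul_comm]
  congr 2
  rw [phase, PiLp.inner_apply, mul_comm]
  congr 1
  push_cast
  rw [Finset.mul_sum]
  refine Finset.sum_congr rfl fun k _ => ?_
  simp
  ring

/-- The weight `1 + ∑_k |ζ_k|`. -/
def weight (ζ : Fin n → ℂ) : ℝ := 1 + ∑ k, ‖ζ k‖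

theorem one_le_weight (ζ : Fin n → ℂ) : 1 ≤ weight ζ :=
  le_add_of_nonneg_right (Finset.sum_nonneg fun _ _ => norm_nonneg _)

/-- Each derivative `∂_k` multiplies the transform by `-iζ_k`, so a factor of the weight is paid for
by one more derivative. -/
theorem weight_pow_mul_norm_FL_le {f : Eu n → ℂ} (hf : ContDiff ℝ ∞ f) (hc : HasCompactSupport f)
    (ζ : Fin n → ℂ) {B : ℝ} (M : ℕ)
    (h : ∀ I : List (Fin n), I.length ≤ M → ‖FL (pdw I f) ζ‖ ≤ B) :
    weight ζ ^ M * ‖FL f ζ‖ ≤ (n + 1) ^ M * B := by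
  induction M generalizing f with
  | zero => simpa using h [] le_rfl
  | succ M ih =>
    have h0 := ih hf hc fun I hI => h I (by omega)
    have hk : ∀ k, weight ζ ^ M * (‖ζ k‖ * ‖FL f ζ‖) ≤ (n + 1) ^ M * B := fun k => by
      have := ih (contDiff_pd hf k) (hasCompactSupport_pdw hc [k]) fun I hI => by
        have := h (I ++ [k]) (by simpa using hI)
        rwa [pdw_append] at this
      rwa [FL_pd hf hc, norm_mul, norm_neg, norm_mul, Complex.norm_I, one_mul] at this
    calc weight ζ ^ (M + 1) * ‖FL f ζ‖
        = weight ζ ^ M * ‖FL f ζ‖ + ∑ k, weight ζ ^ M * (‖ζ k‖ * ‖FL f ζ‖) := by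
          rw [← Finset.mul_sum, ← Finset.sum_mul, pow_succ]
          conv_lhs => rw [mul_assoc, show weight ζ * ‖FL f ζ‖ = ‖FL f ζ‖ + (∑ k, ‖ζ k‖) * ‖FL f ζ‖ by
            rw [weight, add_mul, one_mul]]
          rw [mul_add]
      _ ≤ (n + 1) ^ M * B + ∑ _k : Fin n, (n + 1) ^ M * B :=
          add_le_add h0 (Finset.sum_le_sum fun k _ => hk k)
      _ = (n + 1) ^ (M + 1) * B := by
          rw [Finset.sum_const, Finset.card_univ, Fintype.card_fin, nsmul_eq_mul]
          ring

/-- The real part of the phase is `-∑ x_k Im ζ_k`, which is bounded for `x` in `K` and `ζ` in the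
strip. -/
theorem exists_norm_FL_le {K : Set (Eu n)} (hK : IsCompact K) : ∃ C : ℝ, 0 ≤ C ∧
    ∀ (f : Eu n → ℂ) (B : ℝ), tsupport f ⊆ K → (∀ x ∈ K, ‖f x‖ ≤ B) → ∀ ζ : Fin n → ℂ,
      (∀ k, |(ζ k).im| ≤ 1) → ‖FL f ζ‖ ≤ C * B := by
  obtain ⟨R, hR⟩ := hK.isBounded.exists_norm_le
  refine ⟨Real.exp (n * |R|) * volume.real K, by positivity, fun f B hf hB ζ hζ => ?_⟩
  have h0 : ∀ x ∉ K, f x * Complex.exp (phase ζ x) = 0 := fun x hx => by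
    rw [image_eq_zero_of_notMem_tsupport fun h => hx (hf h), zero_mul]
  rw [FL, ← setIntegral_eq_integral_of_forall_compl_eq_zero h0]
  refine (norm_setIntegral_le_of_norm_le_const hK.measure_lt_top
    (C := B * Real.exp (n * |R|)) fun x hx => ?_).trans (le_of_eq (by ring))
  rw [norm_mul, Complex.norm_exp]
  refine mul_le_mul (hB x hx) (Real.exp_le_exp.2 ?_) (Real.exp_pos _).le
    ((norm_nonneg _).trans (hB x hx))
  have e : (phase ζ x).re = ∑ k, -(x k * (ζ k).im) := by
    simp [phase, Complex.re_sum, Complex.im_sum]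
  rw [e]
  refine (Finset.sum_le_sum (g := fun _ => |R|) fun k _ => ?_).trans (by simp)
  refine (neg_le_abs _).trans ?_
  rw [abs_mul]
  have h1 : |x k| ≤ |R| := ((PiLp.norm_apply_le x k).trans (hR x hx)).trans (le_abs_self R)
  exact (mul_le_of_le_one_right (abs_nonneg _) (hζ k)).trans h1

/-! ### Differential operators -/

/-- The word that lists each variable `k` with multiplicity `α k`. -/
def word (α : Fin n →₀ ℕ) : List (Fin n) :=
  ((List.finRange n).flatMap fun k => List.replicate (α k) k).reverse

theorem prod_map_word {M : Type*} [CommMonoid M] (α : Fin n →₀ ℕ) (f : Fin n → M) :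
    ((word α).map f).prod = ∏ k, f k ^ α k := by
  rw [word, List.map_reverse, List.prod_reverse, Fin.prod_univ_def]
  induction List.finRange n with
  | nil => rfl
  | cons k l ih => simp [List.flatMap_cons, List.map_append, List.prod_append, ih]

/-- The coefficient of `∂^α` in the transpose of `∑ c_α D^α`. -/
def opCoeff (c : (Fin n →₀ ℕ) → ℂ) (α : Fin n →₀ ℕ) : ℂ := c α * Complex.I ^ (word α).length

/-- The transpose `∑_{α ∈ s} c_α (i∂)^α` of the operator `∑_{α ∈ s} c_α D^α`. -/
def dop (s : Finset (Fin n →₀ ℕ)) (c : (Fin n →₀ ℕ) → ℂ) (f : Eu n → ℂ) : Eu n → ℂ :=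
  ∑ α ∈ s, opCoeff c α • pdw (word α) f

theorem dop_apply (s : Finset (Fin n →₀ ℕ)) (c : (Fin n →₀ ℕ) → ℂ) (f : Eu n → ℂ) (x : Eu n) :
    dop s c f x = ∑ α ∈ s, opCoeff c α * pdw (word α) f x := by
  simp [dop, Finset.sum_apply]

theorem tsupport_dop_subset (s : Finset (Fin n →₀ ℕ)) (c : (Fin n →₀ ℕ) → ℂ) (f : Eu n → ℂ) :
    tsupport (dop s c f) ⊆ tsupport f := by
  refine closure_minimal (fun x hx => ?_) (isClosed_tsupport f)
  by_contra h
  refine hx ?_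
  rw [dop_apply]
  refine Finset.sum_eq_zero fun α _ => ?_
  rw [image_eq_zero_of_notMem_tsupport fun h' => h (tsupport_pdw_subset _ _ h'), mul_zero]

/-- The operator `dop` on `C^∞(ℝⁿ)`. -/
def Sm.dop (s : Finset (Fin n →₀ ℕ)) (c : (Fin n →₀ ℕ) → ℂ) : Sm n →ₗ[ℂ] Sm n :=
  ∑ α ∈ s, opCoeff c α • Sm.pdw (word α)

theorem Sm.coe_dop (s : Finset (Fin n →₀ ℕ)) (c : (Fin n →₀ ℕ) → ℂ) (f : Sm n) :
    (Sm.dop s c f).1 = Colombeau.dop s c f.1 := by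
  simp only [Sm.dop, Colombeau.dop, LinearMap.sum_apply, LinearMap.smul_apply, Submodule.coe_sum,
    Submodule.coe_smul]
  rfl

/-- Iterated partial derivatives of test functions. -/
def testPdw (Ω : Opens (Eu n)) (I : List (Fin n)) : 𝓓(Ω, ℂ) →ₗ[ℂ] 𝓓(Ω, ℂ) :=
  I.foldr (fun k A => (testPartial Ω k).toLinearMap ∘ₗ A) LinearMap.id

theorem coe_testPdw (Ω : Opens (Eu n)) (I : List (Fin n)) (f : 𝓓(Ω, ℂ)) :
    (testPdw Ω I f : Eu n → ℂ) = pdw I f := by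
  induction I with
  | nil => rfl
  | cons k I ih =>
    rw [pdw_cons, ← ih]
    exact coe_testPartial k (testPdw Ω I f)

/-- The operator `dop` on test functions. -/
def testOp (Ω : Opens (Eu n)) (s : Finset (Fin n →₀ ℕ)) (c : (Fin n →₀ ℕ) → ℂ) :
    𝓓(Ω, ℂ) →ₗ[ℂ] 𝓓(Ω, ℂ) :=
  ∑ α ∈ s, opCoeff c α • testPdw Ω (word α)

theorem coe_test_sum {ι : Type*} {Ω : Opens (Eu n)} (s : Finset ι) (f : ι → 𝓓(Ω, ℂ)) :
    ((∑ i ∈ s, f i : 𝓓(Ω, ℂ)) : Eu n → ℂ) = ∑ i ∈ s, (f i : Eu n → ℂ) := by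
  classical
  induction s using Finset.induction_on with
  | empty => rfl
  | insert a s ha ih => rw [Finset.sum_insert ha, Finset.sum_insert ha, ← ih]; rfl

theorem coe_testOp (Ω : Opens (Eu n)) (s : Finset (Fin n →₀ ℕ)) (c : (Fin n →₀ ℕ) → ℂ)
    (f : 𝓓(Ω, ℂ)) : (testOp Ω s c f : Eu n → ℂ) = dop s c f := by
  rw [testOp, LinearMap.sum_apply, coe_test_sum, dop]
  refine Finset.sum_congr rfl fun α _ => ?_
  rw [← coe_testPdw]
  rfl

theorem integrable_mul_exp_phase {f : Eu n → ℂ} (hf : Continuous f) (hc : HasCompactSupport f)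
    (ζ : Fin n → ℂ) : Integrable fun x => f x * Complex.exp (phase ζ x) :=
  integrable_mul_of_hasCompactSupport hf hc (contDiff_exp_phase ζ).continuous

theorem FL_dop {f : Eu n → ℂ} (hf : ContDiff ℝ ∞ f) (hc : HasCompactSupport f)
    (s : Finset (Fin n →₀ ℕ)) (c : (Fin n →₀ ℕ) → ℂ) (ζ : Fin n → ℂ) :
    FL (dop s c f) ζ = (symb s c).eval ζ * FL f ζ := by
  have h1 : FL (dop s c f) ζ = ∑ α ∈ s, opCoeff c α * FL (pdw (word α) f) ζ := by
    simp only [FL, dop_apply, Finset.sum_mul, mul_assoc]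
    rw [integral_finsetSum _ fun α _ => (integrable_mul_exp_phase (contDiff_pdw hf _).continuous
      (hasCompactSupport_pdw hc _) ζ).const_mul _]
    simp only [integral_const_mul]
  rw [h1, eval_symb, Finset.sum_mul]
  refine Finset.sum_congr rfl fun α _ => ?_
  rw [FL_pdw hf hc, ← mul_assoc, opCoeff, mul_assoc (c α)]
  congr 2
  rw [← prod_map_word]
  -- Every letter contributes `i · (-iζ_k) = ζ_k`.
  induction word α with
  | nil => simp
  | cons k I ih =>
    rw [List.length_cons, List.map_cons, List.map_cons, List.prod_cons, List.prod_cons, ← ih, pow_succ]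
    linear_combination (-(Complex.I ^ I.length * ζ k *
      (List.map (fun k => -(Complex.I * ζ k)) I).prod)) * Complex.I_mul_I

/-! ### Malgrange's inequality -/

/-- The weight is stable under moves of size one in each coordinate; so on the disc of a complex
line it may be replaced by its value at the centre. -/
theorem weight_le_add {ξ η : Fin n → ℂ} (h : ∀ k, ‖ξ k - η k‖ ≤ 1) :
    weight ξ ≤ (n + 1) * weight η := by
  have h1 : ∑ k, ‖ξ k‖ ≤ ∑ k, (‖η k‖ + 1) := Finset.sum_le_sum fun k _ => by
    have := norm_add_le (ξ k - η k) (η k)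
    rw [sub_add_cancel] at this
    linarith [h k]
  rw [Finset.sum_add_distrib, Finset.sum_const, Finset.card_univ, Fintype.card_fin, nsmul_eq_mul,
    mul_one] at h1
  have h2 := one_le_weight η
  have h3 : (n : ℝ) ≤ n * weight η := le_mul_of_one_le_right (Nat.cast_nonneg _) h2
  have h4 : weight η = 1 + ∑ k, ‖η k‖ := rfl
  have h5 : weight ξ = 1 + ∑ k, ‖ξ k‖ := rfl
  linarith

theorem one_add_norm_le_weight (ξ : Eu n) :
    1 + ‖ξ‖ ≤ weight fun k => ((2 * Real.pi * ξ k : ℝ) : ℂ) := by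
  have h1 : ‖ξ‖ ≤ ∑ k, ‖ξ k‖ := by
    conv_lhs => rw [show ξ = ∑ k, ξ k • EuclideanSpace.single k (1 : ℝ) by
      ext i
      simp [Finset.sum_apply, Pi.single_apply]]
    refine (norm_sum_le _ _).trans (Finset.sum_le_sum fun k _ => ?_)
    simp [norm_smul]
  refine add_le_add_right (h1.trans (Finset.sum_le_sum fun k _ => ?_)) _
  rw [Complex.norm_real, norm_mul]
  refine le_mul_of_one_le_left (norm_nonneg _) ?_
  rw [Real.norm_of_nonneg (by positivity)]
  linarith [Real.pi_gt_three]

/-- Malgrange's inequality on a line through a point of the grid. -/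
theorem norm_eval_symb_mul_norm_FL_le {s : Finset (Fin n →₀ ℕ)} {m : ℕ}
    (hm : (s.sup fun α => α.sum fun _ e => e) ≤ m) (c : (Fin n →₀ ℕ) → ℂ) {f : Eu n → ℂ}
    (hf : ContDiff ℝ ∞ f) (hc : HasCompactSupport f) {Q : ℝ} (hQ0 : 0 ≤ Q) (M : ℕ)
    (hQ : ∀ ζ : Fin n → ℂ, (∀ k, |(ζ k).im| ≤ 1) → weight ζ ^ M * ‖FL (dop s c f) ζ‖ ≤ Q)
    (κ : Fin n → Fin (m + 1)) (ξ : Fin n → ℝ) :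
    ‖(symb s c).eval fun i => ((κ i : ℕ) : ℂ)‖ * ‖FL f fun k => (ξ k : ℂ)‖ ≤
      ((1 + 2 * (m + 1) * (n * m + 2)) * weight fun k => (ξ k : ℂ)) ^ m *
        ((n + 1) ^ M * Q / (weight fun k => (ξ k : ℂ)) ^ M) := by
  set W := weight fun k => (ξ k : ℂ) with hW
  have hW1 : 1 ≤ W := one_le_weight _
  -- The direction `θ = (κ - ξ)/t` has coordinates of modulus at most one. Thus the unit disc `|z| ≤
  -- 1` stays in the strip, while the parameter `z = t` reaches the grid point `κ`. The leading `1`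
  -- keeps `t` positive when `κ = ξ`.
  set t : ℝ := 1 + ∑ k, |(κ k : ℕ) - ξ k| with ht
  have ht1 : 1 ≤ t := le_add_of_nonneg_right (Finset.sum_nonneg fun _ _ => abs_nonneg _)
  have htW : t ≤ (n * m + 1) * W := by
    have h1 : ∑ k, |((κ k : ℕ) : ℝ) - ξ k| ≤ ∑ k : Fin n, ((m : ℝ) + ‖(ξ k : ℂ)‖) := by
      refine Finset.sum_le_sum fun k _ => (abs_sub _ _).trans ?_
      rw [Complex.norm_real, Real.norm_eq_abs, Nat.abs_cast]
      have : ((κ k : ℕ) : ℝ) ≤ m := by exact_mod_cast Nat.lt_succ_iff.1 (κ k).2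
      linarith
    rw [Finset.sum_add_distrib, Finset.sum_const, Finset.card_univ, Fintype.card_fin,
      nsmul_eq_mul] at h1
    have h2 : W = 1 + ∑ k, ‖(ξ k : ℂ)‖ := rfl
    have h3 : (n * m : ℝ) ≤ n * m * W := le_mul_of_one_le_right (by positivity) hW1
    linarith
  let θ : Fin n → ℝ := fun k => ((κ k : ℕ) - ξ k) / t
  have hθ : ∀ k, |θ k| ≤ 1 := fun k => by
    rw [abs_div, abs_of_pos (by linarith : 0 < t), div_le_one (by linarith)]
    have := Finset.single_le_sum (f := fun k => |((κ k : ℕ) : ℝ) - ξ k|)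
      (fun _ _ => abs_nonneg _) (Finset.mem_univ k)
    linarith
  let p : Polynomial ℂ := MvPolynomial.aeval
    (fun k => Polynomial.C (ξ k : ℂ) + Polynomial.C (θ k : ℂ) * Polynomial.X) (symb s c)
  have hp : ∀ z, p.eval z = (symb s c).eval fun k => (ξ k : ℂ) + z * θ k := fun z => by
    have : Polynomial.eval z p = (Polynomial.aeval z) p := by
      rw [Polynomial.coe_aeval_eq_eval]
    rw [this, ← AlgHom.comp_apply, MvPolynomial.comp_aeval, ← MvPolynomial.coe_aeval_eq_eval]
    simp only [map_add, map_mul, Polynomial.aeval_C, Polynomial.aeval_X, Algebra.algebraMap_self,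
      RingHom.id_apply, mul_comm z]
    rfl
  have hdeg : p.natDegree ≤ m := by
    have := MvPolynomial.aeval_natDegree_le (symb s c) ((totalDegree_symb_le s c).trans hm)
      (fun k => Polynomial.C (ξ k : ℂ) + Polynomial.C (θ k : ℂ) * Polynomial.X) (n := 1) (fun k => by
        compute_degree)
    simpa using this
  -- On the unit disc the product of `p` with the transform of `f` is the transform of `dop s c f`,
  -- for which the hypothesis gives a bound. The inequality is evaluated at `w = t`.
  have h := norm_eval_mul_le p hdeg (differentiable_FL_line hf.continuous hc (fun k => (ξ k : ℂ))
    fun k => (θ k : ℂ)) (B := (n + 1) ^ M * Q / W ^ M) (fun z hz => by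
      rw [hp, ← FL_dop hf hc, le_div_iff₀ (by positivity)]
      have him : ∀ k, |((ξ k : ℂ) + z * θ k).im| ≤ 1 := fun k => by
        have : ((ξ k : ℂ) + z * θ k).im = z.im * θ k := by simp
        rw [this, abs_mul]
        exact mul_le_one₀ ((Complex.abs_im_le_norm z).trans hz) (abs_nonneg _) (hθ k)
      have hw : W ≤ (n + 1) * weight fun k => (ξ k : ℂ) + z * θ k := weight_le_add fun k => by
        rw [sub_add_cancel_left, norm_neg, norm_mul, Complex.norm_real]
        exact mul_le_one₀ hz (norm_nonneg _) (hθ k)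
      calc ‖FL (dop s c f) fun k => (ξ k : ℂ) + z * θ k‖ * W ^ M
          ≤ ‖FL (dop s c f) fun k => (ξ k : ℂ) + z * θ k‖ *
            ((n + 1) * weight fun k => (ξ k : ℂ) + z * θ k) ^ M :=
            mul_le_mul_of_nonneg_left (pow_le_pow_left₀ (by linarith) hw M) (norm_nonneg _)
        _ = (n + 1) ^ M * ((weight fun k => (ξ k : ℂ) + z * θ k) ^ M *
            ‖FL (dop s c f) fun k => (ξ k : ℂ) + z * θ k‖) := by
            rw [mul_pow, mul_left_comm, mul_comm ‖_‖]
        _ ≤ (n + 1) ^ M * Q := mul_le_mul_of_nonneg_left (hQ _ him) (by positivity)) (t : ℂ)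
  have hpt : p.eval (t : ℂ) = (symb s c).eval fun i => ((κ i : ℕ) : ℂ) := by
    rw [hp]
    congr 2
    funext k
    have : t * θ k = (κ k : ℕ) - ξ k := mul_div_cancel₀ _ (by linarith)
    rw [← Complex.ofReal_mul, this]
    push_cast
    ring
  rw [hpt] at h
  simp only [zero_mul, add_zero, norm_mul] at h
  refine h.trans (mul_le_mul_of_nonneg_right (pow_le_pow_left₀ (by positivity) ?_ m) (by positivity))
  rw [Complex.norm_real, Real.norm_of_nonneg (by linarith)]
  have h1 : 2 * ((m : ℝ) + 1) * (1 + t) ≤ 2 * (m + 1) * ((n * m + 2) * W) :=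
    mul_le_mul_of_nonneg_left (by linarith) (by positivity)
  calc 1 + 2 * ((m : ℝ) + 1) * (1 + t) ≤ W + 2 * (m + 1) * ((n * m + 2) * W) := by linarith
    _ = _ := by ring

/-- The grid point `κ` depends on `c` only, so `P(κ)` is a constant that can be taken inside the
inversion integral for `f(0)`. The pointwise bound on a line then leaves an integrable function of
`ξ`, and `|P(κ)|` dominates the sum of the coefficients. -/
theorem exists_malgrange_bound (s : Finset (Fin n →₀ ℕ)) : ∃ (M : ℕ) (C : ℝ), 0 < C ∧
    ∀ (c : (Fin n →₀ ℕ) → ℂ) (f : Eu n → ℂ), ContDiff ℝ ∞ f → HasCompactSupport f → ∀ Q : ℝ, 0 ≤ Q →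
      (∀ ζ : Fin n → ℂ, (∀ k, |(ζ k).im| ≤ 1) → weight ζ ^ M * ‖FL (dop s c f) ζ‖ ≤ Q) →
      (∑ α ∈ s, ‖c α‖) * ‖f 0‖ ≤ C * Q := by
  let m : ℕ := s.sup fun α => α.sum fun _ e => e
  obtain ⟨Cg, hCg, hgrid⟩ := exists_grid_bound s m le_rfl
  -- Malgrange's inequality consumes `m` powers of the weight; the other `n + 1` make the bound
  -- integrable over `ℝⁿ`.
  let M := m + (n + 1)
  let D : ℝ := 1 + 2 * (m + 1) * (n * m + 2)
  have hD : 0 < D := by positivity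
  have hint : Integrable fun ξ : Eu n => (1 + ‖ξ‖) ^ (-((n : ℝ) + 1)) := by
    apply integrable_one_add_norm
    simp
  let J : ℝ := ∫ ξ : Eu n, (1 + ‖ξ‖) ^ (-((n : ℝ) + 1))
  have hJ : 0 ≤ J := integral_nonneg fun ξ => by positivity
  -- `J + 1` in place of `J` makes the constant positive.
  refine ⟨M, Cg * (D ^ m * (n + 1) ^ M * (J + 1)), by positivity, fun c f hf hc Q hQ0 hQ => ?_⟩
  obtain ⟨κ, hκ⟩ := hgrid c
  have hpt : ∀ ξ : Eu n, ‖((symb s c).eval fun i => ((κ i : ℕ) : ℂ)) *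
      FL f fun k => ((2 * Real.pi * ξ k : ℝ) : ℂ)‖ ≤
      D ^ m * (n + 1) ^ M * Q * (1 + ‖ξ‖) ^ (-((n : ℝ) + 1)) := by
    intro ξ
    rw [norm_mul]
    refine (norm_eval_symb_mul_norm_FL_le le_rfl c hf hc hQ0 M hQ κ
      (fun k => 2 * Real.pi * ξ k)).trans ?_
    have hW := one_add_norm_le_weight ξ
    set W := weight fun k => ((2 * Real.pi * ξ k : ℝ) : ℂ)
    have hW0 : 0 < W := lt_of_lt_of_le (by positivity) hW
    have e : (D * W) ^ m * ((n + 1) ^ M * Q / W ^ M) = D ^ m * (n + 1) ^ M * Q * (W ^ (n + 1))⁻¹ := by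
      rw [mul_pow, show W ^ M = W ^ m * W ^ (n + 1) from pow_add _ _ _]
      field_simp
    refine (le_of_eq e).trans (mul_le_mul_of_nonneg_left ?_ (by positivity))
    rw [Real.rpow_neg (by positivity), show ((n : ℝ) + 1) = ((n + 1 : ℕ) : ℝ) by push_cast; rfl,
      Real.rpow_natCast]
    exact inv_anti₀ (by positivity) (pow_le_pow_left₀ (by positivity) hW _)
  have h1 : ‖(symb s c).eval fun i => ((κ i : ℕ) : ℂ)‖ * ‖f 0‖ ≤ D ^ m * (n + 1) ^ M * Q * J := by
    rw [← norm_mul, apply_zero_eq_integral_FL hf hc, ← integral_const_mul, ← integral_const_mul]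
    exact norm_integral_le_of_norm_le (hint.const_mul _) (.of_forall hpt)
  calc (∑ α ∈ s, ‖c α‖) * ‖f 0‖
      ≤ Cg * ‖(symb s c).eval fun i => ((κ i : ℕ) : ℂ)‖ * ‖f 0‖ :=
        mul_le_mul_of_nonneg_right hκ (norm_nonneg _)
    _ ≤ Cg * (D ^ m * (n + 1) ^ M * Q * J) := by
        rw [mul_assoc]
        exact mul_le_mul_of_nonneg_left h1 hCg.le
    _ ≤ Cg * (D ^ m * (n + 1) ^ M * Q * (J + 1)) := by gcongr; linarith
    _ = _ := by ring

/-! ### Fundamental solutions with bounds -/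

/-- A linear functional on test functions that is bounded by the seminorms is a distribution. -/
theorem continuous_of_supNorm_bound {Ω : Opens (Eu n)} (L : 𝓓(Ω, ℂ) →ₗ[ℂ] ℂ)
    (hL : ∀ K : Set (Eu n), IsCompact K → K ⊆ Ω → ∃ (j : ℕ) (C : ℝ), 0 ≤ C ∧
      ∀ f : 𝓓(Ω, ℂ), tsupport f ⊆ K → ‖L f‖ ≤ C * supNorm K j f) : Continuous L := by
  rw [TestFunction.continuous_iff_continuous_comp]
  intro K hKΩ
  obtain ⟨j, C, hC, h⟩ := hL K K.isCompact hKΩ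
  refine (ContDiffMapSupportedIn.mkCLMtoNormedSpace (𝕜 := ℂ) (fun f => L (TestFunction.ofSupportedIn hKΩ f))
    (fun f g => map_add L (TestFunction.ofSupportedIn hKΩ f) (TestFunction.ofSupportedIn hKΩ g)) (fun c f => map_smul L c (TestFunction.ofSupportedIn hKΩ f))
    ⟨Finset.range (j + 1), C, hC, fun f => ?_⟩).continuous
  refine (h _ f.tsupport_subset).trans (mul_le_mul_of_nonneg_left ?_ hC)
  refine supNorm_le (apply_nonneg _ _) fun x _ i hi => ?_
  refine (ContDiffMapSupportedIn.norm_iteratedFDeriv_apply_le_seminorm_top ℂ).trans ?_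
  exact Seminorm.le_finset_sup_apply (Finset.mem_range.2 (Nat.lt_succ_of_le hi))

/-- The strip of all `ζ` with `|Im ζ_k| ≤ 1`. -/
abbrev Strip (n : ℕ) : Type := {ζ : Fin n → ℂ // ∀ k, |(ζ k).im| ≤ 1}

/-- This converts the strip seminorm, in which Hahn–Banach is applied, into the seminorms that
define moderateness. -/
theorem exists_weight_FL_bound {K : Set (Eu n)} (hK : IsCompact K) (M : ℕ) : ∃ C : ℝ, 0 ≤ C ∧
    ∀ f : Eu n → ℂ, ContDiff ℝ ∞ f → tsupport f ⊆ K → ∀ ζ : Strip n,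
      weight ζ.1 ^ M * ‖FL f ζ.1‖ ≤ C * supNorm K M f := by
  obtain ⟨C, hC, h⟩ := exists_norm_FL_le hK
  refine ⟨(n + 1) ^ M * C, by positivity, fun f hf hfK ζ => ?_⟩
  have hc : HasCompactSupport f := hK.of_isClosed_subset (isClosed_tsupport f) hfK
  rw [mul_assoc]
  refine weight_pow_mul_norm_FL_le hf hc ζ.1 M fun I hI => ?_
  refine h _ _ ((tsupport_pdw_subset I f).trans hfK) (fun x hx => ?_) ζ.1 ζ.2
  exact norm_pdw_le_supNorm isOpen_univ hf.contDiffOn hK (Set.subset_univ _) hx hI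

theorem FL_add {f g : Eu n → ℂ} (hf : Continuous f) (hfc : HasCompactSupport f) (hg : Continuous g)
    (hgc : HasCompactSupport g) (ζ : Fin n → ℂ) : FL (f + g) ζ = FL f ζ + FL g ζ := by
  rw [FL, FL, FL, ← integral_add (integrable_mul_exp_phase hf hfc ζ)
    (integrable_mul_exp_phase hg hgc ζ)]
  simp only [Pi.add_apply, add_mul]

theorem FL_smul (c : ℂ) (f : Eu n → ℂ) (ζ : Fin n → ℂ) : FL (c • f) ζ = c * FL f ζ := by
  rw [FL, FL, ← integral_const_mul]
  simp only [Pi.smul_apply, smul_eq_mul, mul_assoc]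

theorem bddAbove_weight_FL (M : ℕ) (f : 𝓓((⊤ : Opens (Eu n)), ℂ)) :
    BddAbove (Set.range fun ζ : Strip n => weight ζ.1 ^ M * ‖FL f ζ.1‖) := by
  obtain ⟨C, -, h⟩ := exists_weight_FL_bound (K := tsupport f) f.hasCompactSupport M
  exact ⟨_, by rintro _ ⟨ζ, rfl⟩; exact h f (contDiff_test f) subset_rfl ζ⟩

/-- The seminorm `sup_ζ (1 + |ζ|)^M |f^(ζ)|` over the strip. -/
def stripSeminorm (n M : ℕ) : Seminorm ℂ 𝓓((⊤ : Opens (Eu n)), ℂ) :=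
  Seminorm.of (fun f => ⨆ ζ : Strip n, weight ζ.1 ^ M * ‖FL f ζ.1‖)
    (fun f g => by
      have : Nonempty (Strip n) := ⟨⟨0, by simp⟩⟩
      refine ciSup_le fun ζ => ?_
      have hw : 0 ≤ weight ζ.1 ^ M := pow_nonneg (zero_le_one.trans (one_le_weight _)) M
      refine le_trans ?_ (add_le_add (le_ciSup (bddAbove_weight_FL M f) ζ)
        (le_ciSup (bddAbove_weight_FL M g) ζ))
      rw [FunLike.coe_add, FL_add (contDiff_test f).continuous f.hasCompactSupport
        (contDiff_test g).continuous g.hasCompactSupport, ← mul_add]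
      exact mul_le_mul_of_nonneg_left (norm_add_le _ _) hw)
    (fun c f => by
      rw [Real.mul_iSup_of_nonneg (norm_nonneg c)]
      refine iSup_congr fun ζ => ?_
      rw [FunLike.coe_smul, FL_smul, norm_mul]
      ring)

theorem le_stripSeminorm (M : ℕ) (f : 𝓓((⊤ : Opens (Eu n)), ℂ)) (ζ : Strip n) :
    weight ζ.1 ^ M * ‖FL f ζ.1‖ ≤ stripSeminorm n M f :=
  le_ciSup (bddAbove_weight_FL M f) ζ

/-- Fundamental solutions whose bounds are controlled by the size of the coefficients. -/
theorem exists_fundamental_distribution (s : Finset (Fin n →₀ ℕ)) :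
    ∃ (M : ℕ) (C : Set (Eu n) → ℝ), (∀ K, 0 ≤ C K) ∧ ∀ c : (Fin n →₀ ℕ) → ℂ,
      0 < ∑ α ∈ s, ‖c α‖ → ∃ E : 𝓓((⊤ : Opens (Eu n)), ℂ) →L[ℂ] ℂ,
        (∀ f, E (testOp ⊤ s c f) = f 0) ∧ ∀ K, IsCompact K → ∀ f : 𝓓((⊤ : Opens (Eu n)), ℂ),
          tsupport f ⊆ K → ‖E f‖ ≤ (∑ α ∈ s, ‖c α‖)⁻¹ * C K * supNorm K M f := by
  obtain ⟨M, C₀, hC₀, hM⟩ := exists_malgrange_bound s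
  have hK : ∀ K : Set (Eu n), ∃ C : ℝ, 0 ≤ C ∧ (IsCompact K → ∀ f : 𝓓((⊤ : Opens (Eu n)), ℂ),
      tsupport f ⊆ K → stripSeminorm n M f ≤ C * supNorm K M f) := by
    intro K
    by_cases hK : IsCompact K
    · obtain ⟨C, hC, h⟩ := exists_weight_FL_bound hK M
      have : Nonempty (Strip n) := ⟨⟨0, by simp⟩⟩
      exact ⟨C, hC, fun _ f hf => ciSup_le fun ζ => h f (contDiff_test f) hf ζ⟩
    · exact ⟨0, le_rfl, fun h => absurd h hK⟩
  choose C hC0 hC using hK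
  refine ⟨M, fun K => C₀ * C K, fun K => mul_nonneg hC₀.le (hC0 K), fun c hc => ?_⟩
  set σ := ∑ α ∈ s, ‖c α‖ with hσ
  let ev : 𝓓((⊤ : Opens (Eu n)), ℂ) →ₗ[ℂ] ℂ :=
    { toFun := fun f => f 0, map_add' := fun _ _ => rfl, map_smul' := fun _ _ => rfl }
  have hσC : 0 ≤ σ⁻¹ * C₀ := by positivity
  -- By Malgrange's inequality, evaluation at `0` is dominated by a seminorm of `ᵗP f`. It therefore
  -- factors through `ᵗP`, and the extension keeps the same bound on all test functions.
  obtain ⟨L, hL, hL'⟩ := exists_dual_comp_eq (testOp ⊤ s c) ev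
    (Real.toNNReal (σ⁻¹ * C₀) • stripSeminorm n M) (fun f => by
      change ‖f 0‖ ≤ ((σ⁻¹ * C₀).toNNReal : ℝ) * stripSeminorm n M (testOp ⊤ s c f)
      rw [Real.coe_toNNReal _ hσC, mul_assoc, ← div_eq_inv_mul, le_div_iff₀ hc, mul_comm]
      refine hM c f (contDiff_test f) f.hasCompactSupport _ (apply_nonneg _ _) fun ζ hζ => ?_
      rw [← coe_testOp ⊤]
      exact le_stripSeminorm M (testOp ⊤ s c f) ⟨ζ, hζ⟩)
  have hb : ∀ K, IsCompact K → ∀ f : 𝓓((⊤ : Opens (Eu n)), ℂ),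
      tsupport f ⊆ K → ‖L f‖ ≤ σ⁻¹ * (C₀ * C K) * supNorm K M f := by
    intro K hK f hf
    refine (hL' f).trans ?_
    change ((σ⁻¹ * C₀).toNNReal : ℝ) * stripSeminorm n M f ≤ _
    rw [Real.coe_toNNReal _ hσC, ← mul_assoc, mul_assoc (σ⁻¹ * C₀)]
    exact mul_le_mul_of_nonneg_left (hC K hK f hf) hσC
  refine ⟨⟨L, continuous_of_supNorm_bound L fun K hK _ => ⟨M, _, ?_, hb K hK⟩⟩, hL, hb⟩
  have := hC0 K
  positivity

/-! ### Lower bounds for the coefficients -/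

/-- The coefficients of a representative of `P`. -/
def cf (P : MvPolynomial (Fin n) GenC) (ε : Idx) (α : Fin n →₀ ℕ) : ℂ := (P.coeff α).rep.1 ε

theorem isModerate_cf (P : MvPolynomial (Fin n) GenC) (α : Fin n →₀ ℕ) :
    IsModerate fun ε => cf P ε α := (P.coeff α).rep.2

/-- The ideal of all generalized numbers that are dominated by a net of scalars. -/
def dominatedIdeal (σ : Idx → ℝ) : Ideal GenC where
  carrier := {z | ∃ (r : Idx → ℂ) (M : Idx → ℝ), Represents r z ∧ IsModerate M ∧
    ∀ ε, ‖r ε‖ ≤ |M ε| * |σ ε|}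
  zero_mem' := ⟨fun _ => 0, fun _ => 0, represents_zero, isModerate_const 0, by simp⟩
  add_mem' := by
    rintro z w ⟨r, M, hr, hM, h⟩ ⟨r', M', hr', hM', h'⟩
    refine ⟨_, fun ε => |M ε| + |M' ε|, hr.add hr', IsModerate.add (hM.of_le fun ε => by simp)
      (hM'.of_le fun ε => by simp), fun ε => (norm_add_le _ _).trans ?_⟩
    rw [abs_of_nonneg (by positivity), add_mul]
    exact add_le_add (h ε) (h' ε)
  smul_mem' := by
    rintro a z ⟨r, M, hr, hM, h⟩
    refine ⟨_, fun ε => ‖a.rep.1 ε‖ * M ε, a.represents_rep.mul hr,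
      IsModerate.mul (IsModerate.of_le (v := a.rep.1) a.rep.2 fun ε => by simp) hM, fun ε => ?_⟩
    rw [norm_mul, abs_mul, abs_norm, mul_assoc]
    exact mul_le_mul_of_nonneg_left (h ε) (norm_nonneg _)

/-- Modulo `J` the polynomial `P` is zero, and formal derivatives and evaluation commute with
reduction modulo `J`. -/
theorem polyDeriv_eval_mem {P : MvPolynomial (Fin n) GenC} {J : Ideal GenC}
    (hP : ∀ α ∈ P.support, P.coeff α ∈ J) (α : Fin n →₀ ℕ) (x : Fin n → GenC) :
    (polyDeriv P α).eval x ∈ J := by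
  let φ := MvPolynomial.map (σ := Fin n) (Ideal.Quotient.mk J)
  have h0 : φ P = 0 := by
    ext β
    rw [MvPolynomial.coeff_map, MvPolynomial.coeff_zero, Ideal.Quotient.eq_zero_iff_mem]
    by_cases hβ : β ∈ P.support
    · exact hP β hβ
    · rw [MvPolynomial.notMem_support_iff.1 hβ]
      exact J.zero_mem
  have hpow : ∀ (k : Fin n) (m : ℕ) (Q : MvPolynomial (Fin n) GenC), φ Q = 0 →
      φ ((((MvPolynomial.pderiv k).toLinearMap :
        Module.End GenC (MvPolynomial (Fin n) GenC)) ^ m) Q) = 0 := by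
    intro k m
    induction m with
    | zero => exact fun Q hQ => hQ
    | succ m ih =>
      intro Q hQ
      rw [pow_succ, Module.End.mul_apply]
      refine ih _ ?_
      change φ (MvPolynomial.pderiv k Q) = 0
      rw [← MvPolynomial.pderiv_map, hQ, map_zero]
  have h1 : φ (polyDeriv P α) = 0 := by
    rw [polyDeriv]
    induction List.finRange n with
    | nil => exact h0
    | cons k l ih =>
      rw [List.map_cons, List.prod_cons, Module.End.mul_apply]
      exact hpow k _ _ ih
  rw [← Ideal.Quotient.eq_zero_iff_mem, ← MvPolynomial.eval₂_id, MvPolynomial.hom_eval₂, RingHom.comp_id,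
    ← MvPolynomial.eval_map]
  change MvPolynomial.eval _ (φ (polyDeriv P α)) = 0
  rw [h1, map_zero]

/-- If `P̃(ξ)` is invertible, then the coefficients of `P` are not too small. -/
theorem exists_pow_le_sum_cf {P : MvPolynomial (Fin n) GenC} {ξ : Eu n}
    (h : IsUnit (tildeFn P ξ)) :
    ∃ N : ℕ, ∀ᶠ ε : Idx in atZero, (ε : ℝ) ^ N ≤ ∑ α ∈ P.support, ‖cf P ε α‖ := by
  set σ : Idx → ℝ := fun ε => ∑ α ∈ P.support, ‖cf P ε α‖ with hσ
  have hσ0 : ∀ ε, 0 ≤ σ ε := fun ε => Finset.sum_nonneg fun _ _ => norm_nonneg _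
  -- Each coefficient is dominated by `σ` with factor `1`, so all derivatives of `P` at `ξ` have
  -- representatives dominated by moderate multiples of `σ`.
  have hmem := fun α : Fin n →₀ ℕ => polyDeriv_eval_mem (P := P) (J := dominatedIdeal σ)
    (fun β hβ => ⟨fun ε => cf P ε β, fun _ => 1, (P.coeff β).represents_rep, isModerate_const 1,
      fun ε => by
        rw [abs_one, one_mul, abs_of_nonneg (hσ0 ε)]
        exact Finset.single_le_sum (f := fun α => ‖cf P ε α‖) (fun _ _ => norm_nonneg _) hβ⟩)
    α (fun j => GenNum.const (ξ j : ℂ))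
  choose r M hr hM hrM using hmem
  obtain ⟨y, hy⟩ := h.exists_right_inv
  let R : Idx → ℝ := fun ε => √(∑ k ∈ Finset.range (P.totalDegree + 1),
    ∑ α ∈ Finset.univ.finsuppAntidiag k, ‖r α ε‖ ^ 2)
  have hR : Represents R (tildeFn P ξ) := by
    refine Represents.sqrt (Represents.sum _ fun k _ => Represents.sum _ fun α _ => ?_)
    simp only [sq]
    exact (hr α).abs.mul (hr α).abs
  let B : Idx → ℝ := fun ε => √(∑ k ∈ Finset.range (P.totalDegree + 1),
    ∑ α ∈ Finset.univ.finsuppAntidiag k, |M α ε| ^ 2)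
  have hRB : ∀ ε, R ε ≤ B ε * σ ε := fun ε => by
    rw [← Real.sqrt_sq (hσ0 ε), ← Real.sqrt_mul' _ (sq_nonneg _)]
    refine Real.sqrt_le_sqrt ?_
    rw [Finset.sum_mul]
    refine Finset.sum_le_sum fun k _ => ?_
    rw [Finset.sum_mul]
    refine Finset.sum_le_sum fun α _ => ?_
    rw [← mul_pow]
    refine pow_le_pow_left₀ (norm_nonneg _) ?_ 2
    have := hrM α ε
    rwa [abs_of_nonneg (hσ0 ε)] at this
  have hB : IsModerate B := by
    have h1 : IsModerate fun ε => ∑ k ∈ Finset.range (P.totalDegree + 1),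
        ∑ α ∈ Finset.univ.finsuppAntidiag k, |M α ε| ^ 2 := by
      refine IsModerate.sum _ fun k _ => IsModerate.sum _ fun α _ => ?_
      simp only [sq_abs]
      simp only [sq]
      exact (hM α).mul (hM α)
    exact (Represents.sqrt (represents_mk ⟨_, h1⟩)).isModerate
  have hRy := (hR.mul y.represents_rep).isNegligible_sub (hy ▸ represents_one)
  obtain ⟨N, hN⟩ := (hB.mul (IsModerate.of_le (u := fun ε => |y.rep.1 ε|) y.rep.2
    fun ε => by simp)).eventually_le
  obtain ⟨C, hC⟩ := (hRy 1).bound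
  refine ⟨N + 1, ?_⟩
  have hsmall : ∀ᶠ ε : Idx in atZero, (ε : ℝ) ≤ (2 * (|C| + 1))⁻¹ :=
    eventually_le_atZero ⟨(2 * (|C| + 1))⁻¹, by positivity,
      inv_le_one_of_one_le₀ (by linarith [abs_nonneg C])⟩
  filter_upwards [hN, hC, hsmall] with ε h1 h2 h3
  have hε := ε.2.1
  have hε1 : (ε : ℝ) ≤ 1 := ε.2.2
  rw [pow_one, Real.norm_eq_abs, Real.norm_of_nonneg hε.le] at h2
  have hCε : (|C| + 1) * ε ≤ 1 / 2 := by
    have := mul_le_mul_of_nonneg_left h3 (show 0 ≤ |C| + 1 by positivity)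
    refine this.trans (le_of_eq ?_)
    field_simp
  have hεhalf : (ε : ℝ) ≤ 1 / 2 := by nlinarith [abs_nonneg C]
  -- The product of a representative of `P̃(ξ)` with one of its inverse differs from `1` by a
  -- negligible net, so it is at least `1/2` for small `ε`.
  have h4 : 1 / 2 ≤ R ε * |y.rep.1 ε| := by
    have e1 : R ε * y.rep.1 ε ≤ R ε * |y.rep.1 ε| :=
      mul_le_mul_of_nonneg_left (le_abs_self _) (Real.sqrt_nonneg _)
    have e2 := (abs_le.1 h2).1
    have e3 : C * ε ≤ |C| * ε := mul_le_mul_of_nonneg_right (le_abs_self C) hε.le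
    nlinarith
  have h5 : R ε * |y.rep.1 ε| ≤ ((ε : ℝ)⁻¹) ^ N * σ ε := by
    calc R ε * |y.rep.1 ε| ≤ B ε * σ ε * |y.rep.1 ε| :=
          mul_le_mul_of_nonneg_right (hRB ε) (abs_nonneg _)
      _ = (B ε * |y.rep.1 ε|) * σ ε := by ring
      _ ≤ _ := mul_le_mul_of_nonneg_right ((le_abs_self _).trans h1) (hσ0 ε)
  -- The bound `1/2` is weakened to `ε`, which accounts for the exponent `N + 1`.
  have h6 : (ε : ℝ) ≤ ((ε : ℝ)⁻¹) ^ N * σ ε := hεhalf.trans (h4.trans h5)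
  calc (ε : ℝ) ^ (N + 1) = (ε : ℝ) ^ N * ε := pow_succ _ _
    _ ≤ (ε : ℝ) ^ N * (((ε : ℝ)⁻¹) ^ N * σ ε) := mul_le_mul_of_nonneg_left h6 (by positivity)
    _ = σ ε := by rw [← mul_assoc, ← mul_pow, mul_inv_cancel₀ hε.ne', one_pow, one_mul]

/-! ### `P(D)` on the level of nets -/

section OpNet

variable {Ω V : Opens (Eu n)}

/-- Iterated partial derivatives on `𝓔_{c,M}(Ω)`. -/
def EcM.pdw (Ω : Opens (Eu n)) (I : List (Fin n)) (u : EcM Ω) : EcM Ω :=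
  I.foldr (fun k v => EcM.partial Ω k v) u

theorem EcM.coe_pdw (I : List (Fin n)) (u : EcM Ω) (ε : Idx) :
    (EcM.pdw Ω I u).1 ε = testPdw Ω I (u.1 ε) := by
  induction I with
  | nil => rfl
  | cons k I ih =>
    change testPartial Ω k ((EcM.pdw Ω I u).1 ε) = testPartial Ω k (testPdw Ω I (u.1 ε))
    rw [ih]

theorem isModerate_opCoeff_cf (P : MvPolynomial (Fin n) GenC) (α : Fin n →₀ ℕ) :
    IsModerate fun ε => opCoeff (cf P ε) α :=
  (isModerate_cf P α).mul (isModerate_const _)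

/-- The transpose of `P(D)` on `𝓔_{c,M}(Ω)`. -/
def opNet (P : MvPolynomial (Fin n) GenC) (u : EcM Ω) : EcM Ω :=
  ∑ α ∈ P.support, (⟨_, isModerate_opCoeff_cf P α⟩ : moderateNets ℂ) • EcM.pdw Ω (word α) u

theorem coe_opNet (P : MvPolynomial (Fin n) GenC) (u : EcM Ω) (ε : Idx) :
    (opNet P u).1 ε = testOp Ω P.support (cf P ε) (u.1 ε) := by
  rw [opNet, Submodule.coe_sum, Finset.sum_apply, testOp, LinearMap.sum_apply]
  refine Finset.sum_congr rfl fun α _ => ?_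
  change opCoeff (cf P ε) α • (EcM.pdw Ω (word α) u).1 ε = _
  rw [EcM.coe_pdw]
  rfl

theorem GenNum.const_mul (a b : ℂ) : (GenNum.const (a * b) : GenC) = GenNum.const a * GenNum.const b :=
  rfl

theorem dualD_mk (k : Fin n) (T : Functional Ω) (u : EcM Ω) :
    dualD Ω k T (Gc.mk u) = GenNum.const Complex.I * T (Gc.mk (EcM.partial Ω k u)) := by
  change (GenNum.const (-Complex.I) : GenC) * -(T (Gc.mk (EcM.partial Ω k u))) = _
  rw [mul_neg, ← neg_mul]
  congr 1
  rw [GenNum.const, ← map_neg]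
  congr 1
  exact Subtype.ext (funext fun _ => neg_neg _)

/-- Moving the factors onto the argument reverses their order. As `word` lists its letters in
reverse, no commutation of derivatives is needed. The factor `i` per letter is `(-i)(-1)`. -/
theorem dualD_list_mk (L : List (Fin n)) (T : Functional Ω) (u : EcM Ω) :
    (L.map (dualD Ω)).prod T (Gc.mk u) =
      GenNum.const (Complex.I ^ L.length) * T (Gc.mk (EcM.pdw Ω L.reverse u)) := by
  induction L generalizing u with
  | nil =>
    have : (GenNum.const (Complex.I ^ 0) : GenC) = 1 := by
      rw [pow_zero]
      rfl
    rw [List.length_nil, this, one_mul]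
    rfl
  | cons k L ih =>
    rw [List.map_cons, List.prod_cons, Module.End.mul_apply, dualD_mk, ih, ← mul_assoc,
      ← GenNum.const_mul, ← pow_succ', List.length_cons]
    congr 3
    rw [EcM.pdw, EcM.pdw, List.reverse_cons, List.foldr_append]
    rfl

theorem dualDPow_mk (α : Fin n →₀ ℕ) (T : Functional Ω) (u : EcM Ω) :
    dualDPow Ω α T (Gc.mk u) =
      GenNum.const (Complex.I ^ (word α).length) * T (Gc.mk (EcM.pdw Ω (word α) u)) := by
  have h : dualDPow Ω α =
      (((List.finRange n).flatMap fun k => List.replicate (α k) k).map (dualD Ω)).prod := by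
    rw [dualDPow]
    induction List.finRange n with
    | nil => rfl
    | cons k l ih =>
      rw [List.map_cons, List.prod_cons, ih, List.flatMap_cons, List.map_append, List.prod_append,
        List.map_replicate, List.prod_replicate]
  rw [h, dualD_list_mk, word, List.length_reverse]

theorem applyOp_mk (P : MvPolynomial (Fin n) GenC) (T : Functional Ω) (u : EcM Ω) :
    applyOp P T (Gc.mk u) = T (Gc.mk (opNet P u)) := by
  rw [applyOp, opNet, Gc.mk_sum, map_sum, LinearMap.sum_apply]
  refine Finset.sum_congr rfl fun α _ => ?_
  rw [Gc.mk_smul, map_smul, LinearMap.smul_apply, dualDPow_mk, smul_eq_mul, smul_eq_mul, ← mul_assoc]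
  congr 1
  conv_lhs => rw [← (P.coeff α).mk_rep]
  rw [GenNum.const, ← map_mul]
  rfl

theorem extend_opNet (h : V ≤ Ω) (P : MvPolynomial (Fin n) GenC) (u : EcM V) :
    EcM.extend h (opNet P u) = opNet P (EcM.extend h u) := by
  refine Subtype.ext (funext fun ε => ?_)
  rw [coe_opNet]
  change testExtend h ((opNet P u).1 ε) = testOp Ω P.support (cf P ε) (testExtend h (u.1 ε))
  rw [coe_opNet]
  refine DFunLike.coe_injective ?_
  rw [coe_testOp]
  exact coe_testOp V _ _ _

theorem restrict_mk (h : V ≤ Ω) (T : Functional Ω) (u : EcM V) :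
    T.restrict h (Gc.mk u) = T (Gc.mk (EcM.extend h u)) := rfl

theorem restrict_applyOp (h : V ≤ Ω) (P : MvPolynomial (Fin n) GenC) (T : Functional Ω) :
    (applyOp P T).restrict h = applyOp P (T.restrict h) := by
  ext x
  obtain ⟨u, rfl⟩ := Gc.mk_surjective x
  rw [restrict_mk, applyOp_mk, applyOp_mk, restrict_mk, extend_opNet]

end OpNet

/-! ### Existence of a basic fundamental solution -/

/-- The distributions at each `ε` have order bounds proportional to the inverse of the sum of the
coefficients, with the order and the remaining constants independent of `ε`. The lower bound `ε^N`
on that sum turns them into a moderate net. -/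
theorem exists_basic_fundamentalSolution {P : MvPolynomial (Fin n) GenC}
    (hP : ∃ ξ : Eu n, IsUnit (tildeFn P ξ)) :
    ∃ E : Functional (⊤ : Opens (Eu n)), IsBasic E ∧ IsFundamentalSolution P E := by
  obtain ⟨ξ, hξ⟩ := hP
  obtain ⟨N, hN⟩ := exists_pow_le_sum_cf hξ
  obtain ⟨η, hη⟩ := exists_of_eventually_atZero hN
  obtain ⟨M, C, hC0, hE⟩ := exists_fundamental_distribution (n := n) P.support
  have hpos : ∀ ε ≤ η, 0 < ∑ α ∈ P.support, ‖cf P ε α‖ := fun ε hε =>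
    lt_of_lt_of_le (pow_pos ε.2.1 N) (hη ε hε)
  have hS : ∀ ε : Idx, ∃ E : 𝓓((⊤ : Opens (Eu n)), ℂ) →L[ℂ] ℂ, ε ≤ η →
      (∀ f, E (testOp ⊤ P.support (cf P ε) f) = f 0) ∧
      ∀ K, IsCompact K → ∀ f : 𝓓((⊤ : Opens (Eu n)), ℂ), tsupport f ⊆ K →
        ‖E f‖ ≤ (∑ α ∈ P.support, ‖cf P ε α‖)⁻¹ * C K * supNorm K M f := by
    intro ε
    by_cases hε : ε ≤ η
    · obtain ⟨E, h⟩ := hE (cf P ε) (hpos ε hε)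
      exact ⟨E, fun _ => h⟩
    -- For `ε > η` the coefficients may vanish; the value there does not affect classes.
    · exact ⟨0, fun h => absurd h hε⟩
  choose S hS using hS
  have hmod : IsModerateDistNet S := by
    intro K hK _
    refine ⟨M, N, C K + 1, η, by linarith [hC0 K], fun f hf ε hε => ?_⟩
    refine ((hS ε hε).2 K hK f hf).trans (mul_le_mul_of_nonneg_right ?_ (supNorm_nonneg _))
    rw [mul_comm]
    refine mul_le_mul (by linarith) ?_ (inv_nonneg.2 (hpos ε hε).le) (by linarith [hC0 K])
    rw [inv_pow]
    exact inv_anti₀ (pow_pos ε.2.1 N) (hη ε hε)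
  refine ⟨Functional.ofNet S hmod, isBasic_ofNet hmod, ?_⟩
  rw [IsFundamentalSolution]
  ext x
  obtain ⟨u, rfl⟩ := Gc.mk_surjective x
  rw [applyOp_mk]
  refine ((Functional.represents_ofNet hmod (opNet P u)).congr' ?_).unique (represents_delta u)
  filter_upwards [eventually_le_atZero η] with ε hε
  rw [coe_opNet, (hS ε hε).1]

/-! ### Moderate and regular nets on an equal footing -/

/-- The moderate nets (`b = false`) or the regular nets (`b = true`) of smooth functions on `Ω`. -/
def RB (b : Bool) (Ω : Opens (Eu n)) : Set (Idx → Eu n → ℂ) :=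
  {u | (∀ ε, ContDiffOn ℝ ∞ (u ε) Ω) ∧ ∀ K : Set (Eu n), IsCompact K → K ⊆ Ω →
    ∃ N : ℕ → ℕ, (b = true → ∀ j, N j = N 0) ∧
      ∀ j : ℕ, (fun ε => supNorm K j (u ε)) =O[atZero] fun ε => ((ε : ℝ)⁻¹) ^ N j}

theorem EM_eq_RB : (EM : Opens (Eu n) → Set (Idx → Eu n → ℂ)) = RB false := by
  funext Ω
  ext u
  refine and_congr_right fun _ => forall_congr' fun K => forall_congr' fun _ => forall_congr' fun _ => ?_
  simp only [Bool.false_eq_true, false_implies, true_and]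
  exact Classical.skolem

theorem EMinf_eq_RB : (EMinf : Opens (Eu n) → Set (Idx → Eu n → ℂ)) = RB true := by
  funext Ω
  ext u
  refine and_congr_right fun _ => forall_congr' fun K => forall_congr' fun _ => forall_congr' fun _ => ?_
  constructor
  · rintro ⟨N, hN⟩
    exact ⟨fun _ => N, fun _ _ => rfl, hN⟩
  · rintro ⟨N, hN, h⟩
    refine ⟨N 0, fun j => ?_⟩
    rw [← hN rfl j]
    exact h j

/-! ### Closure properties of the classes of nets -/

section Closure

variable {b : Bool} {Ω Ω' : Opens (Eu n)} {u v : Idx → Eu n → ℂ}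

/-- A net whose seminorms are bounded by those of a net in `RB b Ω`, with a fixed loss of
derivatives and powers of `ε` on each compact set, belongs to the same class. -/
theorem RB.of_supNorm_le (hu : u ∈ RB b Ω) (hv : ∀ ε, ContDiffOn ℝ ∞ (v ε) Ω')
    (h : ∀ K : Set (Eu n), IsCompact K → K ⊆ Ω' → ∃ L : Set (Eu n), IsCompact L ∧ L ⊆ Ω ∧
      ∃ a M : ℕ, ∀ j, ∃ C : ℝ, ∀ᶠ ε : Idx in atZero,
        supNorm K j (v ε) ≤ C * (((ε : ℝ)⁻¹) ^ M * supNorm L (j + a) (u ε))) : v ∈ RB b Ω' := by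
  refine ⟨hv, fun K hK hKΩ => ?_⟩
  obtain ⟨L, hL, hLΩ, a, M, h⟩ := h K hK hKΩ
  obtain ⟨N, hN, hO⟩ := hu.2 L hL hLΩ
  -- The shift `a` and the power `M` do not depend on `j`, so the new exponents are constant in `j`
  -- whenever the old ones are.
  refine ⟨fun j => M + N (j + a), fun hb j => by simp only [hN hb (j + a), hN hb (0 + a)], fun j => ?_⟩
  obtain ⟨C, hC⟩ := h j
  have h1 : (fun ε => supNorm K j (v ε)) =O[atZero]
      fun ε : Idx => ((ε : ℝ)⁻¹) ^ M * supNorm L (j + a) (u ε) := by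
    refine IsBigO.of_bound C (hC.mono fun ε hε => ?_)
    rwa [Real.norm_of_nonneg (supNorm_nonneg _),
      Real.norm_of_nonneg (mul_nonneg (inv_coe_pow_pos ε M).le (supNorm_nonneg _))]
  simpa only [pow_add] using h1.trans ((isBigO_refl _ _).mul (hO (j + a)))

theorem RB.mono (hu : u ∈ RB b Ω) (h : Ω' ≤ Ω) : u ∈ RB b Ω' :=
  ⟨fun ε => (hu.1 ε).mono h, fun K hK hKΩ => hu.2 K hK (hKΩ.trans h)⟩

theorem RB.zero : (fun _ _ => (0 : ℂ)) ∈ RB b Ω := by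
  refine ⟨fun _ => contDiffOn_const, fun K _ _ => ⟨fun _ => 0, fun _ _ => rfl, fun j => ?_⟩⟩
  have : supNorm K j (fun _ => (0 : ℂ)) = 0 := supNorm_zero (Ω := (⊤ : Opens (Eu n)))
  simp only [this]
  exact isBigO_zero _ _

theorem supNorm_add_le_of_contDiffOn {U K : Set (Eu n)} {f g : Eu n → ℂ} (hU : IsOpen U)
    (hf : ContDiffOn ℝ ∞ f U) (hg : ContDiffOn ℝ ∞ g U) (hK : IsCompact K) (hKU : K ⊆ U) (j : ℕ) :
    supNorm K j (fun x => f x + g x) ≤ supNorm K j f + supNorm K j g := by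
  refine supNorm_le (add_nonneg (supNorm_nonneg _) (supNorm_nonneg _)) fun x hx i hi => ?_
  have e := iteratedFDeriv_add_apply (𝕜 := ℝ) (i := i) (x := x) (f := f) (g := g)
    ((contDiffAt_of_isOpen hU hf (hKU hx)).of_le (mod_cast le_top))
    ((contDiffAt_of_isOpen hU hg (hKU hx)).of_le (mod_cast le_top))
  rw [show (fun x => f x + g x) = f + g from rfl, e]
  exact (norm_add_le _ _).trans (add_le_add (le_supNorm_of_contDiffOn hU hf hK hKU hx hi)
    (le_supNorm_of_contDiffOn hU hg hK hKU hx hi))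

theorem RB.add (hu : u ∈ RB b Ω) (hv : v ∈ RB b Ω) : (fun ε x => u ε x + v ε x) ∈ RB b Ω := by
  refine ⟨fun ε => (hu.1 ε).add (hv.1 ε), fun K hK hKΩ => ?_⟩
  obtain ⟨N, hN, hO⟩ := hu.2 K hK hKΩ
  obtain ⟨N', hN', hO'⟩ := hv.2 K hK hKΩ
  refine ⟨fun j => max (N j) (N' j), fun hb j => by simp only [hN hb j, hN' hb j], fun j => ?_⟩
  have h1 := ((hO j).trans (isBigO_inv_pow (le_max_left _ (N' j)))).add
    ((hO' j).trans (isBigO_inv_pow (le_max_right (N j) _)))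
  refine IsBigO.trans (IsBigO.of_bound 1 (Eventually.of_forall fun ε => ?_)) h1
  rw [one_mul, Real.norm_of_nonneg (supNorm_nonneg _),
    Real.norm_of_nonneg (add_nonneg (supNorm_nonneg _) (supNorm_nonneg _))]
  exact supNorm_add_le_of_contDiffOn Ω.isOpen (hu.1 ε) (hv.1 ε) hK hKΩ j

theorem RB.sum {ι : Type*} (s : Finset ι) {u : ι → Idx → Eu n → ℂ} (h : ∀ i ∈ s, u i ∈ RB b Ω) :
    (fun ε x => ∑ i ∈ s, u i ε x) ∈ RB b Ω := by
  classical
  induction s using Finset.induction_on with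
  | empty => simpa using RB.zero
  | insert a s ha ih =>
    simp only [Finset.sum_insert ha]
    exact RB.add (h a (by simp)) (ih fun i hi => h i (by simp [hi]))

theorem supNorm_const_mul_le {U K : Set (Eu n)} {f : Eu n → ℂ} (hU : IsOpen U)
    (hf : ContDiffOn ℝ ∞ f U) (hK : IsCompact K) (hKU : K ⊆ U) (j : ℕ) (c : ℂ) :
    supNorm K j (fun x => c * f x) ≤ ‖c‖ * supNorm K j f := by
  refine supNorm_le (mul_nonneg (norm_nonneg _) (supNorm_nonneg _)) fun x hx i hi => ?_
  have e := iteratedFDeriv_const_smul_apply (𝕜 := ℝ) (i := i) (x := x) (f := f) (a := c)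
    ((contDiffAt_of_isOpen hU hf (hKU hx)).of_le (mod_cast le_top))
  rw [show (fun x => c * f x) = c • f from rfl, e, norm_smul]
  exact mul_le_mul_of_nonneg_left (le_supNorm_of_contDiffOn hU hf hK hKU hx hi) (norm_nonneg _)

theorem RB.const_mul (hu : u ∈ RB b Ω) {c : Idx → ℂ} (hc : IsModerate c) :
    (fun ε x => c ε * u ε x) ∈ RB b Ω := by
  obtain ⟨M, hM⟩ := hc.eventually_le
  refine RB.of_supNorm_le hu (fun ε => contDiffOn_const.mul (hu.1 ε)) fun K hK hKΩ =>
    ⟨K, hK, hKΩ, 0, M, fun j => ⟨1, hM.mono fun ε hε => ?_⟩⟩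
  rw [one_mul, add_zero]
  exact (supNorm_const_mul_le Ω.isOpen (hu.1 ε) hK hKΩ j _).trans
    (mul_le_mul_of_nonneg_right hε (supNorm_nonneg _))

theorem RB.sub (hu : u ∈ RB b Ω) (hv : v ∈ RB b Ω) : (fun ε x => u ε x - v ε x) ∈ RB b Ω := by
  have := RB.add hu (RB.const_mul hv (isModerate_const (-1)))
  simpa only [neg_one_mul, ← sub_eq_add_neg] using this

theorem RB.pdw (hu : u ∈ RB b Ω) (I : List (Fin n)) : (fun ε => pdw I (u ε)) ∈ RB b Ω :=
  RB.of_supNorm_le hu (fun ε => contDiffOn_pdw Ω.isOpen (hu.1 ε) I) fun K hK hKΩ =>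
    ⟨K, hK, hKΩ, I.length, 0, fun j => ⟨1, Eventually.of_forall fun ε => by
      rw [one_mul, pow_zero, one_mul]
      exact supNorm_pdw_le Ω.isOpen (hu.1 ε) hK hKΩ I j⟩⟩

theorem RB.smooth_mul (hu : u ∈ RB b Ω) {χ : Eu n → ℂ} (hχ : ContDiff ℝ ∞ χ) :
    (fun ε x => χ x * u ε x) ∈ RB b Ω :=
  RB.of_supNorm_le hu (fun ε => hχ.contDiffOn.mul (hu.1 ε)) fun K hK hKΩ =>
    ⟨K, hK, hKΩ, 0, 0, fun j => ⟨2 ^ j * supNorm K j χ, Eventually.of_forall fun ε => by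
      rw [pow_zero, one_mul]
      exact supNorm_mul_le Ω.isOpen hχ.contDiffOn (hu.1 ε) hK hKΩ j⟩⟩

theorem contDiff_cutoff_mul {U : Set (Eu n)} (hU : IsOpen U) {χ g : Eu n → ℂ}
    (hχ : ContDiff ℝ ∞ χ) (hs : tsupport χ ⊆ U) (hg : ContDiffOn ℝ ∞ g U) :
    ContDiff ℝ ∞ fun x => χ x * g x := by
  simpa only [mul_comm] using contDiff_mul_of_tsupport_subset hU hg hχ hs

theorem RB.cutoff_mul (hu : u ∈ RB b Ω) {χ : Eu n → ℂ} (hχ : ContDiff ℝ ∞ χ)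
    (hc : HasCompactSupport χ) (hs : tsupport χ ⊆ Ω) :
    (fun ε x => χ x * u ε x) ∈ RB b Ω' := by
  have hsm := fun ε => contDiff_cutoff_mul Ω.isOpen hχ hs (hu.1 ε)
  refine RB.of_supNorm_le hu (fun ε => (hsm ε).contDiffOn) fun K _ _ =>
    ⟨tsupport χ, hc, hs, 0, 0, fun j => ⟨2 ^ j * supNorm (tsupport χ) j χ,
      Eventually.of_forall fun ε => ?_⟩⟩
  rw [pow_zero, one_mul]
  refine (supNorm_le_of_tsupport hc (hsm ε) tsupport_mul_subset_left).trans ?_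
  exact supNorm_mul_le Ω.isOpen hχ.contDiffOn (hu.1 ε) hc hs j

/-- The operator `∑ c_α D^α` itself, on functions. -/
def dopT (s : Finset (Fin n →₀ ℕ)) (c : (Fin n →₀ ℕ) → ℂ) (g : Eu n → ℂ) : Eu n → ℂ :=
  fun x => ∑ α ∈ s, opCoeff c α * ((-1) ^ (word α).length * Colombeau.pdw (word α).reverse g x)

theorem RB.dopT (hu : u ∈ RB b Ω) (P : MvPolynomial (Fin n) GenC) :
    (fun ε => dopT P.support (cf P ε) (u ε)) ∈ RB b Ω :=
  RB.sum _ fun α _ => RB.const_mul (RB.const_mul (RB.pdw hu _) (isModerate_const _))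
    (isModerate_opCoeff_cf P α)

end Closure

/-! ### Action of `P(D)` on functionals given by smooth nets -/

theorem integral_mul_dop {U : Set (Eu n)} (hU : IsOpen U) {g u : Eu n → ℂ}
    (hg : ContDiffOn ℝ ∞ g U) (hu : ContDiff ℝ ∞ u) (hc : HasCompactSupport u)
    (hs : tsupport u ⊆ U) (s : Finset (Fin n →₀ ℕ)) (c : (Fin n →₀ ℕ) → ℂ) :
    ∫ x, g x * dop s c u x = ∫ x, dopT s c g x * u x := by
  have h1 : ∀ α, Integrable fun x => opCoeff c α * (g x * pdw (word α) u x) := fun α =>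
    (integrable_mul_of_tsupport_subset hU hg (contDiff_pdw hu _) (hasCompactSupport_pdw hc _)
      ((tsupport_pdw_subset _ u).trans hs)).const_mul _
  have h2 : ∀ α, Integrable fun x => opCoeff c α * ((-1) ^ (word α).length *
      (pdw (word α).reverse g x * u x)) := fun α =>
    ((integrable_mul_of_tsupport_subset hU (contDiffOn_pdw hU hg _) hu hc hs).const_mul _).const_mul _
  simp only [dop_apply, dopT, Finset.mul_sum, Finset.sum_mul, mul_left_comm (g _), mul_assoc]
  rw [integral_finsetSum _ fun α _ => h1 α, integral_finsetSum _ fun α _ => h2 α]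
  refine Finset.sum_congr rfl fun α _ => ?_
  rw [integral_const_mul, integral_const_mul, integral_const_mul,
    integral_mul_pdw hU hg hu hc hs]

theorem setIntegral_mul_test {Ω : Opens (Eu n)} (g : Eu n → ℂ) (u : 𝓓(Ω, ℂ)) :
    ∫ x in (Ω : Set (Eu n)), g x * u x = ∫ x, g x * u x :=
  setIntegral_eq_integral_of_forall_compl_eq_zero fun x hx => by
    rw [image_eq_zero_of_notMem_tsupport fun h => hx (u.tsupport_subset h), mul_zero]

theorem IsGivenBy.applyOp {b : Bool} {Ω : Opens (Eu n)} {T : Functional Ω}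
    (h : IsGivenBy (RB b) T) (P : MvPolynomial (Fin n) GenC) :
    IsGivenBy (RB b) (Colombeau.applyOp P T) := by
  obtain ⟨g, hg, hT⟩ := h
  refine ⟨_, RB.dopT hg P, fun u => ?_⟩
  rw [applyOp_mk]
  refine (hT (opNet P u)).congr' (Eventually.of_forall fun ε => ?_)
  rw [setIntegral_mul_test, setIntegral_mul_test, coe_opNet, coe_testOp]
  exact integral_mul_dop Ω.isOpen (hg.1 ε) (contDiff_test _) (u.1 ε).hasCompactSupport
    (u.1 ε).tsupport_subset _ _

/-- `P(D)` commutes with restriction and, by integration by parts, maps each class to itself, its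
coefficients being moderate. -/
theorem singSupp_applyOp_subset {b : Bool} {Ω : Opens (Eu n)} (T : Functional Ω)
    (P : MvPolynomial (Fin n) GenC) : singSupp (RB b) (applyOp P T) ⊆ singSupp (RB b) T := by
  rintro x ⟨hx, h⟩
  refine ⟨hx, fun ⟨V, hV, hxV, hg⟩ => h ⟨V, hV, hxV, ?_⟩⟩
  rw [restrict_applyOp]
  exact hg.applyOp P

/-! ### Nets of compactly supported distributions -/

section Dominated

variable {S S' : Sm n →ₗ[ℂ] ℂ} {K L : Set (Eu n)} {i j : ℕ} {C C' : ℝ}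

theorem DominatedBy.mono (hS : DominatedBy S K i C) (hL : IsCompact L) (hKL : K ⊆ L) (hij : i ≤ j)
    (hC : C ≤ C') (hC' : 0 ≤ C') : DominatedBy S L j C' := fun f =>
  (hS f).trans (mul_le_mul hC
    (supNorm_mono isOpen_univ (Sm.contDiffOn f _) hL (Set.subset_univ _) hKL hij)
    (supNorm_nonneg _) hC')

/-- `S` is a compactly supported distribution. -/
def IsDominated (S : Sm n →ₗ[ℂ] ℂ) : Prop :=
  ∃ (K : Set (Eu n)) (j : ℕ) (C : ℝ), IsCompact K ∧ 0 ≤ C ∧ DominatedBy S K j C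

theorem IsDominated.sub (hS : IsDominated S) (hS' : IsDominated S') : IsDominated (S - S') := by
  obtain ⟨K, i, C, hK, hC, h⟩ := hS
  obtain ⟨K', i', C', hK', hC', h'⟩ := hS'
  refine ⟨K ∪ K', max i i', C + C', hK.union hK', add_nonneg hC hC', fun f => ?_⟩
  rw [LinearMap.sub_apply, add_mul]
  exact (norm_sub_le _ _).trans (add_le_add
    (h.mono (hK.union hK') Set.subset_union_left (le_max_left _ _) le_rfl hC f)
    (h'.mono (hK.union hK') Set.subset_union_right (le_max_right _ _) le_rfl hC' f))

theorem IsDominated.comp_pdw (hS : IsDominated S) (I : List (Fin n)) :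
    IsDominated (S ∘ₗ Sm.pdw I) := by
  obtain ⟨K, i, C, hK, hC, h⟩ := hS
  exact ⟨K, i + I.length, C, hK, hC, fun f => (h _).trans (mul_le_mul_of_nonneg_left
    (supNorm_pdw_le isOpen_univ (Sm.contDiffOn f _) hK (Set.subset_univ _) I i) hC)⟩

theorem IsDominated.smul (hS : IsDominated S) (c : ℂ) : IsDominated (c • S) := by
  obtain ⟨K, i, C, hK, hC, h⟩ := hS
  refine ⟨K, i, ‖c‖ * C, hK, by positivity, fun f => ?_⟩
  rw [LinearMap.smul_apply, norm_smul, mul_assoc]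
  exact mul_le_mul_of_nonneg_left (h f) (norm_nonneg _)

theorem isDominated_zero : IsDominated (0 : Sm n →ₗ[ℂ] ℂ) :=
  ⟨∅, 0, 0, isCompact_empty, le_rfl, fun f => by simp⟩

theorem IsDominated.comp_dop (hS : IsDominated S) (s : Finset (Fin n →₀ ℕ))
    (c : (Fin n →₀ ℕ) → ℂ) : IsDominated (S ∘ₗ Sm.dop s c) := by
  have e : S ∘ₗ Sm.dop s c = ∑ α ∈ s, opCoeff c α • (S ∘ₗ Sm.pdw (word α)) := by
    ext f
    simp [Sm.dop, LinearMap.sum_apply, map_sum]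
  rw [e]
  refine Finset.sum_induction _ IsDominated (fun a b ha hb => ?_) isDominated_zero fun α _ =>
    (hS.comp_pdw _).smul _
  have := ha.sub (hb.smul (-1))
  simpa using this

theorem isDominated_intFun {g : Eu n → ℂ} (hg : Continuous g) (hc : HasCompactSupport g) :
    IsDominated (intFun g hg hc) :=
  ⟨_, _, _, hc, integral_nonneg fun _ => norm_nonneg _, dominatedBy_intFun hg hc⟩

/-- Evaluation at the origin. -/
def evalZero (n : ℕ) : Sm n →ₗ[ℂ] ℂ where
  toFun f := f.1 0
  map_add' _ _ := rfl
  map_smul' _ _ := rfl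

theorem isDominated_evalZero : IsDominated (evalZero n) :=
  ⟨{0}, 0, 1, isCompact_singleton, zero_le_one, fun f => by
    rw [one_mul]
    exact norm_le_supNorm isOpen_univ (Sm.contDiffOn f _) isCompact_singleton (Set.subset_univ _)
      rfl 0⟩

theorem IsDominated.contDiff_star (hS : IsDominated S) (u : Sm n) : ContDiff ℝ ∞ (star S u) := by
  obtain ⟨K, i, C, hK, hC, h⟩ := hS
  exact Colombeau.contDiff_star hK h u

theorem IsDominated.pdw_star (hS : IsDominated S) (u : Sm n) (I : List (Fin n)) :
    pdw I (star S u) = star S (Sm.pdw I u) := by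
  obtain ⟨K, i, C, hK, hC, h⟩ := hS
  exact Colombeau.pdw_star hK h u I

theorem Sm.shift_pdw (y : Eu n) (I : List (Fin n)) (u : Sm n) :
    Sm.shift y (Sm.pdw I u) = Sm.pdw I (Sm.shift y u) :=
  Subtype.ext (Colombeau.pdw_shift I y u.1).symm

theorem Sm.shift_dop (y : Eu n) (s : Finset (Fin n →₀ ℕ)) (c : (Fin n →₀ ℕ) → ℂ) (u : Sm n) :
    Sm.shift y (Sm.dop s c u) = Sm.dop s c (Sm.shift y u) := by
  simp only [Sm.dop, LinearMap.sum_apply, LinearMap.smul_apply, map_sum, map_smul, Sm.shift_pdw]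

theorem IsDominated.dop_star (hS : IsDominated S) (u : Sm n) (s : Finset (Fin n →₀ ℕ))
    (c : (Fin n →₀ ℕ) → ℂ) : dop s c (star S u) = star S (Sm.dop s c u) := by
  funext y
  rw [dop_apply, star, Sm.dop, LinearMap.sum_apply, map_sum, map_sum]
  refine Finset.sum_congr rfl fun α _ => ?_
  rw [hS.pdw_star, LinearMap.smul_apply, map_smul, map_smul, smul_eq_mul]
  rfl

theorem supNorm_refl_le (f : Sm n) (hK : IsCompact K) :
    supNorm K j (Sm.refl f).1 ≤ supNorm (-K) j f.1 := by
  refine supNorm_le (supNorm_nonneg _) fun x hx i hi => ?_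
  have h := (LinearIsometryEquiv.neg ℝ (E := Eu n)).norm_iteratedFDeriv_comp_right f.1 x i
  refine (le_of_eq h).trans ?_
  exact le_supNorm hK.neg (Sm.contDiff f) (by simpa using hx) hi

theorem DominatedBy.comp_refl (hS : DominatedBy S K j C) (hK : IsCompact K) (hC : 0 ≤ C) :
    DominatedBy (S ∘ₗ Sm.refl) (-K) j C := fun f =>
  (hS _).trans (mul_le_mul_of_nonneg_left (supNorm_refl_le f hK) hC)

end Dominated

/-- A moderate net of compactly supported distributions, with common bounds. -/
def IsDominatedNet (S : Idx → Sm n →ₗ[ℂ] ℂ) (K : Set (Eu n)) (j N : ℕ) (c : ℝ) : Prop :=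
  IsCompact K ∧ 0 ≤ c ∧ ∀ ε : Idx, DominatedBy (S ε) K j (c * ((ε : ℝ)⁻¹) ^ N)

section Nets

variable {S : Idx → Sm n →ₗ[ℂ] ℂ} {K : Set (Eu n)} {j N : ℕ} {c : ℝ}

theorem IsDominatedNet.isDominated (hS : IsDominatedNet S K j N c) (ε : Idx) :
    IsDominated (S ε) :=
  ⟨K, j, _, hS.1, mul_nonneg hS.2.1 (inv_coe_pow_pos ε N).le, hS.2.2 ε⟩

theorem IsDominatedNet.comp_refl (hS : IsDominatedNet S K j N c) :
    IsDominatedNet (fun ε => S ε ∘ₗ Sm.refl) (-K) j N c :=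
  ⟨hS.1.neg, hS.2.1, fun ε => (hS.2.2 ε).comp_refl hS.1
    (mul_nonneg hS.2.1 (inv_coe_pow_pos ε N).le)⟩

theorem IsDominatedNet.isNegligible (hS : IsDominatedNet S K j N c) {f : Idx → Sm n}
    (hf : IsNegligible fun ε => supNorm K j (f ε).1) : IsNegligible fun ε => S ε (f ε) := by
  refine IsNegligible.of_le (IsModerate.mul_isNegligible
    (IsModerate.mul (isModerate_const c) (isModerate_inv_pow N)) hf) fun ε => ?_
  exact (hS.2.2 ε (f ε)).trans (le_abs_self _)

/-- The convolution of a moderate net of compactly supported distributions with a net in a class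
belongs to the class. -/
theorem IsDominatedNet.star_mem (hS : IsDominatedNet S K j N c) {b : Bool} {g : Idx → Sm n}
    (hg : (fun ε => (g ε).1) ∈ RB b (⊤ : Opens (Eu n))) :
    (fun ε => star (S ε) (g ε)) ∈ RB b (⊤ : Opens (Eu n)) := by
  -- For `y ∈ L` and `z ∈ K` the argument `y + z` stays in the compact set `L + K`. The loss of `j`
  -- derivatives and `N` powers of `ε` is the same for every order `i`, which is what regular nets
  -- require.
  refine RB.of_supNorm_le hg (fun ε => ((hS.isDominated ε).contDiff_star (g ε)).contDiffOn)
    fun L hL _ => ⟨L + K, hL.add hS.1, Set.subset_univ _, j, N, fun i =>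
      ⟨(n + 1) ^ i * c, Eventually.of_forall fun ε => ?_⟩⟩
  have hc := hS.2.1
  have hpos := (inv_coe_pow_pos ε N).le
  rw [mul_assoc]
  refine supNorm_le_of_pdw isOpen_univ ((hS.isDominated ε).contDiff_star (g ε)).contDiffOn
    (Set.subset_univ _) (mul_nonneg hc (mul_nonneg hpos (supNorm_nonneg _))) i fun y hy I hI => ?_
  rw [(hS.isDominated ε).pdw_star, ← mul_assoc]
  refine (hS.2.2 ε _).trans (mul_le_mul_of_nonneg_left ?_ (mul_nonneg hc hpos))
  refine (supNorm_shift_le (contDiff_pdw (g ε).2 I) (hL.add hS.1) y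
    (fun z hz => Set.add_mem_add hy hz) j).trans ?_
  refine (supNorm_pdw_le isOpen_univ (Sm.contDiffOn (g ε) _) (hL.add hS.1) (Set.subset_univ _)
    I j).trans ?_
  exact supNorm_mono isOpen_univ (Sm.contDiffOn (g ε) _) (hL.add hS.1) (Set.subset_univ _)
    subset_rfl (by omega)

end Nets

/-! ### Nets of test functions -/

section TestNets

variable {Ω V : Opens (Eu n)}

/-- A test function as an element of `C^∞(ℝⁿ)`. -/
def testSm (f : 𝓓(Ω, ℂ)) : Sm n := ⟨f, contDiff_test f⟩

/-- A smooth function that is supported in a compact subset of `Ω` as a test function. -/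
def toTest (f : Sm n) {K : Set (Eu n)} (hK : IsCompact K) (hKΩ : K ⊆ Ω) (hs : tsupport f.1 ⊆ K) :
    𝓓(Ω, ℂ) :=
  ⟨f.1, Sm.contDiff f, hK.of_isClosed_subset (isClosed_tsupport _) hs, hs.trans hKΩ⟩

/-- A moderate net of smooth functions supported in a compact subset of `Ω`. -/
def EcM.ofSm (u : Idx → Sm n) {K : Set (Eu n)} (hK : IsCompact K) (hKΩ : K ⊆ Ω)
    (hs : ∀ ε, tsupport (u ε).1 ⊆ K) (hu : (fun ε => (u ε).1) ∈ RB false (⊤ : Opens (Eu n))) :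
    EcM Ω :=
  ⟨fun ε => toTest (u ε) hK hKΩ (hs ε), ⟨K, hK, hKΩ, hs⟩, by
    rw [EM_eq_RB]
    exact RB.mono hu le_top⟩

theorem EcM.mem_RB (u : EcM Ω) : (fun ε => (u.1 ε : Eu n → ℂ)) ∈ RB false (⊤ : Opens (Eu n)) := by
  obtain ⟨⟨K, hK, hKΩ, hs⟩, hu⟩ := u.2
  rw [EM_eq_RB] at hu
  refine RB.of_supNorm_le hu (fun ε => (contDiff_test _).contDiffOn) fun L _ _ =>
    ⟨K, hK, hKΩ, 0, 0, fun j => ⟨1, Eventually.of_forall fun ε => ?_⟩⟩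
  rw [one_mul, pow_zero, one_mul]
  exact supNorm_le_of_tsupport hK (contDiff_test (u.1 ε)) (hs ε)

theorem supNorm_succ_le {K : Set (Eu n)} {f : Eu n → ℂ} (hf : ContDiff ℝ ∞ f) (hK : IsCompact K)
    (j : ℕ) : supNorm K (j + 1) f ≤ supNorm K 0 f + ∑ k, supNorm K j (pd k f) := by
  have h0 : 0 ≤ ∑ k, supNorm K j (pd k f) := Finset.sum_nonneg fun _ _ => supNorm_nonneg _
  refine supNorm_le (add_nonneg (supNorm_nonneg _) h0) fun x hx i hi => ?_
  cases i with
  | zero => exact (le_supNorm hK hf hx le_rfl).trans (le_add_of_nonneg_right h0)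
  | succ i =>
    refine (norm_iteratedFDeriv_succ_le hf.contDiffAt i).trans
      ((Finset.sum_le_sum fun k _ => ?_).trans (le_add_of_nonneg_left (supNorm_nonneg _)))
    exact le_supNorm hK (contDiff_pd hf k) hx (by omega)

/-- If a net of compactly supported distributions is negligible on nets of test functions, then so
is its convolution with a net of test functions. -/
theorem isNegligible_supNorm_star {S : Idx → Sm n →ₗ[ℂ] ℂ} (hS : ∀ ε, IsDominated (S ε))
    {K B : Set (Eu n)} (hK : IsCompact K) (hB : IsCompact B)
    (hneg : ∀ w : EcM (⊤ : Opens (Eu n)), (∀ ε, tsupport (w.1 ε) ⊆ B) →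
      IsNegligible fun ε => S ε (testSm (w.1 ε))) (j : ℕ) (u : EcM (⊤ : Opens (Eu n)))
    (hu : ∀ ε, ∀ y ∈ K, ∀ z, y + z ∈ tsupport (u.1 ε) → z ∈ B) :
    IsNegligible fun ε => supNorm K j (star (S ε) (testSm (u.1 ε))) := by
  induction j generalizing u with
  | zero =>
    rcases K.eq_empty_or_nonempty with rfl | hne
    · have : ∀ f : Eu n → ℂ, supNorm ∅ 0 f = 0 := fun f =>
        le_antisymm (supNorm_le le_rfl fun x hx => hx.elim) (supNorm_nonneg _)
      simp only [this]
      exact isNegligible_zero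
    -- Uniformity in `y` comes from a choice of point for each `ε`: the translates of `u_ε` to the
    -- maximum points form a single moderate net supported in `B`, to which `hneg` applies.
    · have hmax := fun ε => hK.exists_isMaxOn hne
        ((hS ε).contDiff_star (testSm (u.1 ε))).continuous.norm.continuousOn
      choose y hyK hy using hmax
      have hts : ∀ ε, tsupport (Sm.shift (y ε) (testSm (u.1 ε))).1 ⊆ B := fun ε => by
        refine closure_minimal (fun z hz => hu ε _ (hyK ε) z (subset_closure hz)) hB.isClosed
      have hmod : (fun ε => (Sm.shift (y ε) (testSm (u.1 ε))).1) ∈ RB false (⊤ : Opens (Eu n)) := by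
        refine RB.of_supNorm_le (EcM.mem_RB u) (fun ε => Sm.contDiffOn _ _) fun L hL _ =>
          ⟨K + L, hK.add hL, Set.subset_univ _, 0, 0, fun j => ⟨1, Eventually.of_forall fun ε => ?_⟩⟩
        rw [one_mul, pow_zero, one_mul]
        exact supNorm_shift_le (contDiff_test (u.1 ε)) (hK.add hL) (y ε)
          (fun z hz => Set.add_mem_add (hyK ε) hz) j
      refine IsNegligible.of_le (hneg (EcM.ofSm _ hB (Set.subset_univ _) hts hmod) hts) fun ε => ?_
      rw [Real.norm_of_nonneg (supNorm_nonneg _)]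
      refine supNorm_le (norm_nonneg _) fun x hx i hi => ?_
      obtain rfl : i = 0 := by omega
      rw [norm_iteratedFDeriv_zero]
      exact hy ε hx
  | succ j ih =>
    have h0 : IsNegligible fun ε => supNorm K 0 (star (S ε) (testSm (u.1 ε))) := by
      refine IsNegligible.of_le (ih u hu) fun ε => ?_
      rw [Real.norm_of_nonneg (supNorm_nonneg _), Real.norm_of_nonneg (supNorm_nonneg _)]
      exact supNorm_mono isOpen_univ ((hS ε).contDiff_star _).contDiffOn hK (Set.subset_univ _)
        subset_rfl (Nat.zero_le _)
    -- Differentiating the convolution only replaces `u` by `∂_k u`, whose support is no larger, so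
    -- the induction hypothesis applies to it.
    have h1 : ∀ k, IsNegligible fun ε => supNorm K j (pd k (star (S ε) (testSm (u.1 ε)))) := by
      intro k
      refine IsNegligible.congr' (ih (EcM.partial ⊤ k u) fun ε y hy z hz =>
        hu ε y hy z (tsupport_testPartial k _ hz)) (Eventually.of_forall fun ε => ?_)
      have e : testSm ((EcM.partial ⊤ k u).1 ε) = Sm.pdw [k] (testSm (u.1 ε)) :=
        Subtype.ext (coe_testPartial k (u.1 ε))
      simp only [e]
      rw [← (hS ε).pdw_star]
      rfl
    refine IsNegligible.of_le (h0.add (IsNegligible.sum Finset.univ fun k _ => h1 k)) fun ε => ?_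
    rw [Real.norm_of_nonneg (supNorm_nonneg _)]
    exact (supNorm_succ_le ((hS ε).contDiff_star _) hK j).trans (le_abs_self _)

/-- Multiplication by a test function. -/
def cutTest (χ : 𝓓(Ω, ℂ)) : Sm n →ₗ[ℂ] 𝓓(Ω, ℂ) where
  toFun f := ⟨fun x => χ x * f.1 x, (contDiff_test χ).mul (Sm.contDiff f),
    χ.hasCompactSupport.mul_right, tsupport_mul_subset_left.trans χ.tsupport_subset⟩
  map_add' f g := DFunLike.coe_injective (funext fun x => mul_add (χ x) (f.1 x) (g.1 x))
  map_smul' c f := DFunLike.coe_injective (funext fun x => mul_left_comm (χ x) c (f.1 x))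

theorem cutTest_apply (χ : 𝓓(Ω, ℂ)) (f : Sm n) (x : Eu n) : cutTest χ f x = χ x * f.1 x := rfl

/-- Multiplication by a test function makes the distributions act on all of `C^∞(ℝⁿ)`. Setting the
net to zero for `ε > η` makes the bounds hold for every `ε`. -/
theorem IsModerateDistNet.exists_cut {T : Idx → 𝓓(Ω, ℂ) →L[ℂ] ℂ} (hT : IsModerateDistNet T)
    (χ : 𝓓(Ω, ℂ)) : ∃ (S : Idx → Sm n →ₗ[ℂ] ℂ) (η : Idx) (j N : ℕ) (c : ℝ),
      IsDominatedNet S (tsupport χ) j N c ∧ ∀ ε ≤ η, S ε = (T ε).toLinearMap ∘ₗ cutTest χ := by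
  obtain ⟨j, N, c, η, hc, h⟩ := hT (tsupport χ) χ.hasCompactSupport χ.tsupport_subset
  classical
  refine ⟨fun ε => if ε ≤ η then (T ε).toLinearMap ∘ₗ cutTest χ else 0, η, j, N,
    c * (2 ^ j * supNorm (tsupport χ) j χ), ⟨χ.hasCompactSupport,
      mul_nonneg hc.le (mul_nonneg (by positivity) (supNorm_nonneg _)), fun ε f => ?_⟩,
    fun ε hε => if_pos hε⟩
  have hpos := (inv_coe_pow_pos ε N).le
  have h0 : 0 ≤ c * (2 ^ j * supNorm (tsupport χ) j χ) * ((ε : ℝ)⁻¹) ^ N :=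
    mul_nonneg (mul_nonneg hc.le (mul_nonneg (by positivity) (supNorm_nonneg _))) hpos
  by_cases hε : ε ≤ η
  · simp only [if_pos hε]
    refine (h (cutTest χ f) tsupport_mul_subset_left ε hε).trans ?_
    calc c * ((ε : ℝ)⁻¹) ^ N * supNorm (tsupport χ) j (cutTest χ f)
        ≤ c * ((ε : ℝ)⁻¹) ^ N * (2 ^ j * supNorm (tsupport χ) j χ * supNorm (tsupport χ) j f.1) :=
          mul_le_mul_of_nonneg_left (supNorm_mul_le isOpen_univ (contDiff_test χ).contDiffOn
            (Sm.contDiffOn f _) χ.hasCompactSupport (Set.subset_univ _) j)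
            (mul_nonneg hc.le hpos)
      _ = _ := by ring
  · simp only [if_neg hε, LinearMap.zero_apply, norm_zero]
    exact mul_nonneg h0 (supNorm_nonneg _)

end TestNets

/-! ### Localization of a parametrix -/

theorem exists_ball_cutoff (x : Eu n) {r R : ℝ} (hr : 0 < r) (hrR : r < R) :
    ∃ χ : Sm n, (∀ y ∈ Metric.closedBall x r, χ.1 y = 1) ∧
      tsupport χ.1 ⊆ Metric.closedBall x R := by
  let f : ContDiffBump x := ⟨r, R, hr, hrR⟩
  refine ⟨⟨fun y => (f y : ℂ), Complex.ofRealCLM.contDiff.comp f.contDiff⟩, fun y hy => ?_, ?_⟩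
  · change ((f y : ℝ) : ℂ) = 1
    rw [f.one_of_mem_closedBall hy, Complex.ofReal_one]
  · refine (closure_mono fun y hy => ?_).trans f.tsupport_eq.le
    intro h
    exact hy (by simp [h])

section Localization

variable {Ω V : Opens (Eu n)}

/-- Multiplication of a net of test functions by a smooth function. -/
def EcM.mulSm (ψ : Sm n) (u : EcM Ω) : EcM Ω :=
  ⟨fun ε => cutTest (u.1 ε) ψ, by
    obtain ⟨⟨K, hK, hKΩ, hs⟩, -⟩ := u.2
    exact ⟨K, hK, hKΩ, fun ε => tsupport_mul_subset_left.trans (hs ε)⟩, by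
    rw [EM_eq_RB]
    have := RB.mono (RB.smooth_mul (EcM.mem_RB u) (Sm.contDiff ψ)) (le_top : Ω ≤ ⊤)
    refine (congrArg (· ∈ RB false Ω) (funext fun ε => funext fun x => ?_)).mpr this
    exact mul_comm _ _⟩

theorem EcM.mulSm_apply (ψ : Sm n) (u : EcM Ω) (ε : Idx) (x : Eu n) :
    (EcM.mulSm ψ u).1 ε x = u.1 ε x * ψ.1 x := rfl

theorem integrable_mul_test {g : Eu n → ℂ} (hg : ContDiffOn ℝ ∞ g (⊤ : Opens (Eu n)))
    (u : 𝓓(Ω, ℂ)) : Integrable fun x => g x * u x :=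
  integrable_mul_of_tsupport_subset isOpen_univ hg (contDiff_test u) u.hasCompactSupport
    (Set.subset_univ _)

/-- A functional that belongs to a class near every point of a compact set belongs to the class
after multiplication by a smooth function that equals `1` on the compact set. -/
theorem exists_smooth_on_compact {b : Bool} {F : Functional (⊤ : Opens (Eu n))}
    {S : Idx → 𝓓((⊤ : Opens (Eu n)), ℂ) →L[ℂ] ℂ}
    (hS : ∀ u : EcM (⊤ : Opens (Eu n)), Represents (fun ε => S ε (u.1 ε)) (F (Gc.mk u)))
    {A : Set (Eu n)} (hA : IsCompact A) (hsing : Disjoint A (singSupp (RB b) F)) :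
    ∃ ψ : Sm n, ∃ f ∈ RB b (⊤ : Opens (Eu n)), (∀ x ∈ A, ψ.1 x = 1) ∧
      ∀ w : EcM (⊤ : Opens (Eu n)),
        IsNegligible fun ε => S ε (cutTest (w.1 ε) ψ) - ∫ x, f ε x * w.1 ε x := by
  refine hA.induction_on (p := fun A => ∃ ψ : Sm n, ∃ f ∈ RB b (⊤ : Opens (Eu n)),
      (∀ x ∈ A, ψ.1 x = 1) ∧ ∀ w : EcM (⊤ : Opens (Eu n)),
        IsNegligible fun ε => S ε (cutTest (w.1 ε) ψ) - ∫ x, f ε x * w.1 ε x) ?_ ?_ ?_ ?_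
  · refine ⟨0, _, RB.zero, fun x hx => hx.elim, fun w => ?_⟩
    simpa using isNegligible_zero (F := ℂ)
  · rintro s t hst ⟨ψ, f, hf, h1, h2⟩
    exact ⟨ψ, f, hf, fun x hx => h1 x (hst hx), h2⟩
  · rintro s t ⟨ψ, f, hf, h1, h2⟩ ⟨ψ', f', hf', h1', h2'⟩
    -- The cutoff `ψ + (1 - ψ)ψ'` equals `1` wherever `ψ` or `ψ'` does, and the densities combine by
    -- the same formula. This replaces a partition of unity.
    let θ : Sm n := ⟨fun x => 1 - ψ.1 x, contDiff_const.sub (Sm.contDiff ψ)⟩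
    let θψ : Sm n := ⟨fun x => θ.1 x * ψ'.1 x, (Sm.contDiff θ).mul (Sm.contDiff ψ')⟩
    refine ⟨ψ + θψ, _, RB.add hf (RB.smooth_mul hf' (Sm.contDiff θ)), fun x hx => ?_, fun w => ?_⟩
    · change ψ.1 x + (1 - ψ.1 x) * ψ'.1 x = 1
      rcases hx with hx | hx
      · rw [h1 x hx]; ring
      · rw [h1' x hx]; ring
    · refine IsNegligible.congr' ((h2 w).add (h2' (EcM.mulSm θ w))) (.of_forall fun ε => ?_)
      have e1 : cutTest ((EcM.mulSm θ w).1 ε) ψ' = cutTest (w.1 ε) θψ :=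
        DFunLike.coe_injective (funext fun x => mul_assoc _ _ _)
      have e2 : ∫ x, (f ε x + θ.1 x * f' ε x) * w.1 ε x =
          (∫ x, f ε x * w.1 ε x) + ∫ x, f' ε x * (EcM.mulSm θ w).1 ε x := by
        rw [← integral_add (integrable_mul_test (hf.1 ε) _) (integrable_mul_test (hf'.1 ε) _)]
        refine integral_congr_ae (.of_forall fun x => ?_)
        simp only [EcM.mulSm_apply]
        ring
      rw [e1, e2, map_add, map_add]
      ring
  · intro x hx
    have hns := Set.disjoint_left.1 hsing hx
    have hV : ∃ (V : Opens (Eu n)) (h : V ≤ ⊤), x ∈ V ∧ IsGivenBy (RB b) (F.restrict h) := by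
      by_contra h
      exact hns ⟨trivial, h⟩
    obtain ⟨V, hV, hxV, g, hg, hgF⟩ := hV
    obtain ⟨r, hr, hrV⟩ := Metric.isOpen_iff.1 V.isOpen x hxV
    obtain ⟨ψ, h1, hs⟩ := exists_ball_cutoff x (r := r / 3) (R := r / 2) (by positivity)
      (by linarith)
    have hK : IsCompact (Metric.closedBall x (r / 2)) := isCompact_closedBall _ _
    have hKV : Metric.closedBall x (r / 2) ⊆ V :=
      (Metric.closedBall_subset_ball (by linarith)).trans hrV
    refine ⟨Metric.closedBall x (r / 3), mem_nhdsWithin_of_mem_nhds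
      (Metric.closedBall_mem_nhds x (by positivity)), ψ, _,
      RB.cutoff_mul hg (Sm.contDiff ψ) (hK.of_isClosed_subset (isClosed_tsupport _) hs)
        (hs.trans hKV), h1, fun w => ?_⟩
    let u : EcM V := EcM.ofSm (fun ε => testSm (cutTest (w.1 ε) ψ)) hK hKV
      (fun ε => tsupport_mul_subset_right.trans hs) (EcM.mem_RB (EcM.mulSm ψ w))
    refine IsNegligible.congr' ((hS (EcM.extend hV u)).isNegligible_sub (hgF u))
      (.of_forall fun ε => ?_)
    rw [setIntegral_mul_test]
    congr 1
    refine integral_congr_ae (.of_forall fun x => ?_)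
    change g ε x * (w.1 ε x * ψ.1 x) = ψ.1 x * g ε x * w.1 ε x
    ring

/-- After multiplication by a cutoff function that equals `1` near the origin, a parametrix is
still a parametrix on nets of test functions with bounded supports. -/
theorem exists_local_parametrix {b : Bool} {P : MvPolynomial (Fin n) GenC}
    {F : Functional (⊤ : Opens (Eu n))} {S : Idx → 𝓓((⊤ : Opens (Eu n)), ℂ) →L[ℂ] ℂ}
    (hS : ∀ u : EcM (⊤ : Opens (Eu n)), Represents (fun ε => S ε (u.1 ε)) (F (Gc.mk u)))
    (hpar : IsParametrix (RB b) P F) (hsing : singSupp (RB b) F ⊆ {0})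
    (φ : 𝓓((⊤ : Opens (Eu n)), ℂ)) {ρ : ℝ} (hρ : 0 < ρ)
    (hφ : ∀ x ∈ Metric.closedBall (0 : Eu n) ρ, φ x = 1) (R : ℝ) :
    ∃ κ ∈ RB b (⊤ : Opens (Eu n)), ∀ w : EcM (⊤ : Opens (Eu n)),
      (∀ ε, tsupport (w.1 ε) ⊆ Metric.closedBall 0 R) →
      IsNegligible fun ε => S ε (cutTest φ (Sm.dop P.support (cf P ε) (testSm (w.1 ε)))) -
        w.1 ε 0 - ∫ x, κ ε x * w.1 ε x := by
  obtain ⟨r, hr, hrF⟩ := hpar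
  have hA : IsCompact (Metric.closedBall (0 : Eu n) R \ Metric.ball 0 ρ) :=
    (isCompact_closedBall _ _).diff Metric.isOpen_ball
  obtain ⟨ψ, f, hf, hψ, hψf⟩ := exists_smooth_on_compact hS hA (b := b)
    (Set.disjoint_left.2 fun x hx hx' => hx.2 (by
      rw [Set.mem_singleton_iff.1 (hsing hx')]
      exact Metric.mem_ball_self hρ))
  let θ : Sm n := ⟨fun x => 1 - φ x, contDiff_const.sub (contDiff_test φ)⟩
  have hθf := RB.smooth_mul hf (Sm.contDiff θ)
  -- The full parametrix contributes the remainder `r`. The part `(1 - φ)F` that was cut away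
  -- agrees, on the ball of radius `R`, with the net `(1 - φ)f` in the class, so it contributes
  -- `P(D)((1 - φ)f)`.
  refine ⟨_, RB.sub hr (RB.dopT hθf P), fun w hw => ?_⟩
  have h1 := ((hS (opNet P w)).sub (represents_delta w))
  rw [← applyOp_mk, ← LinearMap.sub_apply] at h1
  refine IsNegligible.congr' ((h1.isNegligible_sub (hrF w)).sub
    (hψf (EcM.mulSm θ (opNet P w)))) (.of_forall fun ε => ?_)
  have hop : ∀ x, (opNet P w).1 ε x = dop P.support (cf P ε) (w.1 ε) x := fun x => by
    rw [coe_opNet, coe_testOp]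
  -- The factor `ψ` may be dropped: it is `1` on the annulus, `1 - φ` vanishes inside it, and `ᵗP w`
  -- vanishes outside it.
  have e1 : cutTest ((EcM.mulSm θ (opNet P w)).1 ε) ψ = cutTest ((opNet P w).1 ε) θ := by
    refine DFunLike.coe_injective (funext fun x => ?_)
    simp only [cutTest_apply, EcM.mulSm_apply]
    by_cases hx : x ∈ Metric.closedBall (0 : Eu n) ρ
    · have : θ.1 x = 0 := by
        change 1 - φ x = 0
        rw [hφ x hx, sub_self]
      rw [this]; ring
    · by_cases hx' : x ∈ Metric.closedBall (0 : Eu n) R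
      · rw [hψ x ⟨hx', fun h => hx (Metric.ball_subset_closedBall h)⟩, mul_one]
      · have : (opNet P w).1 ε x = 0 := by
          rw [hop]
          exact image_eq_zero_of_notMem_tsupport fun h =>
            hx' (hw ε (tsupport_dop_subset _ _ _ h))
        rw [this]; ring
  have e2 : cutTest φ (Sm.dop P.support (cf P ε) (testSm (w.1 ε))) =
      (opNet P w).1 ε - cutTest ((opNet P w).1 ε) θ := by
    refine DFunLike.coe_injective (funext fun x => ?_)
    change φ x * (Sm.dop P.support (cf P ε) (testSm (w.1 ε))).1 x =
      (opNet P w).1 ε x - (opNet P w).1 ε x * (1 - φ x)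
    rw [Sm.coe_dop, hop]
    change φ x * dop P.support (cf P ε) (w.1 ε) x = _
    ring
  have e3 : ∫ x, f ε x * (EcM.mulSm θ (opNet P w)).1 ε x =
      ∫ x, dopT P.support (cf P ε) (fun x => θ.1 x * f ε x) x * w.1 ε x := by
    rw [← integral_mul_dop isOpen_univ (hθf.1 ε) (contDiff_test (w.1 ε))
      (w.1 ε).hasCompactSupport (Set.subset_univ _)]
    refine integral_congr_ae (.of_forall fun x => ?_)
    simp only [EcM.mulSm_apply, hop]
    ring
  have e4 : ∫ x, (r ε x - dopT P.support (cf P ε) (fun x => θ.1 x * f ε x) x) * w.1 ε x =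
      (∫ x, r ε x * w.1 ε x) -
        ∫ x, dopT P.support (cf P ε) (fun x => θ.1 x * f ε x) x * w.1 ε x := by
    simp only [sub_mul]
    exact integral_sub (integrable_mul_test (hr.1 ε) _)
      (integrable_mul_test ((RB.dopT hθf P).1 ε) _)
  rw [e1, e2, e3, e4, setIntegral_mul_test, map_sub]
  ring

end Localization

/-! ### Convolution identities -/

theorem DominatedBy.eq_zero {S : Sm n →ₗ[ℂ] ℂ} {K : Set (Eu n)} {j : ℕ} {C : ℝ}
    (hS : DominatedBy S K j C) {f : Sm n} (h : Disjoint K (tsupport f.1)) : S f = 0 := by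
  have h0 : supNorm K j f.1 = 0 := by
    refine le_antisymm (supNorm_le le_rfl fun x hx i _ => ?_) (supNorm_nonneg _)
    have : iteratedFDeriv ℝ i f.1 x = 0 := by
      by_contra h0
      exact Set.disjoint_left.1 h hx (support_iteratedFDeriv_subset i h0)
    rw [this, norm_zero]
  have := hS f
  rw [h0, mul_zero] at this
  exact norm_le_zero_iff.1 this

theorem Sm.mem_tsupport_shift {y z : Eu n} {u : Sm n} (h : z ∈ tsupport (Sm.shift y u).1) :
    y + z ∈ tsupport u.1 := by
  have : IsClosed ((fun z => y + z) ⁻¹' tsupport u.1) :=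
    (isClosed_tsupport _).preimage (continuous_const.add continuous_id)
  exact closure_minimal (t := (fun z => y + z) ⁻¹' tsupport u.1)
    (fun z hz => subset_closure (s := Function.support u.1) hz) this h

theorem tsupport_star_subset_closedBall {S : Sm n →ₗ[ℂ] ℂ} {K : Set (Eu n)} {j : ℕ} {C r s : ℝ}
    (hS : DominatedBy S K j C) (hK : K ⊆ Metric.closedBall 0 r) {u : Sm n} {x : Eu n}
    (hu : tsupport u.1 ⊆ Metric.closedBall x s) :
    tsupport (star S u) ⊆ Metric.closedBall x (r + s) := by
  refine closure_minimal (fun y hy => ?_) Metric.isClosed_closedBall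
  by_contra h
  refine hy (hS.eq_zero (Set.disjoint_left.2 fun z hz hz' => h ?_))
  have h1 := mem_closedBall_zero_iff.1 (hK hz)
  have h2 := mem_closedBall_iff_norm.1 (hu (Sm.mem_tsupport_shift hz'))
  rw [mem_closedBall_iff_norm]
  calc ‖y - x‖ = ‖(y + z - x) - z‖ := by congr 1; abel
    _ ≤ _ := (norm_sub_le _ _).trans (by linarith)

/-- Commutativity of the convolution with respect to reflection. -/
theorem star_intFun_eq {a c : Eu n → ℂ} (ha : Continuous a) (hac : HasCompactSupport a)
    (has : ContDiff ℝ ∞ a) (hc : Continuous c) (hcc : HasCompactSupport c) (hcs : ContDiff ℝ ∞ c)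
    (y : Eu n) :
    star (intFun a ha hac) ⟨c, hcs⟩ y = star (intFun c hc hcc) ⟨a, has⟩ (-y) := by
  change ∫ z, a z * c (y + z) = ∫ z, c z * a (-y + z)
  rw [← integral_add_left_eq_self (fun z => c z * a (-y + z)) y]
  refine integral_congr_ae (.of_forall fun z => ?_)
  simp only [neg_add_cancel_left, mul_comm]

/-- Transposition of a convolution: `S` moves from `u` onto the smooth function `a`, by Fubini for
the reflected distribution followed by a translation of the integration variable. This is what
exhibits `u` as a plain factor under an integral. -/
theorem apply_starSm_intFun {S : Sm n →ₗ[ℂ] ℂ} {K : Set (Eu n)} {j : ℕ} {C : ℝ} (hK : IsCompact K)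
    (hC : 0 ≤ C) (hS : DominatedBy S K j C) {a u : Sm n} (ha : HasCompactSupport a.1)
    (hu : HasCompactSupport u.1) :
    S (starSm ha (dominatedBy_intFun (Sm.contDiff a).continuous ha) u) =
      ∫ x, u.1 x * star (S ∘ₗ Sm.refl) a x := by
  rw [integral_mul_star hK.neg (hS.comp_refl hK hC) (Sm.contDiff u).continuous hu a]
  refine congrArg S (Subtype.ext (funext fun y => ?_))
  exact star_intFun_eq _ ha (Sm.contDiff a) (Sm.contDiff u).continuous hu (Sm.contDiff u) y

/-! ### Hypoellipticity from a parametrix -/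

/-- With `v(y) = S(u(y + ·))`, the local parametrix identity gives `ᵗP v = u + k + negligible`.
Applying `T` yields `Tu = ∫ g v - T(k)` up to a negligible net, and both terms are integrals of `u`
against nets in the class. -/
theorem singSupp_subset_of_isParametrix {b : Bool} {P : MvPolynomial (Fin n) GenC}
    {F : Functional (⊤ : Opens (Eu n))} (hF : IsBasic F) (hpar : IsParametrix (RB b) P F)
    (hsing : singSupp (RB b) F ⊆ {0}) {Ω : Opens (Eu n)} {T : Functional Ω} (hT : IsBasic T) :
    singSupp (RB b) T ⊆ singSupp (RB b) (applyOp P T) := by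
  rintro x₀ ⟨hx, h⟩
  refine ⟨hx, fun ⟨V, hV, hxV, g, hg, hgT⟩ => h ?_⟩
  obtain ⟨-, Fn, hFn, hFr⟩ := hF
  obtain ⟨-, Tn, hTn, hTr⟩ := hT
  obtain ⟨r, hr, hrV⟩ := Metric.isOpen_iff.1 V.isOpen x₀ hxV
  -- The radii add up: `u` lives within `ρ` of `x₀` and `S` within `ρ` of `0`, so `v` lives within
  -- `2ρ`, where `χ = 1`. If `y` is within `3ρ` of `x₀` and `y + z` in the support of `u`, then `|z|
  -- ≤ 4ρ`, where `β = 1`.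
  obtain ⟨ρ, hρ, hρr⟩ : ∃ ρ : ℝ, 0 < ρ ∧ 3 * ρ < r := ⟨r / 4, by positivity, by linarith⟩
  have hball : ∀ s ≤ 3 * ρ, Metric.closedBall x₀ s ⊆ V := fun s hs =>
    (Metric.closedBall_subset_ball (by linarith)).trans hrV
  obtain ⟨φ, hφ1, hφs⟩ := exists_ball_cutoff (0 : Eu n) (r := ρ / 2) (R := ρ) (by positivity)
    (by linarith)
  obtain ⟨χ, hχ1, hχs⟩ := exists_ball_cutoff x₀ (r := 2 * ρ) (R := 3 * ρ) (by positivity)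
    (by linarith)
  obtain ⟨β, hβ1, hβs⟩ := exists_ball_cutoff (0 : Eu n) (r := 4 * ρ) (R := 5 * ρ) (by positivity)
    (by linarith)
  have hχc : HasCompactSupport χ.1 :=
    (isCompact_closedBall _ _).of_isClosed_subset (isClosed_tsupport _) hχs
  have hβc : HasCompactSupport β.1 :=
    (isCompact_closedBall _ _).of_isClosed_subset (isClosed_tsupport _) hβs
  let φt : 𝓓((⊤ : Opens (Eu n)), ℂ) :=
    toTest φ (isCompact_closedBall (0 : Eu n) ρ) (Set.subset_univ _) hφs
  let χt : 𝓓(Ω, ℂ) :=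
    toTest χ (isCompact_closedBall x₀ (3 * ρ)) ((hball _ le_rfl).trans hV) hχs
  obtain ⟨S, η, j, N, c, hS, hSF⟩ := hFn.exists_cut φt
  obtain ⟨Q, η', j', N', c', hQ, hQT⟩ := hTn.exists_cut χt
  obtain ⟨κ, hκ, hκw⟩ := exists_local_parametrix hFr hpar hsing φt (ρ := ρ / 2) (by positivity)
    hφ1 (4 * ρ)
  -- the localized remainder and the localized right-hand side
  let a : Idx → Sm n := fun ε =>
    ⟨fun x => β.1 x * κ ε x, (Sm.contDiff β).mul (contDiffOn_univ.1 (hκ.1 ε))⟩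
  have hac : ∀ ε, HasCompactSupport (a ε).1 := fun ε => hβc.mul_right
  have haR : (fun ε => (a ε).1) ∈ RB b (⊤ : Opens (Eu n)) := RB.smooth_mul hκ (Sm.contDiff β)
  let q : Idx → Sm n := fun ε =>
    ⟨fun x => χ.1 x * g ε x, contDiff_cutoff_mul V.isOpen (Sm.contDiff χ)
      (hχs.trans (hball _ le_rfl)) (hg.1 ε)⟩
  have hqc : ∀ ε, HasCompactSupport (q ε).1 := fun ε => hχc.mul_right
  have hqR : (fun ε => (q ε).1) ∈ RB b (⊤ : Opens (Eu n)) :=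
    RB.cutoff_mul hg (Sm.contDiff χ) hχc (hχs.trans (hball _ le_rfl))
  let I : Idx → Sm n →ₗ[ℂ] ℂ := fun ε => intFun (a ε).1 (Sm.contDiff (a ε)).continuous (hac ε)
  -- The defect in the identity `S ∘ ᵗP = δ + a`. The cutoff `β` makes `a` compactly supported
  -- without changing it on the nets that matter.
  let Err : Idx → Sm n →ₗ[ℂ] ℂ := fun ε =>
    S ε ∘ₗ Sm.dop P.support (cf P ε) - evalZero n - I ε
  have hErr : ∀ ε, IsDominated (Err ε) := fun ε =>
    (((hS.isDominated ε).comp_dop _ _).sub isDominated_evalZero).sub (isDominated_intFun _ _)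
  have hErr0 : ∀ w : EcM (⊤ : Opens (Eu n)),
      (∀ ε, tsupport (w.1 ε) ⊆ Metric.closedBall 0 (4 * ρ)) →
      IsNegligible fun ε => Err ε (testSm (w.1 ε)) := by
    intro w hw
    refine IsNegligible.congr' (hκw w hw) ((eventually_le_atZero η).mono fun ε hε => ?_)
    have e : ∫ x, κ ε x * w.1 ε x = ∫ x, β.1 x * κ ε x * w.1 ε x := by
      refine integral_congr_ae (.of_forall fun x => ?_)
      by_cases hx : x ∈ Metric.closedBall (0 : Eu n) (4 * ρ)
      · simp only [hβ1 x hx, one_mul]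
      · simp only [image_eq_zero_of_notMem_tsupport fun h => hx (hw ε h), mul_zero]
    rw [e]
    change _ = S ε (Sm.dop P.support (cf P ε) (testSm (w.1 ε))) - w.1 ε 0 -
      ∫ x, β.1 x * κ ε x * w.1 ε x
    rw [hSF ε hε]
    rfl
  let W : Opens (Eu n) := ⟨Metric.ball x₀ ρ, Metric.isOpen_ball⟩
  have hWΩ : W ≤ Ω := fun x hx =>
    hV (hball ρ (by linarith) (Metric.ball_subset_closedBall hx))
  refine ⟨W, hWΩ, Metric.mem_ball_self hρ,
    fun ε x => star (S ε ∘ₗ Sm.refl) (q ε) x - star (Q ε ∘ₗ Sm.refl) (a ε) x,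
    RB.mono (RB.sub (hS.comp_refl.star_mem hqR) (hQ.comp_refl.star_mem haR)) le_top, fun u => ?_⟩
  have hus : ∀ ε, tsupport (u.1 ε) ⊆ Metric.closedBall x₀ ρ := fun ε =>
    (u.1 ε).tsupport_subset.trans Metric.ball_subset_closedBall
  have hvs : ∀ ε, tsupport (star (S ε) (testSm (u.1 ε))) ⊆ Metric.closedBall x₀ (2 * ρ) := fun ε =>
    (tsupport_star_subset_closedBall (hS.2.2 ε) hφs (hus ε)).trans
      (Metric.closedBall_subset_closedBall (by linarith))
  let v : EcM V := EcM.ofSm (fun ε => ⟨star (S ε) (testSm (u.1 ε)), (hS.isDominated ε).contDiff_star _⟩)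
    (isCompact_closedBall x₀ (2 * ρ)) (hball _ (by linarith)) hvs (hS.star_mem (EcM.mem_RB u))
  -- The defect is negligible on each net supported in the ball of radius `4ρ`. Hence its
  -- convolution with `u` is negligible in every seminorm on the support of `χ`, and the moderate
  -- net `Q` preserves negligibility.
  have hneg1 : IsNegligible fun ε =>
      Q ε ⟨star (Err ε) (testSm (u.1 ε)), (hErr ε).contDiff_star _⟩ := by
    refine hQ.isNegligible (isNegligible_supNorm_star hErr hQ.1
      (isCompact_closedBall (0 : Eu n) (4 * ρ)) hErr0 j' (EcM.extend le_top u) ?_)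
    intro ε y hy z hz
    have h1 := mem_closedBall_iff_norm.1 (hχs hy)
    have h2 := mem_closedBall_iff_norm.1 (hus ε hz)
    rw [mem_closedBall_zero_iff]
    calc ‖z‖ = ‖(y + z - x₀) - (y - x₀)‖ := by congr 1; abel
      _ ≤ _ := (norm_sub_le _ _).trans (by linarith)
  -- Since `v` is supported in `V`, the hypothesis `P(D)T = g` on `V` may be tested on it.
  have hneg2 : IsNegligible fun ε =>
      Tn ε ((EcM.extend hV (opNet P v)).1 ε) - ∫ x in (V : Set (Eu n)), g ε x * v.1 ε x := by
    refine Represents.isNegligible_sub (hTr _) ?_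
    rw [extend_opNet, ← applyOp_mk]
    exact hgT v
  rw [restrict_mk]
  refine (hTr (EcM.extend hWΩ u)).of_isNegligible_sub (IsNegligible.congr' (hneg2.sub hneg1)
    ((eventually_le_atZero η').mono fun ε hε => ?_))
  have hQu : Tn ε ((EcM.extend hWΩ u).1 ε) = Q ε (testSm (u.1 ε)) := by
    rw [hQT ε hε]
    refine congrArg (Tn ε) (DFunLike.coe_injective (funext fun x => ?_))
    change u.1 ε x = χ.1 x * u.1 ε x
    by_cases hx : x ∈ Metric.closedBall x₀ (2 * ρ)
    · rw [hχ1 x hx, one_mul]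
    · rw [image_eq_zero_of_notMem_tsupport fun h =>
        hx (Metric.closedBall_subset_closedBall (by linarith) (hus ε h)), mul_zero]
  have hQv : Tn ε ((EcM.extend hV (opNet P v)).1 ε) =
      Q ε (Sm.dop P.support (cf P ε) (testSm (v.1 ε))) := by
    rw [hQT ε hε]
    refine congrArg (Tn ε) (DFunLike.coe_injective (funext fun x => ?_))
    change (opNet P v).1 ε x = χ.1 x * (Sm.dop P.support (cf P ε) (testSm (v.1 ε))).1 x
    rw [coe_opNet, coe_testOp, Sm.coe_dop]
    change dop P.support (cf P ε) (v.1 ε) x = χ.1 x * dop P.support (cf P ε) (v.1 ε) x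
    by_cases hx : x ∈ Metric.closedBall x₀ (2 * ρ)
    · rw [hχ1 x hx, one_mul]
    · have : dop P.support (cf P ε) (v.1 ε) x = 0 :=
        image_eq_zero_of_notMem_tsupport fun h => hx (hvs ε (tsupport_dop_subset _ _ _ h))
      rw [this, mul_zero]
  let k : Sm n := starSm (hac ε) (dominatedBy_intFun (Sm.contDiff (a ε)).continuous (hac ε))
    (testSm (u.1 ε))
  -- Convolution commutes with constant coefficient operators, and convolving with `δ` returns `u`;
  -- this turns the defect into the identity `ᵗP v - u - k`.
  have hstar : (⟨star (Err ε) (testSm (u.1 ε)), (hErr ε).contDiff_star _⟩ : Sm n) =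
      Sm.dop P.support (cf P ε) (testSm (v.1 ε)) - testSm (u.1 ε) - k := by
    refine Subtype.ext (funext fun y => ?_)
    change S ε (Sm.dop P.support (cf P ε) (Sm.shift y (testSm (u.1 ε)))) - u.1 ε (y + 0) -
      star (I ε) (testSm (u.1 ε)) y = (Sm.dop P.support (cf P ε) (testSm (v.1 ε))).1 y -
        u.1 ε y - star (I ε) (testSm (u.1 ε)) y
    rw [← Sm.shift_dop, add_zero, Sm.coe_dop]
    change _ = dop P.support (cf P ε) (star (S ε) (testSm (u.1 ε))) y - _ - _
    rw [(hS.isDominated ε).dop_star]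
    rfl
  have hgv : ∫ x in (V : Set (Eu n)), g ε x * v.1 ε x =
      ∫ x, u.1 ε x * star (S ε ∘ₗ Sm.refl) (q ε) x := by
    rw [setIntegral_mul_test]
    refine Eq.trans ?_ (apply_starSm_intFun hS.1 (mul_nonneg hS.2.1 (inv_coe_pow_pos ε N).le)
      (hS.2.2 ε) (hqc ε) (u := testSm (u.1 ε)) (u.1 ε).hasCompactSupport)
    rw [← integral_mul_star hS.1 (hS.2.2 ε)]
    refine integral_congr_ae (.of_forall fun x => ?_)
    change g ε x * star (S ε) (testSm (u.1 ε)) x = χ.1 x * g ε x * star (S ε) (testSm (u.1 ε)) x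
    by_cases hx : x ∈ Metric.closedBall x₀ (2 * ρ)
    · rw [hχ1 x hx, one_mul]
    · rw [image_eq_zero_of_notMem_tsupport fun h => hx (hvs ε h), mul_zero, mul_zero]
  have hk : Q ε k = ∫ x, u.1 ε x * star (Q ε ∘ₗ Sm.refl) (a ε) x :=
    apply_starSm_intFun hQ.1 (mul_nonneg hQ.2.1 (inv_coe_pow_pos ε N').le) (hQ.2.2 ε) (hac ε)
      (u := testSm (u.1 ε)) (u.1 ε).hasCompactSupport
  have hint : ∫ x in (W : Set (Eu n)), (star (S ε ∘ₗ Sm.refl) (q ε) x -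
      star (Q ε ∘ₗ Sm.refl) (a ε) x) * u.1 ε x =
      (∫ x, u.1 ε x * star (S ε ∘ₗ Sm.refl) (q ε) x) -
        ∫ x, u.1 ε x * star (Q ε ∘ₗ Sm.refl) (a ε) x := by
    rw [setIntegral_mul_test]
    simp only [mul_comm (u.1 ε _), sub_mul]
    exact integral_sub (integrable_mul_test ((hS.comp_refl.star_mem hqR).1 ε) _)
      (integrable_mul_test ((hQ.comp_refl.star_mem haR).1 ε) _)
  rw [hQu, hQv, hint, hstar, map_sub, map_sub, hgv, hk]
  ring

/-! ### The equivalence of the three conditions -/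

theorem singSupp_delta_subset {b : Bool} : singSupp (RB b) (delta n) ⊆ {0} := by
  rintro x ⟨-, h⟩
  by_contra hx
  refine h ⟨⟨{0}ᶜ, isOpen_compl_singleton⟩, le_top, hx, _, RB.zero, fun u => ?_⟩
  rw [restrict_mk]
  refine (represents_delta _).congr' (.of_forall fun ε => ?_)
  simp only [zero_mul, integral_zero]
  exact image_eq_zero_of_notMem_tsupport fun h => (u.1 ε).tsupport_subset h rfl

theorem tfae_isHypoelliptic (b : Bool) {P : MvPolynomial (Fin n) GenC}
    (hP : ∃ ξ : Eu n, IsUnit (tildeFn P ξ)) :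
    List.TFAE [
      IsHypoelliptic (RB b) P,
      ∃ E : Functional (⊤ : Opens (Eu n)),
        IsBasic E ∧ IsFundamentalSolution P E ∧ singSupp (RB b) E ⊆ {0},
      ∃ F : Functional (⊤ : Opens (Eu n)),
        IsBasic F ∧ IsParametrix (RB b) P F ∧ singSupp (RB b) F ⊆ {0}] := by
  tfae_have 1 → 2 := by
    intro h
    obtain ⟨E, hE, hPE⟩ := exists_basic_fundamentalSolution hP
    refine ⟨E, hE, hPE, ?_⟩
    -- Hypoellipticity is applied to `E` itself, replacing its singular support by that of `P(D)E =
    -- δ`.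
    rw [← h ⊤ E hE, show applyOp P E = delta n from hPE]
    exact singSupp_delta_subset
  tfae_have 2 → 3 := by
    rintro ⟨E, hE, hPE, hs⟩
    refine ⟨E, hE, ⟨_, RB.zero, fun u => ?_⟩, hs⟩
    rw [show applyOp P E = delta n from hPE, sub_self, LinearMap.zero_apply]
    simpa using represents_zero (𝕜 := ℂ)
  tfae_have 3 → 1 := by
    rintro ⟨F, hF, hpar, hs⟩ Ω T hT
    exact (singSupp_applyOp_subset T P).antisymm
      (singSupp_subset_of_isParametrix hF hpar hs hT)
  tfae_finish

end Colombeau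

end

open Colombeau in
theorem mainTheorem2 (n : ℕ) (P : MvPolynomial (Fin n) GenC)
    (hP : ∃ ξ : Eu n, IsUnit (tildeFn P ξ)) :
    List.TFAE [
      IsHypoelliptic EM P,
      ∃ E : Functional (⊤ : Opens (Eu n)),
        IsBasic E ∧ IsFundamentalSolution P E ∧ singSupp EM E ⊆ {0},
      ∃ F : Functional (⊤ : Opens (Eu n)),
        IsBasic F ∧ IsParametrix EM P F ∧ singSupp EM F ⊆ {0}] ∧
    List.TFAE [
      IsHypoelliptic EMinf P,
      ∃ E : Functional (⊤ : Opens (Eu n)),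
        IsBasic E ∧ IsFundamentalSolution P E ∧ singSupp EMinf E ⊆ {0},
      ∃ F : Functional (⊤ : Opens (Eu n)),
        IsBasic F ∧ IsParametrix EMinf P F ∧ singSupp EMinf F ⊆ {0}] := by
  rw [EM_eq_RB, EMinf_eq_RB]
  exact ⟨tfae_isHypoelliptic false hP, tfae_isHypoelliptic true hP⟩
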